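/- **Theorem.** Let $\mathbb{K}$ be a field of characteristic zero and let $A$ be a finite-dimensional $\mathbb{Z}/2$-graded unital cyclic $A_\infty$-algebra over $\mathbb{K}$ whose (symmetric, nondegenerate) inner product $\langle-,-\rangle$ is odd, with structure maps $m_k$, $k\ge 1$. Let $N\ge 0$ be an integer and let $V=\Sigma\,\mathfrak{gl}_N(A)$ be the suspension of $A\otimes \mathrm{Mat}_N(\mathbb{K})$, with the odd symplectic form obtained from the pairing $\langle a\otimes X,b\otimes Y\rangle=\langle a,b\rangle\operatorname{Tr}(XY)$. Let $$\mathfrak{h}=\mathbb{K}[[\hbar]]\,\widehat\otimes\,\widehat S V^*,\qquad \widehat S V^*=\prod_{n\ge 0}\big[(V^*)^{\otimes n}\big]_{S_n},$$ be the differential $\mathbb{Z}/2$-graded Lie algebra ($\hbar$ even) whose odd bracket $\{-,-\}$ is the $\hbar$-linear extension of the Poisson bracket determined by the inverse form $\langle-,-\rangle^{-1}$ on $V^*$ and whose differential is $d=\hbar\Delta$, where the BV Laplacian $\Delta$ is the operator that vanishes on constant and linear terms and satisfies $\Delta(ab)=(\Delta a)b+(-1)^a a(\Delta b)+\{a,b\}$.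 It is filtered by $F_p\mathfrak h=\hbar^p\mathfrak h$. Let $\mathfrak g=\mathfrak h^{\mathfrak{gl}_N(\mathbb K)}$ be the differential graded Lie subalgebra of invariants, with the induced filtration, for the action of $\mathfrak{gl}_N(\mathbb{K})$ by derivations of $\widehat SV^*$ induced by $M\cdot(a\otimes X)=a\otimes[M,X]$. Let $x_0\in\widehat SV^*$ be the ($\mathfrak{gl}_N(\mathbb K)$-invariant) element representing the cyclic commutator $L_\infty$-structure $l_N$ on $\mathfrak{gl}_N(A)$, that is, the image under the projection from cyclic to symmetric coinvariants of $\sum_{n\ge 2}\frac1n\alpha_n$, where $\alpha_{k+1}$ is the cyclically invariant tensor on $V$ corresponding, under the suspension, to the form $\langle m_k(y_0,\dots,y_{k-1}),y_k\rangle$ on $A\otimes\mathrm{Mat}_N(\mathbb K)$, for the structure maps $m_k$ tensored with matrix multiplication. For $\mathfrak k=\mathfrak g$ or $\mathfrak h$, a quantization of $x_0$ in $\mathfrak k$ is an even $x\in\mathfrak k$ with $dx+\frac12\{x,x\}=0$ and $x\equiv x_0$ modulo $\hbar$. The odd elements $y$ of $F_1\mathfrak k$ act on quantizations by $$\exp(y)\cdot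 x=x+\sum_{i\ge0}\frac{1}{(i+1)!}\{y,-\}^i\big(dy+\{y,x\}\big),$$ and the moduli space of quantizations of $x_0$ in $\mathfrak k$ is the quotient of the set of quantizations by this action. Then the inclusion $\mathfrak g\subset\mathfrak h$ induces a bijection from the moduli space of quantizations of $x_0$ in $\mathfrak g$ to the moduli space of quantizations of $x_0$ in $\mathfrak h$. Explicitly, for every quantization $x$ of $x_0$ in $\mathfrak{h}$ there is an odd $y\in F_1\mathfrak h$ such that $\exp(y)\cdot x$ is a $\mathfrak{gl}_N(\mathbb K)$-invariant quantization; and if $x',x''$ are invariant quantizations with $x''=\exp(y)\cdot x'$ for some odd $y\in F_1\mathfrak h$, then also $x''=\exp(z)\cdot x'$ for some odd $\mathfrak{gl}_N(\mathbb K)$-invariant $z\in F_1\mathfrak h$. -/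

import Mathlib

namespace BVQuant

/-! ## The completed symmetric algebra of the dual of a super vector space

`V` is a finite-dimensional super vector space with homogeneous basis `(e i)`, `i : I`, of
parities `p i`; the dual basis of `V^*` is `(x i)`. -/

section FormalFunctions

variable {K I : Type*} [Field K]

/-- The Koszul sign `(-1)^(a b)`. -/
def sgn (K : Type*) [Field K] (a b : ZMod 2) : K := (-1) ^ (a.val * b.val)

/-- The parity of the word `x_{w_1} ⋯ x_{w_n}`. -/
def wordParity (p : I → ZMod 2) (w : List I) : ZMod 2 := (w.map p).sum

/-- The completed symmetric algebra `Ŝ V^* = ∏ₙ S^n V^*`, where `S^n V^*` is realised, in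
characteristic zero, by the tensors in `(V^*)^{⊗ n}` that are invariant under the (Koszul-signed)
action of the symmetric group: the family `f` of the coefficients of such tensors in the words of
length `n = 0, 1, 2, …` represents the formal function
`∑ₙ (1/n!) ∑_{w_1, …, w_n} f [w_1, …, w_n] x_{w_1} ⋯ x_{w_n}`
(an invariant tensor `α` in `(V^*)^{⊗ n}` corresponds to the coinvariant tensor `α / n!`).
Equivalently `f [w_1, …, w_n]` is the value at `0` of `∂_{w_n} ⋯ ∂_{w_1}` applied to the formal
function, with left derivatives `∂_i = ∂/∂x_i`. -/
def FormalFunctions (K : Type*) [Field K] (p : I → ZMod 2) : Submodule K (List I → K) where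
  carrier := {f | ∀ (u : List I) (a b : I) (v : List I),
    f (u ++ a :: b :: v) = sgn K (p a) (p b) * f (u ++ b :: a :: v)}
  zero_mem' := by intro u a b v; simp
  add_mem' := by
    intro f g hf hg u a b v
    simp only [Pi.add_apply, hf u a b v, hg u a b v, mul_add]
  smul_mem' := by
    intro c f hf u a b v
    simp only [Pi.smul_apply, smul_eq_mul, hf u a b v]
    ring

/-- The left derivative `∂/∂x_i`, on Taylor coefficients. -/
def rawDeriv (i : I) (f : List I → K) : List I → K := fun w => f (i :: w)

/-- The operator equal to `(-1)^(q |f|)` on homogeneous `f`, on Taylor coefficients. -/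
def rawTwist (p : I → ZMod 2) (q : ZMod 2) (f : List I → K) : List I → K :=
  fun w => sgn K q (wordParity p w) * f w

/-- The product, on Taylor coefficients. It is determined by its constant term `f(0) g(0)` and by
the Leibniz rule `∂_i (f g) = (∂_i f) g + (-1)^(|i| |f|) f (∂_i g)`. -/
def rawMul (p : I → ZMod 2) : List I → (List I → K) → (List I → K) → K
  | [], f, g => f [] * g []
  | i :: w, f, g =>
      rawMul p w (rawDeriv i f) g + rawMul p w (rawTwist p (p i) f) (rawDeriv i g)

theorem sgn_comm (a b : ZMod 2) : sgn K a b = sgn K b a := by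
  simp only [sgn, mul_comm]

theorem sgn_mul_self (a b : ZMod 2) : sgn K a b * sgn K a b = 1 := by
  simp only [sgn, ← mul_pow]; simp

theorem sgn_add (a b c : ZMod 2) : sgn K a (b + c) = sgn K a b * sgn K a c := by
  have key : ∀ a b c : ZMod 2,
      (a.val * (b + c).val) % 2 = (a.val * b.val + a.val * c.val) % 2 := by decide
  simp only [sgn, ← pow_add]
  rw [neg_one_pow_eq_pow_mod_two, key, ← neg_one_pow_eq_pow_mod_two]

theorem rawDeriv_mem {p : I → ZMod 2} (i : I) {f : List I → K} (hf : f ∈ FormalFunctions K p) :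
    rawDeriv i f ∈ FormalFunctions K p := fun u a b v => hf (i :: u) a b v

theorem wordParity_swap (p : I → ZMod 2) (u : List I) (a b : I) (v : List I) :
    wordParity p (u ++ a :: b :: v) = wordParity p (u ++ b :: a :: v) := by
  simp only [wordParity, List.map_append, List.map_cons, List.sum_append, List.sum_cons]
  ring

theorem rawTwist_mem {p : I → ZMod 2} (q : ZMod 2) {f : List I → K}
    (hf : f ∈ FormalFunctions K p) : rawTwist p q f ∈ FormalFunctions K p := by
  intro u a b v
  simp only [rawTwist, hf u a b v, wordParity_swap p u a b v]
  ring

theorem rawMul_smul_left (p : I → ZMod 2) (w : List I) (c : K) (f g : List I → K) :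
    rawMul p w (c • f) g = c * rawMul p w f g := by
  induction w generalizing f g with
  | nil => simp [rawMul, mul_assoc]
  | cons i w ih =>
    have h1 : rawDeriv i (c • f) = c • rawDeriv i f := rfl
    have h2 : rawTwist p (p i) (c • f) = c • rawTwist p (p i) f := by
      funext w; simp only [rawTwist, Pi.smul_apply, smul_eq_mul]; ring
    simp only [rawMul, h1, h2, ih]
    ring

theorem rawMul_smul_right (p : I → ZMod 2) (w : List I) (c : K) (f g : List I → K) :
    rawMul p w f (c • g) = c * rawMul p w f g := by
  induction w generalizing f g with
  | nil => simp [rawMul]; ring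
  | cons i w ih =>
    have h1 : rawDeriv i (c • g) = c • rawDeriv i g := rfl
    simp only [rawMul, h1, ih]
    ring

theorem rawDeriv_rawTwist (p : I → ZMod 2) (i : I) (q : ZMod 2) (f : List I → K) :
    rawDeriv i (rawTwist p q f) = sgn K q (p i) • rawTwist p q (rawDeriv i f) := by
  funext w
  simp only [rawDeriv, rawTwist, wordParity, List.map_cons, List.sum_cons, Pi.smul_apply,
    smul_eq_mul, sgn_add]
  ring

theorem rawTwist_comm (p : I → ZMod 2) (q r : ZMod 2) (f : List I → K) :
    rawTwist p q (rawTwist p r f) = rawTwist p r (rawTwist p q f) := by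
  funext w; simp only [rawTwist]; ring

theorem rawDeriv_comm {p : I → ZMod 2} (a b : I) {f : List I → K}
    (hf : f ∈ FormalFunctions K p) :
    rawDeriv b (rawDeriv a f) = sgn K (p a) (p b) • rawDeriv a (rawDeriv b f) := by
  funext w; exact hf [] a b w

theorem rawMul_mem {p : I → ZMod 2} {f g : List I → K} (hf : f ∈ FormalFunctions K p)
    (hg : g ∈ FormalFunctions K p) : (fun w => rawMul p w f g) ∈ FormalFunctions K p := by
  intro u a b v
  change rawMul p (u ++ a :: b :: v) f g = sgn K (p a) (p b) * rawMul p (u ++ b :: a :: v) f g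
  induction u generalizing f g with
  | nil =>
    simp only [List.nil_append, rawMul]
    rw [rawDeriv_comm a b hf, rawDeriv_comm a b hg, rawDeriv_rawTwist, rawDeriv_rawTwist,
      rawTwist_comm p (p b) (p a)]
    simp only [rawMul_smul_left, rawMul_smul_right, sgn_comm (p b) (p a)]
    have h := sgn_mul_self (K := K) (p a) (p b)
    linear_combination (-rawMul p v (rawTwist p (p b) (rawDeriv a f)) (rawDeriv b g)) * h
  | cons i u ih =>
    simp only [List.cons_append, rawMul]
    rw [ih (rawDeriv_mem i hf) hg, ih (rawTwist_mem (p i) hf) (rawDeriv_mem i hg)]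
    ring

namespace FormalFunctions

variable {p : I → ZMod 2}

/-- The left derivative `∂/∂x_i`. -/
def deriv (i : I) (f : FormalFunctions K p) : FormalFunctions K p :=
  ⟨rawDeriv i f, rawDeriv_mem i f.2⟩

/-- The operator equal to `(-1)^(q |f|)` on homogeneous `f`. -/
def twist (q : ZMod 2) (f : FormalFunctions K p) : FormalFunctions K p :=
  ⟨rawTwist p q f, rawTwist_mem q f.2⟩

/-- The (super)commutative product of `Ŝ V^*`. -/
def mul (f g : FormalFunctions K p) : FormalFunctions K p :=
  ⟨fun w => rawMul p w f g, rawMul_mem f.2 g.2⟩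

/-- The unit of `Ŝ V^*`. -/
def one : FormalFunctions K p :=
  ⟨fun w => if w = [] then 1 else 0, by intro u a b v; simp⟩

open Classical in
/-- The linear coordinate function `x_i`. -/
noncomputable def coord (i : I) : FormalFunctions K p :=
  ⟨fun w => if w = [i] then 1 else 0, by
    intro u a b v
    have h (c d : I) : u ++ c :: d :: v ≠ [i] := by
      intro h
      have := congrArg List.length h
      simp at this
      omega
    simp [h]⟩

/-- The commutative word `x_{w_1} ⋯ x_{w_n}`. -/
noncomputable def word : List I → FormalFunctions K p
  | [] => one
  | i :: w => mul (coord i) (word w)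

/-- The formal sum `∑ₙ g n` of a sequence whose `n`-th term is homogeneous of polynomial
degree `n`. -/
def formalSum (g : ℕ → FormalFunctions K p) : FormalFunctions K p :=
  ⟨fun w => (g w.length : List I → K) w, by
    intro u a b v
    have h : (u ++ a :: b :: v).length = (u ++ b :: a :: v).length := by simp
    simp only [h]
    exact (g _).2 u a b v⟩

/-- `f` has parity `q`. -/
def HasParity (q : ZMod 2) (f : FormalFunctions K p) : Prop :=
  ∀ w, wordParity p w ≠ q → (f : List I → K) w = 0

end FormalFunctions

/-- The derivation determined by `x_J ↦ ∑ L, c J L • x_L`, on Taylor coefficients: the sum, over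
the letters of the word, of the effect of replacing the letter `i` by `∑ J, c J i • J`. -/
def rawLinAct [Fintype I] (c : Matrix I I K) : List I → (List I → K) → K
  | [], _ => 0
  | i :: w, f => (∑ J, c J i * f (J :: w)) + rawLinAct c w (rawDeriv i f)

theorem rawLinAct_smul [Fintype I] (c : Matrix I I K) (w : List I) (t : K) (f : List I → K) :
    rawLinAct c w (t • f) = t * rawLinAct c w f := by
  induction w generalizing f with
  | nil => simp [rawLinAct]
  | cons i w ih =>
    have h1 : rawDeriv i (t • f) = t • rawDeriv i f := rfl
    simp only [rawLinAct, h1, ih, Pi.smul_apply, smul_eq_mul, mul_add, Finset.mul_sum]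
    congr 1
    exact Finset.sum_congr rfl fun J _ => by ring

theorem rawLinAct_mem [Fintype I] {p : I → ZMod 2} {c : Matrix I I K}
    (hc : ∀ J i, p J ≠ p i → c J i = 0) {f : List I → K} (hf : f ∈ FormalFunctions K p) :
    (fun w => rawLinAct c w f) ∈ FormalFunctions K p := by
  have key (J i : I) (s t : K) (h : p J = p i → s = t) : c J i * s = c J i * t := by
    by_cases hJ : p J = p i
    · rw [h hJ]
    · rw [hc J i hJ]; simp
  intro u a b v
  change rawLinAct c (u ++ a :: b :: v) f = sgn K (p a) (p b) * rawLinAct c (u ++ b :: a :: v) f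
  induction u generalizing f with
  | nil =>
    simp only [List.nil_append, rawLinAct]
    rw [rawDeriv_comm a b hf, rawLinAct_smul]
    have h1 : ∑ J, c J a * f (J :: b :: v)
        = sgn K (p a) (p b) * ∑ J, c J a * rawDeriv b f (J :: v) := by
      rw [Finset.mul_sum]
      refine Finset.sum_congr rfl fun J _ => ?_
      rw [mul_left_comm]
      exact key J a _ _ fun hJ => by rw [← hJ]; exact hf [] J b v
    have h2 : ∑ J, c J b * rawDeriv a f (J :: v)
        = sgn K (p a) (p b) * ∑ J, c J b * f (J :: a :: v) := by
      rw [Finset.mul_sum]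
      refine Finset.sum_congr rfl fun J _ => ?_
      rw [mul_left_comm]
      exact key J b _ _ fun hJ => by rw [← hJ]; exact hf [] a J v
    rw [h1, h2]
    ring
  | cons i u ih =>
    simp only [List.cons_append, rawLinAct]
    rw [ih (rawDeriv_mem i hf), mul_add, Finset.mul_sum]
    congr 1
    refine Finset.sum_congr rfl fun J _ => ?_
    have := hf (J :: u) a b v
    simp only [List.cons_append] at this
    rw [this]
    ring

/-- The even derivation of the algebra `Ŝ V^*` with `x_J ↦ ∑ L, c J L • x_L`, where `c` is an even
endomorphism of `V`. -/
def FormalFunctions.linAct [Fintype I] {p : I → ZMod 2} (c : Matrix I I K)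
    (hc : ∀ J i, p J ≠ p i → c J i = 0) (f : FormalFunctions K p) : FormalFunctions K p :=
  ⟨fun w => rawLinAct c w f, rawLinAct_mem hc f.2⟩

end FormalFunctions

/-! ## The commutative Batalin-Vilkovisky formalism -/

section BV

open FormalFunctions

variable {K I : Type*} [Field K] [Fintype I] {p : I → ZMod 2}

/-- The inverse form `P i j = ⟨x_i, x_j⟩⁻¹` on `V^*` of an odd symplectic form on `V` with Gram
matrix `ω i j = ⟨e_i, e_j⟩`. It is characterised by `⟨D_l u, D_r v⟩⁻¹ = (-1)^|u| ⟨u, v⟩`, where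
`D_l u = ⟨u, -⟩` and `D_r v = ⟨-, v⟩` (the sign being the Koszul sign of `D_l ⊗ D_r`), that is by
`ω P ω = ((-1)^(p i) ω i j)`. -/
noncomputable def inverseForm [DecidableEq I] (p : I → ZMod 2) (ω : Matrix I I K) :
    Matrix I I K :=
  Matrix.of fun i j => ω⁻¹ i j * (-1) ^ (p j).val

/-- The odd Poisson bracket on `Ŝ V^*` extending the inverse form `P` by the Leibniz rule. -/
def poisson (P : Matrix I I K) (f g : FormalFunctions K p) : FormalFunctions K p :=
  ∑ k, ∑ l, P k l • mul (deriv k (twist (p l) f)) (deriv l g)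

/-- The BV Laplacian: the second order operator that vanishes on `1` and on the `x_i` and has
`Δ (x_i x_j) = ⟨x_i, x_j⟩⁻¹`; it satisfies
`Δ (f g) = (Δ f) g + (-1)^|f| f (Δ g) + {f, g}`. -/
def laplacian (P : Matrix I I K) (f : FormalFunctions K p) : FormalFunctions K p :=
  (2 : K)⁻¹ • ∑ k, ∑ l, P k l • deriv k (deriv l f)

/-- The underlying space `K[[ħ]] ⊗̂ Ŝ V^*` of the commutative BV differential graded Lie algebra:
`x n` is the coefficient of `ħ^n`, and `ħ` is even. -/
abbrev ComBV (K : Type*) {I : Type*} [Field K] (p : I → ZMod 2) : Type _ :=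
  ℕ → FormalFunctions K p

/-- The odd Lie bracket: the `ħ`-linear extension of the Poisson bracket. -/
def bracket (P : Matrix I I K) (x y : ComBV K p) : ComBV K p :=
  fun n => ∑ ij ∈ Finset.HasAntidiagonal.antidiagonal n, poisson P (x ij.1) (y ij.2)

/-- The differential `d = ħ Δ`. -/
def differential (P : Matrix I I K) (x : ComBV K p) : ComBV K p
  | 0 => 0
  | n + 1 => laplacian P (x n)

/-- The submodule `F_m = ħ^m K[[ħ]] ⊗̂ Ŝ V^*` of the filtration by powers of `ħ`. -/
def filtration (K : Type*) {I : Type*} [Field K] (p : I → ZMod 2) (m : ℕ) :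
    Submodule K (ComBV K p) where
  carrier := {x | ∀ n < m, x n = 0}
  zero_mem' := fun _ _ => rfl
  add_mem' := by
    intro x y hx hy n hn
    simp only [Pi.add_apply, hx n hn, hy n hn, add_zero]
  smul_mem' := by
    intro c x hx n hn
    simp only [Pi.smul_apply, hx n hn, smul_zero]

/-- `x` has parity `q`. -/
def IsOfParity (q : ZMod 2) (x : ComBV K p) : Prop := ∀ n, FormalFunctions.HasParity q (x n)

/-- The Maurer-Cartan equation (quantum master equation) `d x + ½ {x, x} = 0`. -/
def IsMaurerCartan (P : Matrix I I K) (x : ComBV K p) : Prop :=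
  differential P x + (2 : K)⁻¹ • bracket P x x = 0

/-- The gauge action `exp(y) · x = x + ∑_{i ≥ 0} 1/(i+1)! {y, -}^i (d y + {y, x})` for `y` in
`F_1`. The `i`-th summand lies in `F_i`, so only the summands with `i ≤ n` contribute to the
coefficient of `ħ^n`. -/
noncomputable def gaugeAct (P : Matrix I I K) (y x : ComBV K p) : ComBV K p :=
  fun n => x n + ∑ i ∈ Finset.range (n + 1),
    ((i + 1).factorial : K)⁻¹ • ((bracket P y)^[i] (differential P y + bracket P y x)) n

/-- The quantizations, in a differential graded Lie subalgebra `U` of `K[[ħ]] ⊗̂ Ŝ V^*` (with the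
induced filtration `U ∩ F_m`), of an element `x₀` of `Ŝ V^*`: the Maurer-Cartan elements (of even
parity) of `U` that reduce to `x₀` modulo `ħ`. -/
def Quantization (P : Matrix I I K) (U : Submodule K (ComBV K p)) (x₀ : FormalFunctions K p) :
    Type _ :=
  {x : ComBV K p // x ∈ U ∧ IsOfParity 0 x ∧ IsMaurerCartan P x ∧ x 0 = x₀}

/-- Two quantizations in `U` are gauge equivalent if `x' = exp(y) · x` for an odd element `y`
of `U ∩ F_1`. -/
def GaugeEquiv (P : Matrix I I K) (U : Submodule K (ComBV K p)) {x₀ : FormalFunctions K p}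
    (x x' : Quantization P U x₀) : Prop :=
  ∃ y : ComBV K p, y ∈ U ∧ y ∈ filtration K p 1 ∧ IsOfParity 1 y ∧ x'.1 = gaugeAct P y x.1

/-- The moduli space of quantizations of `x₀` in `U`: the quotient of the set of quantizations by
the gauge action of the odd part of `U ∩ F_1`. -/
def Moduli (P : Matrix I I K) (U : Submodule K (ComBV K p)) (x₀ : FormalFunctions K p) : Type _ :=
  Quot (GaugeEquiv P U (x₀ := x₀))

/-- A quantization in `U` is a quantization in any larger `U'`. -/
def Quantization.incl (P : Matrix I I K) {U U' : Submodule K (ComBV K p)} (h : U ≤ U')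
    {x₀ : FormalFunctions K p} (x : Quantization P U x₀) : Quantization P U' x₀ :=
  ⟨x.1, h x.2.1, x.2.2⟩

/-- The map of moduli spaces induced by the inclusion of `U` into `U'`. -/
def Moduli.incl (P : Matrix I I K) {U U' : Submodule K (ComBV K p)} (h : U ≤ U')
    (x₀ : FormalFunctions K p) : Moduli P U x₀ → Moduli P U' x₀ :=
  Quot.map (Quantization.incl P h) fun _ _ ⟨y, hy, hy'⟩ => ⟨y, h hy, hy'⟩

end BV

/-! ## Cyclic `A∞`-algebras -/

section AInfinity

variable {K A : Type*} [Field K] [AddCommGroup A] [Module K A]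

/-- The grading involution, `a ↦ (-1)^|a| a`. -/
def gradingInvolution (𝒜 : ZMod 2 → Submodule K A) [DirectSum.Decomposition 𝒜] (a : A) : A :=
  (DirectSum.decompose 𝒜 a 0 : A) - (DirectSum.decompose 𝒜 a 1 : A)

/-- `m_k (a_1, …, a_k)` for a list `[a_1, …, a_k]`. -/
def applyList (m : ∀ k : ℕ, MultilinearMap K (fun _ : Fin k => A) A) (l : List A) : A :=
  m l.length fun j => l.get j

/-- The maps `m_k : A^{⊗ k} → A`, `k ≥ 1` (with `m_0 = 0`), are the structure maps of a
`ℤ/2`-graded `A∞`-algebra: `m_k` has degree `2 - k`, and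
`∑_{r+s+t=n} (-1)^(r+st) m_{r+1+t} (1^{⊗ r} ⊗ m_s ⊗ 1^{⊗ t}) = 0` for all `n`, where the Koszul
rule gives the sign `(-1)^(s (|a_1|+…+|a_r|))` on `a_1 ⊗ ⋯ ⊗ a_n`. -/
structure IsAInfinity (𝒜 : ZMod 2 → Submodule K A) [DirectSum.Decomposition 𝒜]
    (m : ∀ k : ℕ, MultilinearMap K (fun _ : Fin k => A) A) : Prop where
  zero : m 0 = 0
  degree : ∀ (k : ℕ) (q : Fin k → ZMod 2) (a : Fin k → A), (∀ j, a j ∈ 𝒜 (q j)) →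
    m k a ∈ 𝒜 ((k : ZMod 2) + ∑ j, q j)
  relation : ∀ l : List A,
    ∑ r ∈ Finset.range (l.length + 1), ∑ s ∈ Finset.Icc 1 (l.length - r),
      (-1 : K) ^ (r + s * (l.length - r - s)) •
        applyList m ((l.take r).map (gradingInvolution 𝒜)^[s] ++
          applyList m ((l.drop r).take s) :: l.drop (r + s)) = 0

/-- The `A∞`-structure is (strictly) unital. -/
def IsUnital (m : ∀ k : ℕ, MultilinearMap K (fun _ : Fin k => A) A) : Prop :=
  ∃ e : A, (∀ a, m 2 ![e, a] = a ∧ m 2 ![a, e] = a) ∧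
    ∀ k, k ≠ 2 → ∀ a : Fin k → A, (∃ j, a j = e) → m k a = 0

/-- `B` is an odd nondegenerate (graded) symmetric bilinear form. -/
structure IsOddInnerProduct (𝒜 : ZMod 2 → Submodule K A) (B : LinearMap.BilinForm K A) :
    Prop where
  odd : ∀ (i j : ZMod 2) (a b : A), a ∈ 𝒜 i → b ∈ 𝒜 j → i + j ≠ 1 → B a b = 0
  symm : ∀ (i j : ZMod 2) (a b : A), a ∈ 𝒜 i → b ∈ 𝒜 j → B a b = sgn K i j * B b a
  nondegenerate : B.Nondegenerate

/-- The structure maps are cyclic: the forms `⟨m_k (a_0, …, a_{k-1}), a_k⟩` are (graded)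
antisymmetric under cyclic permutations of `a_0, …, a_k`. -/
def IsCyclicStructure (𝒜 : ZMod 2 → Submodule K A) (B : LinearMap.BilinForm K A)
    (m : ∀ k : ℕ, MultilinearMap K (fun _ : Fin k => A) A) : Prop :=
  ∀ k, 1 ≤ k → ∀ (q : Fin (k + 1) → ZMod 2) (a : Fin (k + 1) → A), (∀ j, a j ∈ 𝒜 (q j)) →
    B (m k (Fin.init a)) (a (Fin.last k)) =
      (-1 : K) ^ k * sgn K (q 0) (∑ j, Fin.tail q j) * B (m k (Fin.tail a)) (a 0)

/-! ## Matrices over a cyclic `A∞`-algebra -/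

/-- The structure map of `Mat_N(A) = A ⊗ Mat_N(K)`, namely `m_k` tensored with
`X_1 ⊗ ⋯ ⊗ X_k ↦ X_1 ⋯ X_k`: the sum is over the paths `r = t_0, t_1, …, t_k = s`. -/
def matrixStructure (m : ∀ k : ℕ, MultilinearMap K (fun _ : Fin k => A) A) (N k : ℕ)
    (X : Fin k → Matrix (Fin N) (Fin N) A) : Matrix (Fin N) (Fin N) A :=
  Matrix.of fun r s => ∑ t : Fin (k + 1) → Fin N,
    if t 0 = r ∧ t (Fin.last k) = s then m k fun j => X j (t j.castSucc) (t j.succ) else 0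

/-- The pairing `⟨a ⊗ X, b ⊗ Y⟩ = ⟨a, b⟩ Tr (X Y)` on `Mat_N(A)`. -/
def matrixPairing (B : LinearMap.BilinForm K A) (N : ℕ) (X Y : Matrix (Fin N) (Fin N) A) : K :=
  ∑ r, ∑ s, B (X r s) (Y s r)

variable {ι : Type*}

/-- The index set of the basis `b_i ⊗ E_{rs}` of `Mat_N(A)`, given a basis `(b_i)` of `A`. -/
abbrev MatIndex (ι : Type*) (N : ℕ) : Type _ := ι × Fin N × Fin N

/-- The basis vector `b_i ⊗ E_{rs}` of `Mat_N(A)`. -/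
noncomputable def matBasis (b : Module.Basis ι K A) {N : ℕ} (J : MatIndex ι N) : Matrix (Fin N) (Fin N) A :=
  Matrix.single J.2.1 J.2.2 (b J.1)

/-- The parities of the basis `Σ (b_i ⊗ E_{rs})` of the suspension `Σ gl_N(A)`, where `b_i` has
parity `π i`. -/
def shiftParity (π : ι → ZMod 2) (N : ℕ) (J : MatIndex ι N) : ZMod 2 := π J.1 + 1

/-- The Gram matrix of the odd symplectic form `⟨Σ y, Σ z⟩ = (-1)^|y| ⟨y, z⟩` on `Σ gl_N(A)`. -/
noncomputable def sympGram (B : LinearMap.BilinForm K A) (b : Module.Basis ι K A) (π : ι → ZMod 2) (N : ℕ) :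
    Matrix (MatIndex ι N) (MatIndex ι N) K :=
  Matrix.of fun J L => (-1) ^ (π J.1).val * matrixPairing B N (matBasis b J) (matBasis b L)

/-- The inverse form on the dual of `Σ gl_N(A)`. -/
noncomputable def glForm [Fintype ι] [DecidableEq ι] (B : LinearMap.BilinForm K A)
    (b : Module.Basis ι K A) (π : ι → ZMod 2) (N : ℕ) :
    Matrix (MatIndex ι N) (MatIndex ι N) K :=
  inverseForm (shiftParity π N) (sympGram B b π N)

/-- The coefficients of the tensor in `((Σ Mat_N(A))^*)^{⊗ (k+1)}` that corresponds, under the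
suspension, to the form `⟨m_k (y_0, …, y_{k-1}), y_k⟩` on `Mat_N(A)`; the sign is that of
`(Σ ⊗ ⋯ ⊗ Σ) (y_0 ⊗ ⋯ ⊗ y_k) = (-1)^(∑ (k - j) |y_j|) Σ y_0 ⊗ ⋯ ⊗ Σ y_k`. -/
noncomputable def cyclicTensor (B : LinearMap.BilinForm K A)
    (m : ∀ k : ℕ, MultilinearMap K (fun _ : Fin k => A) A) (b : Module.Basis ι K A)
    (π : ι → ZMod 2) (N k : ℕ) (w : Fin (k + 1) → MatIndex ι N) : K :=
  (-1) ^ (∑ j : Fin (k + 1), (k - (j : ℕ)) * (π (w j).1).val) *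
    matrixPairing B N (matrixStructure m N k fun j => matBasis b (w j.castSucc))
      (matBasis b (w (Fin.last k)))

/-- The element of `Ŝ (Σ gl_N(A))^*` representing the commutator cyclic `L∞`-structure `l_N`: the
image, under the projection from cyclic words to commutative words, of the element
`∑_{n ≥ 2} (1/n) α_n` representing the cyclic `A∞`-structure of `Mat_N(A)`, where `α_{k+1}` is the
cyclic tensor of `⟨m_k (y_0, …, y_{k-1}), y_k⟩`. -/
noncomputable def lTilde [Fintype ι] (B : LinearMap.BilinForm K A)
    (m : ∀ k : ℕ, MultilinearMap K (fun _ : Fin k => A) A) (b : Module.Basis ι K A)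
    (π : ι → ZMod 2) (N : ℕ) : FormalFunctions K (shiftParity π N) :=
  FormalFunctions.formalSum fun n =>
    match n with
    | 0 => 0
    | 1 => 0
    | k + 2 => ((k + 2 : ℕ) : K)⁻¹ • ∑ w : Fin (k + 1 + 1) → MatIndex ι N,
        cyclicTensor B m b π N (k + 1) w • FormalFunctions.word (List.ofFn w)

/-- The matrix of `a ⊗ X ↦ a ⊗ [M, X]` in the basis `b_i ⊗ E_{rs}`. -/
def adMatrix (ι : Type*) [DecidableEq ι] {N : ℕ} (M : Matrix (Fin N) (Fin N) K) :
    Matrix (MatIndex ι N) (MatIndex ι N) K :=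
  Matrix.of fun J L => if J.1 = L.1 then
    (M * Matrix.single L.2.1 L.2.2 (1 : K) - Matrix.single L.2.1 L.2.2 (1 : K) * M :
      Matrix (Fin N) (Fin N) K) J.2.1 J.2.2 else 0

theorem adMatrix_even [DecidableEq ι] (π : ι → ZMod 2) {N : ℕ} (M : Matrix (Fin N) (Fin N) K)
    (J L : MatIndex ι N) (h : shiftParity π N J ≠ shiftParity π N L) :
    (-adMatrix ι M) J L = 0 := by
  have h' : J.1 ≠ L.1 := fun e => h (by simp [shiftParity, e])
  simp [adMatrix, h']

/-- The action of `M` in `gl_N(K)` on `Ŝ (Σ gl_N(A))^*` by derivations, dual to the conjugation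
action `a ⊗ X ↦ a ⊗ [M, X]`. -/
def glAct [Fintype ι] [DecidableEq ι] (π : ι → ZMod 2) {N : ℕ} (M : Matrix (Fin N) (Fin N) K)
    (f : FormalFunctions K (shiftParity π N)) : FormalFunctions K (shiftParity π N) :=
  FormalFunctions.linAct (-adMatrix ι M) (adMatrix_even π M) f

theorem rawLinAct_add {I : Type*} [Fintype I] (c : Matrix I I K) (w : List I)
    (f g : List I → K) : rawLinAct c w (f + g) = rawLinAct c w f + rawLinAct c w g := by
  induction w generalizing f g with
  | nil => simp [rawLinAct]
  | cons i w ih =>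
    have h1 : rawDeriv i (f + g) = rawDeriv i f + rawDeriv i g := rfl
    simp only [rawLinAct, h1, ih, Pi.add_apply, mul_add, Finset.sum_add_distrib]
    ring

/-- The `gl_N(K)`-invariants of `K[[ħ]] ⊗̂ Ŝ (Σ gl_N(A))^*`. -/
def invariants (K : Type*) [Field K] [Fintype ι] [DecidableEq ι] (π : ι → ZMod 2) (N : ℕ) :
    Submodule K (ComBV K (shiftParity π N)) where
  carrier := {x | ∀ (n : ℕ) (M : Matrix (Fin N) (Fin N) K), glAct π M (x n) = 0}
  zero_mem' := by
    intro n M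
    ext w
    have := rawLinAct_smul (-adMatrix ι M) w (0 : K) 0
    simpa [glAct, FormalFunctions.linAct] using this
  add_mem' := by
    intro x y hx hy n M
    have h1 := congrArg Subtype.val (hx n M)
    have h2 := congrArg Subtype.val (hy n M)
    ext w
    have := rawLinAct_add (-adMatrix ι M) w (x n : List (MatIndex ι N) → K) (y n)
    have h1' := congrFun h1 w
    have h2' := congrFun h2 w
    simp only [glAct, FormalFunctions.linAct] at h1' h2' ⊢
    simpa [h1', h2'] using this
  smul_mem' := by
    intro c x hx n M
    have h1 := congrArg Subtype.val (hx n M)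
    ext w
    have := rawLinAct_smul (-adMatrix ι M) w c (x n : List (MatIndex ι N) → K)
    have h1' := congrFun h1 w
    simp only [glAct, FormalFunctions.linAct] at h1' ⊢
    simpa [h1'] using this

end AInfinity

end BVQuant

open BVQuant

open BVQuant

/-! Write δ = {x₀, -} on Ŝ V^*, and let C_rs be the contraction with Σ(e ⊗ E_rs), where e is the
unit of A. It is an odd derivation of the bracket. Because e is a strict unit and the structure is
cyclic, C_rs x₀ receives a contribution from m_2 only. It is a quadratic function, equal to the
symplectic form composed with ad E_rs, so it is up to sign a Hamiltonian for the action L_rs of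
E_rs. Applying C_rs to δ f therefore gives Cartan's formula L_rs = C_rs δ + δ C_rs: gl_N acts
trivially on δ-cohomology (`isCartan_unitContraction`, `IsCartan.glHom_eq_contract`).

Projection to invariants is obtained from the Casimir operator Ω = ∑ L_rs L_sr. The matrices of the
action are rational and L_sr is the transpose of L_rs for the standard pairing of coefficients,
which is positive definite over ℚ. Hence ker Ω is the space of invariants and ker Ω² = ker Ω. In
each polynomial degree the space is finite-dimensional, so it splits as ker Ω ⊕ im Ω
(`exists_isInvariant_sub_glCasimir`). Cartan's formula makes Ω null-homotopic for δ, and the two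
facts combine into the key statement `IsCartan.exists_sub_twisted_invariant`: if δ c is invariant,
then c becomes invariant after subtracting some δ s.

Both halves of the theorem follow by induction on the power of ħ. For existence, the Maurer-Cartan
equation expresses δ x_{n+1} through lower coefficients; when these are invariant, x_{n+1} can be
made invariant by changing the gauge parameter at order n+1 (`IsCartan.exists_gaugeAct_invariant`).
For uniqueness, if x' = exp(z) · x with x, x' invariant and z invariant below order n+1, then δ
z_{n+1} is invariant. A correction of z_{n+1} by a δ-exact term is realised by composing with a
gauge transformation dW + {x', W}, which stabilises x' (`IsCartan.exists_invariant_gaugeAct`).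

The second induction needs composition of gauge transformations. Adjoining Δ to Ŝ V^* turns the
affine gauge action into the linear action of exp(ad y) on x + ħΔ (`seriesAct_gauge`), and
composition becomes the Campbell-Hausdorff theorem for power series of operators
(`exists_expSeries_mul`, `exists_gaugeAct_comp`). -/

namespace BVQuant

/-! ## Exponentials of power series over a noncommutative algebra -/

section DividedPowers

variable {K R : Type*} [Field K] [Ring R] [Algebra K R]

/-- The divided power `Y ^ n / n!`. -/
noncomputable def dividedPower (K : Type*) [Field K] {R : Type*} [Ring R] [Algebra K R] (Y : R)
    (n : ℕ) : R :=
  ((n.factorial : K)⁻¹) • Y ^ n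

theorem dividedPower_zero (Y : R) : dividedPower K Y 0 = 1 := by simp [dividedPower]

variable [CharZero K]

/-- The weight n+1 is split as i+j, and each half loses its boundary term, where the weight is zero.
This plays the role of differentiation in a formal parameter, and lets the inductions on divided
powers advance by one step. -/
theorem sum_antidiagonal_succ_smul {M : Type*} [AddCommGroup M] [Module K M] (n : ℕ)
    (f : ℕ → ℕ → M) :
    ((n + 1 : ℕ) : K) • ∑ x ∈ Finset.HasAntidiagonal.antidiagonal (n + 1), f x.1 x.2 =
      ∑ x ∈ Finset.HasAntidiagonal.antidiagonal n,
        (((x.1 + 1 : ℕ) : K) • f (x.1 + 1) x.2 + ((x.2 + 1 : ℕ) : K) • f x.1 (x.2 + 1)) := by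
  have h : ((n + 1 : ℕ) : K) • ∑ x ∈ Finset.HasAntidiagonal.antidiagonal (n + 1), f x.1 x.2 =
      ∑ x ∈ Finset.HasAntidiagonal.antidiagonal (n + 1),
        ((x.1 : K) • f x.1 x.2 + (x.2 : K) • f x.1 x.2) := by
    rw [Finset.smul_sum]
    refine Finset.sum_congr rfl fun x hx => ?_
    rw [Finset.HasAntidiagonal.mem_antidiagonal] at hx
    rw [← add_smul, ← hx]
    push_cast
    rfl
  rw [h, Finset.sum_add_distrib, Finset.sum_add_distrib, Finset.Nat.sum_antidiagonal_succ]
  rw [Finset.Nat.sum_antidiagonal_succ' (f := fun x : ℕ × ℕ => (x.2 : K) • f x.1 x.2)]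
  simp

theorem factorial_succ_inv (n : ℕ) :
    ((n + 1 : ℕ) : K) * (((n + 1).factorial : K)⁻¹) = ((n.factorial : K)⁻¹) := by
  have h1 : ((n + 1 : ℕ) : K) ≠ 0 := Nat.cast_ne_zero.2 n.succ_ne_zero
  rw [Nat.factorial_succ, Nat.cast_mul, mul_inv, ← mul_assoc, mul_inv_cancel₀ h1, one_mul]

theorem smul_dividedPower_succ (Y : R) (n : ℕ) :
    ((n + 1 : ℕ) : K) • dividedPower K Y (n + 1) = Y * dividedPower K Y n := by
  rw [dividedPower, smul_smul, factorial_succ_inv, dividedPower, pow_succ', mul_smul_comm]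

theorem smul_dividedPower_succ' (Y : R) (n : ℕ) :
    ((n + 1 : ℕ) : K) • dividedPower K Y (n + 1) = dividedPower K Y n * Y := by
  rw [dividedPower, smul_smul, factorial_succ_inv, dividedPower, pow_succ, smul_mul_assoc]

theorem natCast_succ_smul_injective {M : Type*} [AddCommGroup M] [Module K M] (n : ℕ) {a b : M}
    (h : ((n + 1 : ℕ) : K) • a = ((n + 1 : ℕ) : K) • b) : a = b :=
  smul_right_injective M (Nat.cast_ne_zero.2 n.succ_ne_zero : ((n + 1 : ℕ) : K) ≠ 0) h

/-- The derivative of exp(tY) exp(-tY) in t vanishes, read off in one positive degree. -/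
theorem sum_dividedPower_neg (Y : R) (n : ℕ) :
    ∑ x ∈ Finset.HasAntidiagonal.antidiagonal (n + 1),
      dividedPower K Y x.1 * dividedPower K (-Y) x.2 = 0 := by
  apply natCast_succ_smul_injective (K := K) n
  rw [sum_antidiagonal_succ_smul (K := K) n
    (fun i j => dividedPower K Y i * dividedPower K (-Y) j), smul_zero]
  refine Finset.sum_eq_zero fun x _ => ?_
  rw [← smul_mul_assoc, ← mul_smul_comm, smul_dividedPower_succ', smul_dividedPower_succ,
    mul_assoc, ← mul_add, neg_mul, add_neg_cancel, mul_zero]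

/-- The commutator `Y Z - Z Y`. -/
def commutator (Y Z : R) : R := Y * Z - Z * Y

/-- One degree of exp(Y) Z = (exp(ad Y) Z) exp(Y). The induction moves a factor Y to the right past
an iterated commutator, which costs one more commutator. -/
theorem dividedPower_mul_eq_sum (Y Z : R) (n : ℕ) :
    dividedPower K Y n * Z = ∑ x ∈ Finset.HasAntidiagonal.antidiagonal n,
      ((x.1.factorial : K)⁻¹ • (commutator Y)^[x.1] Z) * dividedPower K Y x.2 := by
  induction n with
  | zero => simp [dividedPower]
  | succ n ih =>
    apply natCast_succ_smul_injective (K := K) n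
    rw [sum_antidiagonal_succ_smul (K := K) n
      (fun i j => ((i.factorial : K)⁻¹ • (commutator Y)^[i] Z) * dividedPower K Y j),
      ← smul_mul_assoc, smul_dividedPower_succ, mul_assoc, ih, Finset.mul_sum]
    refine Finset.sum_congr rfl fun x _ => ?_
    rw [← smul_mul_assoc, smul_smul, factorial_succ_inv, ← mul_smul_comm, smul_dividedPower_succ,
      Function.iterate_succ_apply', commutator]
    simp only [mul_smul_comm, smul_mul_assoc, sub_mul, mul_assoc, smul_sub]
    abel

/-- One degree of Duhamel's formula D(exp Y) = ((exp(ad Y) - 1)/ad Y)(D Y) · exp Y. -/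
theorem derivation_dividedPower_eq_sum (D : R →ₗ[K] R)
    (hD : ∀ a b, D (a * b) = D a * b + a * D b) (Y : R) (n : ℕ) :
    D (dividedPower K Y (n + 1)) = ∑ x ∈ Finset.HasAntidiagonal.antidiagonal n,
      (((x.1 + 1).factorial : K)⁻¹ • (commutator Y)^[x.1] (D Y)) * dividedPower K Y x.2 := by
  induction n with
  | zero => simp [dividedPower]
  | succ n ih =>
    apply natCast_succ_smul_injective (K := K) (n + 1)
    set b : ℕ → R := fun k => ((k + 1).factorial : K)⁻¹ • (commutator Y)^[k] (D Y) with hb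
    -- Since b k carries the denominator (k+1)!, its commutator with Y is (k+2) times b (k+1).
    have hYb (k : ℕ) : Y * b k = ((k + 2 : ℕ) : K) • b (k + 1) + b k * Y := by
      simp only [hb]
      rw [smul_smul, factorial_succ_inv, Function.iterate_succ_apply' _ k, commutator]
      simp only [mul_smul_comm, smul_mul_assoc, smul_sub]
      abel
    have hL : ((n + 1 + 1 : ℕ) : K) • D (dividedPower K Y (n + 1 + 1)) =
        b 0 * dividedPower K Y (n + 1) + ∑ x ∈ Finset.HasAntidiagonal.antidiagonal n,
          (((x.1 + 2 : ℕ) : K) • (b (x.1 + 1) * dividedPower K Y x.2) +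
            ((x.2 + 1 : ℕ) : K) • (b x.1 * dividedPower K Y (x.2 + 1))) := by
      rw [← map_smul, smul_dividedPower_succ, hD, ih, Finset.mul_sum]
      congr 1
      · simp [hb]
      · refine Finset.sum_congr rfl fun x _ => ?_
        change Y * (b x.1 * _) = _
        rw [← mul_assoc, hYb, add_mul, smul_mul_assoc, mul_assoc, ← smul_dividedPower_succ,
          mul_smul_comm]
    -- On the antidiagonal of n+1 the factor n+2 is split as (i+1) + j; the extra one belongs to the
    -- shifted factorial in b.
    have hR : ((n + 1 + 1 : ℕ) : K) • ∑ x ∈ Finset.HasAntidiagonal.antidiagonal (n + 1),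
          b x.1 * dividedPower K Y x.2 =
        ∑ x ∈ Finset.HasAntidiagonal.antidiagonal (n + 1),
          ((x.1 + 1 : ℕ) : K) • (b x.1 * dividedPower K Y x.2) +
        ∑ x ∈ Finset.HasAntidiagonal.antidiagonal (n + 1),
          (x.2 : K) • (b x.1 * dividedPower K Y x.2) := by
      rw [Finset.smul_sum, ← Finset.sum_add_distrib]
      refine Finset.sum_congr rfl fun x hx => ?_
      rw [Finset.HasAntidiagonal.mem_antidiagonal] at hx
      rw [← add_smul, ← hx]
      congr 1
      push_cast
      ring
    rw [hL, hR, Finset.Nat.sum_antidiagonal_succ,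
      Finset.Nat.sum_antidiagonal_succ'
        (f := fun x : ℕ × ℕ => (x.2 : K) • (b x.1 * dividedPower K Y x.2)),
      Finset.sum_add_distrib]
    simp only [zero_add, Nat.cast_one, one_smul, Nat.cast_zero, zero_smul]
    rw [add_assoc]

end DividedPowers

/-! ### Summable families of power series and the exponential -/

section PowerSeries

open PowerSeries

variable {K R : Type*} [Field K] [Ring R] [Algebra K R]

theorem coeff_smul_field (c : K) (F : PowerSeries R) (n : ℕ) :
    coeff n (c • F) = c • coeff n F := rfl

/-- The sum of a family of power series whose `k`-th member is divisible by the `k`-th power of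
the variable. -/
noncomputable def sumSeries (F : ℕ → PowerSeries R) : PowerSeries R :=
  mk fun n => ∑ k ∈ Finset.range (n + 1), coeff n (F k)

theorem coeff_sumSeries (F : ℕ → PowerSeries R) (n : ℕ) :
    coeff n (sumSeries F) = ∑ k ∈ Finset.range (n + 1), coeff n (F k) := by
  simp [sumSeries]

theorem coeff_mul_eq_zero {F G : PowerSeries R} {a b : ℕ} (hF : ∀ n < a, coeff n F = 0)
    (hG : ∀ n < b, coeff n G = 0) (n : ℕ) (hn : n < a + b) : coeff n (F * G) = 0 := by
  rw [coeff_mul]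
  refine Finset.sum_eq_zero fun x hx => ?_
  rw [Finset.HasAntidiagonal.mem_antidiagonal] at hx
  by_cases h : x.1 < a
  · rw [hF _ h, zero_mul]
  · rw [hG _ (by omega), mul_zero]

theorem coeff_pow_eq_zero {Y : PowerSeries R} (hY : coeff 0 Y = 0) (k n : ℕ) (hn : n < k) :
    coeff n (Y ^ k) = 0 := by
  induction k generalizing n with
  | zero => omega
  | succ k ih =>
    rw [pow_succ]
    exact coeff_mul_eq_zero (a := k) (b := 1) ih (fun m hm => by
      obtain rfl : m = 0 := by omega
      exact hY) n hn

theorem coeff_sumSeries_of_le {F : ℕ → PowerSeries R} (hF : ∀ k n, n < k → coeff n (F k) = 0)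
    {i n : ℕ} (h : i ≤ n) :
    coeff i (sumSeries F) = ∑ k ∈ Finset.range (n + 1), coeff i (F k) := by
  rw [coeff_sumSeries]
  refine Finset.sum_subset (Finset.range_mono (by omega)) fun k _ hk => hF _ _ ?_
  simp at hk
  omega

/-- A product of members k and l has order at least k+l, so in degree n the square of indices up to
n and the triangle k+l ≤ n give the same sum. -/
theorem sumSeries_mul {F G : ℕ → PowerSeries R} (hF : ∀ k n, n < k → coeff n (F k) = 0)
    (hG : ∀ k n, n < k → coeff n (G k) = 0) :
    sumSeries F * sumSeries G =
      sumSeries fun n => ∑ x ∈ Finset.HasAntidiagonal.antidiagonal n, F x.1 * G x.2 := by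
  refine PowerSeries.ext fun n => ?_
  have h1 : coeff n (sumSeries F * sumSeries G) =
      ∑ x ∈ Finset.range (n + 1) ×ˢ Finset.range (n + 1), coeff n (F x.1 * G x.2) := by
    rw [coeff_mul, Finset.sum_product]
    simp only [coeff_mul]
    have : ∀ x ∈ Finset.HasAntidiagonal.antidiagonal n,
        coeff x.1 (sumSeries F) * coeff x.2 (sumSeries G) =
        ∑ k ∈ Finset.range (n + 1), ∑ l ∈ Finset.range (n + 1),
          coeff x.1 (F k) * coeff x.2 (G l) := by
      intro x hx
      rw [Finset.HasAntidiagonal.mem_antidiagonal] at hx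
      rw [coeff_sumSeries_of_le hF (n := n) (by omega),
        coeff_sumSeries_of_le hG (n := n) (by omega), Finset.sum_mul_sum]
    rw [Finset.sum_congr rfl this, Finset.sum_comm]
    refine Finset.sum_congr rfl fun k _ => ?_
    rw [Finset.sum_comm]
  rw [h1, coeff_sumSeries]
  simp only [map_sum]
  rw [Finset.sum_sigma']
  symm
  refine Finset.sum_of_injOn (fun x : (_ : ℕ) × (ℕ × ℕ) => x.2) ?_ ?_ ?_ ?_
  · rintro ⟨a, b⟩ ha ⟨a', b'⟩ ha' h
    simp only [Finset.coe_sigma, Set.mem_sigma_iff, Finset.mem_coe,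
      Finset.HasAntidiagonal.mem_antidiagonal] at *
    subst h
    obtain rfl : a = a' := by rw [← ha.2, ← ha'.2]
    rfl
  · rintro ⟨a, b⟩ ha
    simp only [Finset.coe_sigma, Set.mem_sigma_iff, Finset.mem_coe,
      Finset.HasAntidiagonal.mem_antidiagonal,
      Finset.mem_range, Finset.coe_product, Set.mem_prod] at *
    omega
  · rintro ⟨a, b⟩ _ hab
    refine coeff_mul_eq_zero (hF a) (hG b) n ?_
    by_contra hcon
    refine hab ⟨⟨a + b, (a, b)⟩, ?_, rfl⟩
    simp
    omega
  · intros
    rfl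

theorem sumSeries_eq_zeroth {F : ℕ → PowerSeries R} (h : ∀ n, F (n + 1) = 0) :
    sumSeries F = F 0 := by
  ext n
  rw [coeff_sumSeries, Finset.sum_range_succ']
  simp [h]

/-- The exponential `∑ₙ Y ^ n / n!` of a power series without constant term. -/
noncomputable def expSeries (K : Type*) {R : Type*} [Field K] [Ring R] [Algebra K R]
    (Y : PowerSeries R) : PowerSeries R :=
  sumSeries (dividedPower K Y)

theorem coeff_dividedPower_eq_zero {Y : PowerSeries R} (hY : coeff 0 Y = 0) (k n : ℕ)
    (hn : n < k) : coeff n (dividedPower K Y k) = 0 := by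
  rw [dividedPower, coeff_smul_field, coeff_pow_eq_zero hY k n hn, smul_zero]

theorem expSeries_mul_neg [CharZero K] {Y : PowerSeries R} (hY : coeff 0 Y = 0) :
    expSeries K Y * expSeries K (-Y) = 1 := by
  have hY' : coeff 0 (-Y) = 0 := by rw [map_neg, hY, neg_zero]
  rw [expSeries, expSeries, sumSeries_mul (coeff_dividedPower_eq_zero hY)
    (coeff_dividedPower_eq_zero hY'), sumSeries_eq_zeroth (sum_dividedPower_neg Y)]
  simp [dividedPower_zero]

theorem coeff_zero_expSeries (Y : PowerSeries R) : coeff 0 (expSeries K Y) = 1 := by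
  rw [expSeries, coeff_sumSeries, Finset.sum_range_one, dividedPower_zero, coeff_one, if_pos rfl]

theorem coeff_commutator_iterate_eq_zero {Y : PowerSeries R} (hY : coeff 0 Y = 0)
    {Z : PowerSeries R} {a : ℕ} (hZ : ∀ n < a, coeff n Z = 0) (k n : ℕ) (hn : n < a + k) :
    coeff n ((commutator Y)^[k] Z) = 0 := by
  have hY1 : ∀ m < 1, coeff m Y = 0 := fun m hm => by
    obtain rfl : m = 0 := by omega
    exact hY
  induction k generalizing n with
  | zero => exact hZ n hn
  | succ k ih =>
    rw [Function.iterate_succ_apply', commutator, map_sub, coeff_mul_eq_zero hY1 ih n (by omega),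
      coeff_mul_eq_zero ih hY1 n (by omega), sub_zero]

theorem expSeries_mul_eq [CharZero K] {Y : PowerSeries R} (hY : coeff 0 Y = 0)
    (Z : PowerSeries R) :
    expSeries K Y * Z =
      sumSeries (fun k => (k.factorial : K)⁻¹ • (commutator Y)^[k] Z) * expSeries K Y := by
  rw [expSeries, sumSeries_mul _ (coeff_dividedPower_eq_zero hY)]
  · simp only [← dividedPower_mul_eq_sum]
    ext n
    rw [coeff_sumSeries, coeff_mul]
    simp only [coeff_mul]
    rw [Finset.sum_comm]
    refine Finset.sum_congr rfl fun x hx => ?_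
    rw [Finset.HasAntidiagonal.mem_antidiagonal] at hx
    rw [coeff_sumSeries_of_le (coeff_dividedPower_eq_zero hY) (n := n) (by omega),
      Finset.sum_mul]
  · intro k n hn
    rw [coeff_smul_field, coeff_commutator_iterate_eq_zero hY (a := 0) (by simp) k n (by omega),
      smul_zero]

/-- The derivation `X d/dX` of the ring of power series in `X`. -/
noncomputable def eulerDeriv (K : Type*) (R : Type*) [Field K] [Ring R] [Algebra K R] :
    PowerSeries R →ₗ[K] PowerSeries R where
  toFun F := mk fun n => (n : K) • coeff n F
  map_add' F G := by ext n; simp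
  map_smul' c F := by
    ext n
    simp only [coeff_mk, coeff_smul_field, RingHom.id_apply]
    rw [smul_comm]

theorem coeff_eulerDeriv (F : PowerSeries R) (n : ℕ) :
    coeff n (eulerDeriv K R F) = (n : K) • coeff n F := by
  simp [eulerDeriv]

theorem eulerDeriv_mul (F G : PowerSeries R) :
    eulerDeriv K R (F * G) = eulerDeriv K R F * G + F * eulerDeriv K R G := by
  ext n
  rw [map_add, coeff_eulerDeriv, coeff_mul, coeff_mul, coeff_mul, Finset.smul_sum,
    ← Finset.sum_add_distrib]
  refine Finset.sum_congr rfl fun x hx => ?_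
  rw [Finset.HasAntidiagonal.mem_antidiagonal] at hx
  rw [coeff_eulerDeriv, coeff_eulerDeriv, smul_mul_assoc, mul_smul_comm, ← add_smul, ← hx]
  push_cast
  rfl

theorem eulerDeriv_expSeries [CharZero K] {Y : PowerSeries R} (hY : coeff 0 Y = 0) :
    eulerDeriv K R (expSeries K Y) =
      sumSeries (fun k => ((k + 1).factorial : K)⁻¹ • (commutator Y)^[k] (eulerDeriv K R Y)) *
        expSeries K Y := by
  have h0 : ∀ n < 1, coeff n (eulerDeriv K R Y) = 0 := fun m hm => by
    obtain rfl : m = 0 := by omega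
    simp [coeff_eulerDeriv]
  rw [expSeries, sumSeries_mul _ (coeff_dividedPower_eq_zero hY)]
  · simp only [← derivation_dividedPower_eq_sum (eulerDeriv K R) eulerDeriv_mul]
    ext n
    rw [coeff_eulerDeriv, coeff_sumSeries, coeff_sumSeries, Finset.smul_sum,
      Finset.sum_range_succ']
    conv_rhs => rw [Finset.sum_range_succ]
    -- The index shift leaves the divided power n+1, which has no coefficient in degree n; the
    -- divided power 0 is constant and is killed by the Euler derivation.
    simp only [coeff_eulerDeriv, coeff_dividedPower_eq_zero hY (n + 1) n (by omega), smul_zero]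
    rw [dividedPower_zero, coeff_one]
    rcases n with _ | n
    · simp
    · simp
  · intro k n hn
    rw [coeff_smul_field, coeff_commutator_iterate_eq_zero hY h0 k n (by omega), smul_zero]

/-- With no constant terms, the coefficients of a product up to degree n only involve the
coefficients of the factors below n. -/
theorem coeff_mul_congr {Y Y' Z Z' : PowerSeries R} {n : ℕ} (hY : coeff 0 Y = 0)
    (hY' : coeff 0 Y' = 0) (hZ : coeff 0 Z = 0) (hZ' : coeff 0 Z' = 0)
    (h1 : ∀ k < n, coeff k Y = coeff k Y') (h2 : ∀ k < n, coeff k Z = coeff k Z') (k : ℕ)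
    (hk : k ≤ n) : coeff k (Y * Z) = coeff k (Y' * Z') := by
  rw [coeff_mul, coeff_mul]
  refine Finset.sum_congr rfl fun x hx => ?_
  rw [Finset.HasAntidiagonal.mem_antidiagonal] at hx
  by_cases h : x.1 = 0
  · rw [h, hY, hY', zero_mul, zero_mul]
  by_cases h' : x.2 = 0
  · rw [h', hZ, hZ', mul_zero, mul_zero]
  rw [h1 _ (by omega), h2 _ (by omega)]

/-- By the previous remark powers of exponent at least 2 do not see the first coefficient in which
the series differ, so only the linear term of the exponential contributes. All successive
approximations below rest on this. -/
theorem coeff_expSeries_sub {Y Y' : PowerSeries R} {n : ℕ} (hY : coeff 0 Y = 0)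
    (hY' : coeff 0 Y' = 0) (h : ∀ k < n, coeff k Y = coeff k Y') (k : ℕ) (hk : k ≤ n) :
    coeff k (expSeries K Y) - coeff k (expSeries K Y') = coeff k Y - coeff k Y' := by
  have key : ∀ i, 2 ≤ i → ∀ k ≤ n, coeff k (Y ^ i) = coeff k (Y' ^ i) := by
    intro i hi
    induction i, hi using Nat.le_induction with
    | base =>
      intro k hk
      rw [pow_two, pow_two]
      exact coeff_mul_congr hY hY' hY hY' h h k hk
    | succ i hi ih =>
      intro k hk
      rw [pow_succ, pow_succ]
      exact coeff_mul_congr (coeff_pow_eq_zero hY i 0 (by omega))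
        (coeff_pow_eq_zero hY' i 0 (by omega)) hY hY' (fun k hk => ih k (by omega)) h k hk
  rw [expSeries, expSeries, coeff_sumSeries, coeff_sumSeries]
  rcases k with _ | k
  · simp [dividedPower, hY, hY']
  rw [Finset.sum_range_succ', Finset.sum_range_succ', Finset.sum_range_succ',
    Finset.sum_range_succ']
  have : ∀ i ∈ Finset.range k, coeff (k + 1) (dividedPower K Y (i + 1 + 1)) =
      coeff (k + 1) (dividedPower K Y' (i + 1 + 1)) := by
    intro i _
    rw [dividedPower, dividedPower, coeff_smul_field, coeff_smul_field, key _ (by omega) _ hk]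
  rw [Finset.sum_congr rfl this]
  simp [dividedPower]

end PowerSeries

/-! ## The Campbell-Hausdorff theorem -/

section CampbellHausdorff

open PowerSeries

variable {K R : Type*} [Field K] [Ring R] [Algebra K R]

/-- A sequence can be built from successive approximations of which the `n`-th agrees with the
preceding ones in the entries below `n`. -/
theorem exists_limit_of_approximations {X : Type*} (P : ℕ → (ℕ → X) → Prop) (s₀ : ℕ → X)
    (h₀ : P 0 s₀)
    (step : ∀ n s, P n s → ∃ s', P (n + 1) s' ∧ ∀ k < n, s' k = s k) :
    ∃ s : ℕ → X, ∀ n, ∃ t, P n t ∧ ∀ k < n, s k = t k := by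
  choose! f hf1 hf2 using step
  let seq : ℕ → ℕ → X := fun n => Nat.rec s₀ f n
  have hP : ∀ n, P n (seq n) := fun n => by
    induction n with
    | zero => exact h₀
    | succ n ih => exact hf1 n _ ih
  have hag : ∀ n m, n ≤ m → ∀ k < n, seq m k = seq n k := by
    intro n m hnm
    induction m, hnm using Nat.le_induction with
    | base => intros; rfl
    | succ m hm ih =>
      intro k hk
      rw [← ih k hk]
      exact hf2 m _ (hP m) k (by omega)
  exact ⟨fun k => seq (k + 1) k, fun n => ⟨seq n, hP n, fun k hk =>
    (hag (k + 1) n (by omega) k (by omega)).symm⟩⟩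

/-- All coefficients of the series `F` lie in `L`. -/
def CoeffsIn (L : Submodule K R) (F : PowerSeries R) : Prop := ∀ n, coeff n F ∈ L

theorem CoeffsIn.neg {L : Submodule K R} {F : PowerSeries R} (hF : CoeffsIn L F) :
    CoeffsIn L (-F) := fun n => by
  rw [map_neg]
  exact L.neg_mem (hF n)

/-- `g` is an invertible series, with inverse `g'`, that normalises the series with coefficients
in `L`, and whose logarithmic derivative has its coefficients in `L`. -/
structure IsIntegralCurve (L : Submodule K R) (g g' : PowerSeries R) : Prop where
  mul_inv : g * g' = 1
  inv_mul : g' * g = 1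
  coeff_zero : coeff 0 g = 1
  conj : ∀ F, CoeffsIn L F → CoeffsIn L (g * F * g')
  logDeriv : CoeffsIn L (eulerDeriv K R g * g')

/-- The logarithmic derivative is a cocycle: that of g h is that of g plus the g-conjugate of that
of h, and g normalises the series over L. -/
theorem IsIntegralCurve.mul {L : Submodule K R} {g g' h h' : PowerSeries R}
    (hg : IsIntegralCurve L g g') (hh : IsIntegralCurve L h h') :
    IsIntegralCurve L (g * h) (h' * g') where
  mul_inv := by rw [mul_assoc, ← mul_assoc h, hh.mul_inv, one_mul, hg.mul_inv]
  inv_mul := by rw [mul_assoc, ← mul_assoc g', hg.inv_mul, one_mul, hh.inv_mul]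
  coeff_zero := by simp [coeff_mul, hg.coeff_zero, hh.coeff_zero]
  conj F hF := by
    have := hg.conj _ (hh.conj F hF)
    simpa only [mul_assoc] using this
  logDeriv n := by
    have h1 := hg.conj _ hh.logDeriv n
    have h2 := hg.logDeriv n
    have : eulerDeriv K R (g * h) * (h' * g') =
        eulerDeriv K R g * g' + g * (eulerDeriv K R h * h') * g' := by
      rw [eulerDeriv_mul, add_mul]
      congr 1
      · rw [mul_assoc, ← mul_assoc h, hh.mul_inv, one_mul]
      · simp only [mul_assoc]
    rw [this, map_add]
    exact L.add_mem h2 h1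

variable {L : Submodule K R}

theorem coeffsIn_commutator (hL : ∀ a ∈ L, ∀ b ∈ L, a * b - b * a ∈ L)
    {F G : PowerSeries R} (hF : CoeffsIn L F) (hG : CoeffsIn L G) :
    CoeffsIn L (commutator F G) := by
  intro n
  have h : coeff n (G * F) =
      ∑ x ∈ Finset.HasAntidiagonal.antidiagonal n, coeff x.2 G * coeff x.1 F := by
    rw [coeff_mul, ← Finset.Nat.sum_antidiagonal_swap]
    rfl
  rw [commutator, map_sub, h, coeff_mul, ← Finset.sum_sub_distrib]
  exact L.sum_mem fun x _ => hL _ (hF _) _ (hG _)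

theorem coeffsIn_sumSeries_commutator (hL : ∀ a ∈ L, ∀ b ∈ L, a * b - b * a ∈ L)
    {Y F : PowerSeries R} (hY : CoeffsIn L Y)
    (hF : CoeffsIn L F) (c : ℕ → K) :
    CoeffsIn L (sumSeries fun k => c k • (commutator Y)^[k] F) := by
  have h : ∀ k, CoeffsIn L ((commutator Y)^[k] F) := by
    intro k
    induction k with
    | zero => exact hF
    | succ k ih =>
      rw [Function.iterate_succ_apply']
      exact coeffsIn_commutator hL hY ih
  intro n
  rw [coeff_sumSeries]
  exact L.sum_mem fun k _ => L.smul_mem _ (h k n)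

variable [CharZero K]

theorem expSeries_neg_mul {Y : PowerSeries R} (hY : coeff 0 Y = 0) :
    expSeries K (-Y) * expSeries K Y = 1 := by
  have := expSeries_mul_neg (K := K) (Y := -Y) (by rw [map_neg, hY, neg_zero])
  rwa [neg_neg] at this

/-- Conjugation by exp Y and its logarithmic derivative are both series in ad Y, applied
respectively to the given series and to the Euler derivative of Y; closure of L under commutators
suffices. -/
theorem isIntegralCurve_expSeries (hL : ∀ a ∈ L, ∀ b ∈ L, a * b - b * a ∈ L)
    {Y : PowerSeries R} (hY : CoeffsIn L Y)
    (hY0 : coeff 0 Y = 0) : IsIntegralCurve L (expSeries K Y) (expSeries K (-Y)) where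
  mul_inv := expSeries_mul_neg hY0
  inv_mul := expSeries_neg_mul hY0
  coeff_zero := coeff_zero_expSeries Y
  conj F hF := by
    rw [expSeries_mul_eq hY0, mul_assoc, expSeries_mul_neg hY0, mul_one]
    exact coeffsIn_sumSeries_commutator hL hY hF _
  logDeriv := by
    rw [eulerDeriv_expSeries hY0, mul_assoc, expSeries_mul_neg hY0, mul_one]
    refine coeffsIn_sumSeries_commutator hL hY (fun n => ?_) _
    rw [coeff_eulerDeriv]
    exact L.smul_mem _ (hY n)

/-- The leading coefficient of an integral curve lies in `L`. -/
theorem IsIntegralCurve.coeff_mem {g g' : PowerSeries R} (hg : IsIntegralCurve L g g') {n : ℕ}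
    (hn : n ≠ 0) (h : ∀ k < n, k ≠ 0 → coeff k g = 0) : coeff n g ∈ L := by
  have h0 : coeff 0 g' = 1 := by
    have := congrArg (coeff 0) hg.mul_inv
    simpa [coeff_mul, hg.coeff_zero] using this
  -- The Euler derivative kills the constant term and multiplies degree n by n. By vanishing of the
  -- intermediate coefficients only the pair (n, 0) survives.
  have h1 : coeff n (eulerDeriv K R g * g') = (n : K) • coeff n g := by
    rw [coeff_mul, Finset.sum_eq_single (n, 0)]
    · rw [coeff_eulerDeriv, h0, mul_one]
    · intro x hx hne
      rw [Finset.HasAntidiagonal.mem_antidiagonal] at hx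
      rw [coeff_eulerDeriv]
      by_cases h0 : x.1 = 0
      · simp [h0]
      · rw [h x.1 _ h0, smul_zero, zero_mul]
        rcases x with ⟨a, b⟩
        simp only [ne_eq, Prod.mk.injEq, not_and] at *
        omega
    · simp
  have h2 := L.smul_mem ((n : K)⁻¹) (hg.logDeriv n)
  rwa [h1, smul_smul, inv_mul_cancel₀ (Nat.cast_ne_zero.2 hn), one_smul] at h2

/-- Every integral curve is the exponential of a series with coefficients in `L`. -/
theorem IsIntegralCurve.exists_log (hL : ∀ a ∈ L, ∀ b ∈ L, a * b - b * a ∈ L)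
    {g g' : PowerSeries R} (hg : IsIntegralCurve L g g')
    {N : ℕ} (hN : N ≠ 0) {Y₀ : PowerSeries R} (hY : CoeffsIn L Y₀) (hY0 : coeff 0 Y₀ = 0)
    (hexp : ∀ k < N, coeff k (expSeries K Y₀) = coeff k g) :
    ∃ Y : PowerSeries R, CoeffsIn L Y ∧ (∀ k < N, coeff k Y = coeff k Y₀) ∧
      expSeries K Y = g := by
  obtain ⟨s, hs⟩ := exists_limit_of_approximations
    (P := fun n s => CoeffsIn L (PowerSeries.mk s) ∧ s 0 = 0 ∧
      (∀ k < N, s k = coeff k Y₀) ∧ ∀ k, k < n ∨ k < N →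
        coeff k (expSeries K (PowerSeries.mk s)) = coeff k g)
    (s₀ := fun n => coeff n Y₀)
    (by
      have : (PowerSeries.mk fun n => coeff n Y₀) = Y₀ := by ext; simp
      rw [this]
      exact ⟨hY, hY0, fun _ _ => rfl, fun k hk => hexp k (by omega)⟩)
    (by
      rintro n s ⟨h1, h2, h3, h4⟩
      -- Up to N the prescribed series is already a logarithm and must not be altered.
      by_cases hn : n < N
      · exact ⟨s, ⟨h1, h2, h3, fun k hk => h4 k (by omega)⟩, fun _ _ => rfl⟩
      have hs0 : coeff 0 (PowerSeries.mk s) = 0 := by rw [coeff_mk]; exact h2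
      have hE := isIntegralCurve_expSeries hL h1.neg (by rw [map_neg, hs0, neg_zero])
      rw [neg_neg] at hE
      have hh := hg.mul hE
      -- The quotient g exp(-s) is again an integral curve and is 1 below degree n. Its coefficient
      -- in degree n therefore lies in L, and is the correction to be added to s.
      set h := g * expSeries K (-PowerSeries.mk s) with hh_def
      have hgh : g = h * expSeries K (PowerSeries.mk s) := by
        rw [hh_def, mul_assoc, expSeries_neg_mul hs0, mul_one]
      have hlow : ∀ k < n, k ≠ 0 → coeff k h = 0 := by
        have : coeff 0 h = 1 := hh.coeff_zero
        have hone : ∀ k < n, coeff k h =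
            coeff k (expSeries K (PowerSeries.mk s) * expSeries K (-PowerSeries.mk s)) := by
          intro k hk
          rw [hh_def, coeff_mul, coeff_mul]
          refine Finset.sum_congr rfl fun x hx => ?_
          rw [Finset.HasAntidiagonal.mem_antidiagonal] at hx
          rw [h4 x.1 (by omega)]
        intro k hk hk0
        rw [hone k hk, expSeries_mul_neg hs0, coeff_one, if_neg hk0]
      have hn0 : n ≠ 0 := by omega
      have hmem := hh.coeff_mem hn0 hlow
      have hcoef : coeff n g = coeff n h + coeff n (expSeries K (PowerSeries.mk s)) := by
        conv_lhs => rw [hgh]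
        rw [coeff_mul]
        have hne : ((n, 0) : ℕ × ℕ) ≠ (0, n) := by simp [hn0]
        rw [← Finset.sum_subset (s₁ := {(n, 0), (0, n)})]
        · rw [Finset.sum_pair hne, coeff_zero_expSeries, hh.coeff_zero, one_mul, mul_one]
        · intro x hx
          simp only [Finset.mem_insert, Finset.mem_singleton] at hx
          rcases hx with rfl | rfl <;> simp
        · rintro ⟨a, b⟩ hx hx'
          simp only [Finset.mem_insert, Finset.mem_singleton, Prod.mk.injEq, not_or,
            Finset.HasAntidiagonal.mem_antidiagonal] at hx hx'
          rw [hlow a (by omega) (by omega), zero_mul]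
      refine ⟨fun k => if k = n then s n + coeff n h else s k, ⟨?_, ?_, ?_, ?_⟩, ?_⟩
      · intro k
        have := h1 k
        rw [coeff_mk] at this ⊢
        split_ifs with hk
        · exact L.add_mem (hk ▸ this) hmem
        · exact this
      · exact (if_neg (by omega)).trans h2
      · intro k hk
        exact (if_neg (by omega)).trans (h3 k hk)
      · intro k hk
        have := coeff_expSeries_sub (K := K)
          (Y := PowerSeries.mk fun k => if k = n then s n + coeff n h else s k)
          (Y' := PowerSeries.mk s) (n := n) (by rw [coeff_mk, if_neg (by omega)]; exact h2) hs0
          (fun k hk => by rw [coeff_mk, coeff_mk, if_neg (by omega)]) k (by omega)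
        rw [sub_eq_iff_eq_add] at this
        rw [this, coeff_mk, coeff_mk]
        split_ifs with hkn
        · subst hkn
          rw [hcoef]
          abel
        · rw [sub_self, zero_add]
          exact h4 k (by omega)
      · intro k hk
        exact if_neg (by omega))
  refine ⟨PowerSeries.mk s, ?_, ?_, ?_⟩
  · intro n
    obtain ⟨t, ⟨h1, -⟩, h⟩ := hs (n + 1)
    have := h1 n
    rw [coeff_mk] at this ⊢
    rwa [h n (by omega)]
  · intro k hk
    obtain ⟨t, ⟨-, -, h3, -⟩, h⟩ := hs (k + 1)
    rw [coeff_mk, h k (by omega), h3 k hk]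
  -- Coefficient n of an exponential depends on coefficients up to n only, so equality passes to the
  -- limit from the approximation of stage n+1.
  · ext n
    obtain ⟨t, ⟨-, h2, -, h4⟩, h⟩ := hs (n + 1)
    have h20 : coeff 0 (PowerSeries.mk t) = 0 := by rw [coeff_mk]; exact h2
    have := coeff_expSeries_sub (K := K) (Y := PowerSeries.mk s) (Y' := PowerSeries.mk t) (n := n)
      (by rw [coeff_mk, h 0 (by omega), h2]) h20
      (fun k hk => by rw [coeff_mk, coeff_mk, h k (by omega)]) n le_rfl
    rw [coeff_mk, coeff_mk, h n (by omega), sub_self, sub_eq_zero] at this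
    rw [this, h4 n (by omega)]

/-- The Campbell-Hausdorff theorem: a product of exponentials is an exponential. -/
theorem exists_expSeries_mul (hL : ∀ a ∈ L, ∀ b ∈ L, a * b - b * a ∈ L)
    {U Y : PowerSeries R} (hU : CoeffsIn L U) (hY : CoeffsIn L Y)
    (hY0 : coeff 0 Y = 0) {n : ℕ} (hn : n ≠ 0) (hUn : ∀ k < n, coeff k U = 0) :
    ∃ C : PowerSeries R, CoeffsIn L C ∧ (∀ k ≤ n, coeff k C = coeff k U + coeff k Y) ∧
      expSeries K C = expSeries K U * expSeries K Y := by
  have hU0 : coeff 0 U = 0 := hUn 0 (by omega)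
  have hUY0 : coeff 0 (U + Y) = 0 := by rw [map_add, hU0, hY0, add_zero]
  -- Since U has order at least n, exp U is 1 + U and U exp Y is U up to degree n. So U + Y is a
  -- logarithm of the product up to that degree, and the exact one can be chosen to agree with it
  -- there.
  obtain ⟨C, h1, h2, h3⟩ := IsIntegralCurve.exists_log hL ((isIntegralCurve_expSeries hL hU hU0).mul
    (isIntegralCurve_expSeries hL hY hY0)) (N := n + 1) (Y₀ := U + Y) (by omega)
    (fun k => by rw [map_add]; exact L.add_mem (hU k) (hY k)) hUY0 (by
      intro k hk
      have e1 := coeff_expSeries_sub (K := K) hUY0 hY0 (n := n)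
        (fun k hk => by rw [map_add, hUn k hk, zero_add]) k (by omega)
      have e2 : ∀ j ≤ n, coeff j (expSeries K U) = coeff j 1 + coeff j U := by
        intro j hj
        have := coeff_expSeries_sub (K := K) hU0 (map_zero (coeff (R := R) 0)) (n := n)
          (fun k hk => by rw [hUn k hk, map_zero]) j hj
        rw [map_zero, sub_zero, sub_eq_iff_eq_add] at this
        rw [this, add_comm]
        congr 2
        rw [expSeries, sumSeries_eq_zeroth (fun n => by simp [dividedPower]), dividedPower_zero]
      have e3 : coeff k (expSeries K U * expSeries K Y) =
          coeff k ((1 + U) * expSeries K Y) := by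
        rw [coeff_mul, coeff_mul]
        refine Finset.sum_congr rfl fun x hx => ?_
        rw [Finset.HasAntidiagonal.mem_antidiagonal] at hx
        rw [e2 x.1 (by omega), map_add]
      have e4 : coeff k (U * expSeries K Y) = coeff k U := by
        rw [coeff_mul, Finset.sum_eq_single (k, 0)]
        · rw [coeff_zero_expSeries, mul_one]
        · rintro ⟨a, b⟩ hx hne
          simp only [Finset.HasAntidiagonal.mem_antidiagonal, ne_eq, Prod.mk.injEq,
            not_and] at hx hne
          rw [hUn a (by omega), zero_mul]
        · simp
      rw [sub_eq_iff_eq_add] at e1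
      rw [e3, add_mul, one_mul, map_add, e4, e1, map_add]
      abel)
  exact ⟨C, h1, fun k hk => by rw [h2 k (by omega), map_add], h3⟩

end CampbellHausdorff

/-! ## Calculus of formal functions -/

section Calculus

open FormalFunctions

variable {K I : Type*} [Field K] {p : I → ZMod 2}

theorem zmod_two_cases (a : ZMod 2) : a = 0 ∨ a = 1 := by
  revert a; decide

theorem sgn_zero_left (a : ZMod 2) : sgn K 0 a = 1 := by simp [sgn]

theorem sgn_zero_right (a : ZMod 2) : sgn K a 0 = 1 := by simp [sgn]

theorem sgn_one_one : sgn K 1 1 = -1 := by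
  have : (1 : ZMod 2).val = 1 := rfl
  simp [sgn, this]

theorem zmod_two_one_add_one : (1 : ZMod 2) + 1 = 0 := rfl

namespace FormalFunctions

theorem ext_coeff {f g : FormalFunctions K p}
    (h : ∀ w, (f : List I → K) w = (g : List I → K) w) : f = g :=
  Subtype.ext (funext h)

theorem deriv_apply (i : I) (f : FormalFunctions K p) (w : List I) :
    (deriv i f : List I → K) w = (f : List I → K) (i :: w) := rfl

theorem mul_nil (f g : FormalFunctions K p) :
    (mul f g : List I → K) [] = (f : List I → K) [] * (g : List I → K) [] := rfl

theorem twist_apply (q : ZMod 2) (f : FormalFunctions K p) (w : List I) :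
    (twist q f : List I → K) w = sgn K q (wordParity p w) * (f : List I → K) w := rfl

/-- The product is defined by recursion on the word through this rule. Identities are accordingly
proved by induction on the word: compare constant terms, then derivatives. -/
theorem deriv_leibniz (i : I) (f g : FormalFunctions K p) :
    deriv i (mul f g) = mul (deriv i f) g + mul (twist (p i) f) (deriv i g) := rfl

theorem deriv_deriv (i j : I) (f : FormalFunctions K p) :
    deriv i (deriv j f) = sgn K (p i) (p j) • deriv j (deriv i f) :=
  Subtype.ext (by
    have := rawDeriv_comm (p := p) j i f.2
    rwa [sgn_comm] at this)

/-- The left derivative as a linear map. -/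
def derivHom (i : I) : FormalFunctions K p →ₗ[K] FormalFunctions K p where
  toFun := deriv i
  map_add' _ _ := rfl
  map_smul' _ _ := rfl

theorem deriv_map_add (i : I) (f g : FormalFunctions K p) :
    deriv i (f + g) = deriv i f + deriv i g := rfl

theorem deriv_map_smul (i : I) (c : K) (f : FormalFunctions K p) :
    deriv i (c • f) = c • deriv i f := rfl

theorem neg_smul_eq (c : K) (f : FormalFunctions K p) : (-c) • f = -(c • f) := neg_smul c f

theorem deriv_map_sum {J : Type*} (i : I) (s : Finset J) (f : J → FormalFunctions K p) :
    deriv i (∑ j ∈ s, f j) = ∑ j ∈ s, deriv i (f j) :=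
  map_sum (derivHom i) f s

theorem twist_add (q : ZMod 2) (f g : FormalFunctions K p) :
    twist q (f + g) = twist q f + twist q g :=
  ext_coeff fun w => by simp [twist_apply, mul_add]

theorem twist_smul (q : ZMod 2) (c : K) (f : FormalFunctions K p) :
    twist q (c • f) = c • twist q f :=
  ext_coeff fun w => by simp [twist_apply, mul_left_comm]

theorem mul_smul_left (c : K) (f g : FormalFunctions K p) : mul (c • f) g = c • mul f g :=
  ext_coeff fun w => rawMul_smul_left p w c f g

theorem mul_smul_right (c : K) (f g : FormalFunctions K p) : mul f (c • g) = c • mul f g :=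
  ext_coeff fun w => rawMul_smul_right p w c f g

theorem mul_add_left (f f' g : FormalFunctions K p) : mul (f + f') g = mul f g + mul f' g := by
  refine ext_coeff fun w => ?_
  induction w generalizing f f' g with
  | nil => exact add_mul _ _ _
  | cons i w ih =>
    rw [← deriv_apply, deriv_leibniz, deriv_map_add, twist_add]
    have h1 := ih (deriv i f) (deriv i f') g
    have h2 := ih (twist (p i) f) (twist (p i) f') (deriv i g)
    simp only [Submodule.coe_add, Pi.add_apply] at h1 h2 ⊢
    rw [h1, h2, ← deriv_apply, ← deriv_apply, deriv_leibniz, deriv_leibniz]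
    simp only [Submodule.coe_add, Pi.add_apply]
    ring

theorem mul_add_right (f g g' : FormalFunctions K p) : mul f (g + g') = mul f g + mul f g' := by
  refine ext_coeff fun w => ?_
  induction w generalizing f g g' with
  | nil => exact mul_add _ _ _
  | cons i w ih =>
    rw [← deriv_apply, deriv_leibniz, deriv_map_add]
    have h1 := ih (deriv i f) g g'
    have h2 := ih (twist (p i) f) (deriv i g) (deriv i g')
    simp only [Submodule.coe_add, Pi.add_apply] at h1 h2 ⊢
    rw [h1, h2, ← deriv_apply, ← deriv_apply, deriv_leibniz, deriv_leibniz]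
    simp only [Submodule.coe_add, Pi.add_apply]
    ring

theorem HasParity.twist_eq {a : ZMod 2} {f : FormalFunctions K p} (hf : HasParity a f)
    (q : ZMod 2) : twist q f = sgn K q a • f := by
  refine ext_coeff fun w => ?_
  rw [twist_apply]
  by_cases h : wordParity p w = a
  · rw [h]; rfl
  · change _ = sgn K q a * _
    rw [hf w h, mul_zero, mul_zero]

theorem wordParity_cons (i : I) (w : List I) :
    wordParity p (i :: w) = p i + wordParity p w := by
  simp [wordParity]

theorem add_eq_iff_zmod_two (a b c : ZMod 2) : a + b = c ↔ b = c + a := by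
  revert a b c; decide

theorem HasParity.deriv {a : ZMod 2} {f : FormalFunctions K p} (hf : HasParity a f) (i : I) :
    HasParity (a + p i) (deriv i f) := fun w hw => by
  refine hf (i :: w) fun h => hw ?_
  rwa [wordParity_cons, add_eq_iff_zmod_two] at h

/-- The formal functions of parity `a`. -/
def ofParity (K : Type*) [Field K] (p : I → ZMod 2) (a : ZMod 2) :
    Submodule K (FormalFunctions K p) where
  carrier := {f | HasParity a f}
  zero_mem' := fun _ _ => rfl
  add_mem' := by
    intro f g hf hg w hw
    rw [Submodule.coe_add, Pi.add_apply, hf w hw, hg w hw, add_zero]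
  smul_mem' := by
    intro c f hf w hw
    rw [Submodule.coe_smul, Pi.smul_apply, hf w hw, smul_zero]

theorem HasParity.zero (a : ZMod 2) : HasParity a (0 : FormalFunctions K p) :=
  (ofParity K p a).zero_mem

theorem HasParity.add {a : ZMod 2} {f g : FormalFunctions K p} (hf : HasParity a f)
    (hg : HasParity a g) : HasParity a (f + g) := (ofParity K p a).add_mem hf hg

theorem HasParity.smul {a : ZMod 2} {f : FormalFunctions K p} (c : K) (hf : HasParity a f) :
    HasParity a (c • f) := (ofParity K p a).smul_mem c hf

theorem HasParity.neg {a : ZMod 2} {f : FormalFunctions K p} (hf : HasParity a f) :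
    HasParity a (-f) := (ofParity K p a).neg_mem hf

theorem HasParity.sum {J : Type*} {s : Finset J} {a : ZMod 2} {f : J → FormalFunctions K p}
    (hf : ∀ j ∈ s, HasParity a (f j)) : HasParity a (∑ j ∈ s, f j) :=
  (ofParity K p a).sum_mem hf

/-- A function of parity `a` whose coefficient at `w` does not vanish has `w` of parity `a`. -/
theorem HasParity.eq_or_eq_zero {a : ZMod 2} {f : FormalFunctions K p} (hf : HasParity a f)
    (w : List I) : wordParity p w = a ∨ (f : List I → K) w = 0 := by
  by_cases h : wordParity p w = a
  · exact Or.inl h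
  · exact Or.inr (hf w h)

theorem HasParity.mul {a b : ZMod 2} {f g : FormalFunctions K p} (hf : HasParity a f)
    (hg : HasParity b g) : HasParity (a + b) (mul f g) := by
  intro w
  induction w generalizing a b f g with
  | nil =>
    intro h
    rw [mul_nil]
    rcases hf.eq_or_eq_zero [] with h1 | h1
    · rcases hg.eq_or_eq_zero [] with h2 | h2
      · exact absurd (by rw [← h1, ← h2]; simp [wordParity]) h
      · rw [h2, mul_zero]
    · rw [h1, zero_mul]
  | cons i w ih =>
    intro h
    rw [wordParity_cons, Ne, add_eq_iff_zmod_two] at h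
    rw [← deriv_apply, deriv_leibniz, hf.twist_eq, mul_smul_left]
    simp only [Submodule.coe_add, Pi.add_apply, Submodule.coe_smul, Pi.smul_apply]
    rw [ih (hf.deriv i) hg (by rwa [add_right_comm]), ih hf (hg.deriv i) (by rwa [← add_assoc])]
    simp

end FormalFunctions

end Calculus

/-! ### The Poisson bracket and the Laplacian in coordinates -/

section PoissonCalculus

open FormalFunctions

variable {K I : Type*} [Field K] {p : I → ZMod 2}

theorem coe_sum_apply {J : Type*} (s : Finset J) (f : J → FormalFunctions K p) (w : List I) :
    ((∑ j ∈ s, f j : FormalFunctions K p) : List I → K) w = ∑ j ∈ s, (f j : List I → K) w := by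
  rw [Submodule.coe_sum, Finset.sum_apply]

theorem coeff_swap (f : FormalFunctions K p) (i j : I) :
    (f : List I → K) [i, j] = sgn K (p i) (p j) * (f : List I → K) [j, i] := f.2 [] i j []

theorem wordParity_singleton (i : I) : wordParity p [i] = p i := by simp [wordParity]

theorem wordParity_pair (i j : I) : wordParity p [i, j] = p i + p j := by simp [wordParity]

variable [Fintype I] {P : Matrix I I K}

theorem poisson_add_left (f f' g : FormalFunctions K p) :
    poisson P (f + f') g = poisson P f g + poisson P f' g := by
  simp only [poisson, twist_add, deriv_map_add, mul_add_left, smul_add, Finset.sum_add_distrib]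

theorem poisson_add_right (f g g' : FormalFunctions K p) :
    poisson P f (g + g') = poisson P f g + poisson P f g' := by
  simp only [poisson, deriv_map_add, mul_add_right, smul_add, Finset.sum_add_distrib]

theorem poisson_smul_left (c : K) (f g : FormalFunctions K p) :
    poisson P (c • f) g = c • poisson P f g := by
  simp only [poisson, twist_smul, deriv_map_smul, mul_smul_left, Finset.smul_sum]
  simp only [smul_comm c]

theorem poisson_smul_right (c : K) (f g : FormalFunctions K p) :
    poisson P f (c • g) = c • poisson P f g := by
  simp only [poisson, deriv_map_smul, mul_smul_right, Finset.smul_sum]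
  simp only [smul_comm c]

/-- The Poisson bracket as a bilinear map. -/
def poissonHom (P : Matrix I I K) :
    FormalFunctions K p →ₗ[K] FormalFunctions K p →ₗ[K] FormalFunctions K p :=
  LinearMap.mk₂ K (poisson P) poisson_add_left poisson_smul_left poisson_add_right
    poisson_smul_right

theorem poissonHom_apply (f g : FormalFunctions K p) : poissonHom P f g = poisson P f g := rfl

theorem poisson_zero_left (g : FormalFunctions K p) : poisson P 0 g = 0 :=
  LinearMap.map_zero₂ (poissonHom P) g

theorem poisson_zero_right (f : FormalFunctions K p) : poisson P f 0 = 0 :=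
  map_zero (poissonHom P f)

theorem poisson_neg_left (f g : FormalFunctions K p) : poisson P (-f) g = -poisson P f g :=
  LinearMap.map_neg₂ (poissonHom P) f g

theorem poisson_neg_right (f g : FormalFunctions K p) : poisson P f (-g) = -poisson P f g :=
  map_neg (poissonHom P f) g

theorem poisson_sum_left {J : Type*} (s : Finset J) (f : J → FormalFunctions K p)
    (g : FormalFunctions K p) : poisson P (∑ j ∈ s, f j) g = ∑ j ∈ s, poisson P (f j) g :=
  LinearMap.map_sum₂ (poissonHom P) s f g

theorem poisson_sum_right {J : Type*} (s : Finset J) (f : FormalFunctions K p)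
    (g : J → FormalFunctions K p) : poisson P f (∑ j ∈ s, g j) = ∑ j ∈ s, poisson P f (g j) :=
  map_sum (poissonHom P f) g s

/-- The BV Laplacian as a linear map. -/
def laplacianHom (P : Matrix I I K) : FormalFunctions K p →ₗ[K] FormalFunctions K p :=
  (2 : K)⁻¹ • ∑ k, ∑ l, P k l • (derivHom k ∘ₗ derivHom l)

theorem laplacianHom_apply (f : FormalFunctions K p) : laplacianHom P f = laplacian P f := by
  simp only [laplacianHom, laplacian, LinearMap.smul_apply, LinearMap.sum_apply,
    LinearMap.comp_apply]
  rfl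

theorem laplacian_add (f g : FormalFunctions K p) :
    laplacian P (f + g) = laplacian P f + laplacian P g := by
  simp only [← laplacianHom_apply, map_add]

theorem laplacian_smul (c : K) (f : FormalFunctions K p) :
    laplacian P (c • f) = c • laplacian P f := by
  simp only [← laplacianHom_apply, map_smul]

theorem laplacian_zero : laplacian P (0 : FormalFunctions K p) = 0 := by
  simp only [← laplacianHom_apply, map_zero]

theorem laplacian_neg (f : FormalFunctions K p) : laplacian P (-f) = -laplacian P f := by
  simp only [← laplacianHom_apply, map_neg]

theorem poisson_eq_sum {a : ZMod 2} {f : FormalFunctions K p} (hf : HasParity a f)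
    (g : FormalFunctions K p) :
    poisson P f g = ∑ k, ∑ l, (P k l * sgn K (p l) a) • mul (deriv k f) (deriv l g) := by
  simp only [poisson, hf.twist_eq, deriv_map_smul, mul_smul_left, smul_smul]

theorem poisson_nil {a : ZMod 2} {f : FormalFunctions K p} (hf : HasParity a f)
    (g : FormalFunctions K p) :
    (poisson P f g : List I → K) [] =
      ∑ k, ∑ l, P k l * sgn K (p l) a * ((f : List I → K) [k] * (g : List I → K) [l]) := by
  rw [poisson_eq_sum hf, coe_sum_apply]
  simp only [coe_sum_apply]
  rfl

/-- The form `P` is symmetric and odd. -/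
structure IsOddSymmetric (p : I → ZMod 2) (P : Matrix I I K) : Prop where
  symm : ∀ k l, P k l = P l k
  odd : ∀ k l, P k l ≠ 0 → p l = p k + 1

/-- Left derivatives supercommute, and a nonzero entry of P joins indices of opposite parities, so
the Koszul signs of all summands agree. This reduces bracket identities to their constant terms. -/
theorem deriv_poisson (hP : IsOddSymmetric p P) {a : ZMod 2} {f : FormalFunctions K p}
    (hf : HasParity a f) (g : FormalFunctions K p) (i : I) :
    deriv i (poisson P f g) = sgn K (p i) 1 • poisson P (deriv i f) g +
      sgn K (p i) (a + 1) • poisson P f (deriv i g) := by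
  rw [poisson_eq_sum hf, poisson_eq_sum (hf.deriv i), poisson_eq_sum hf, deriv_map_sum]
  simp only [deriv_map_sum, Finset.smul_sum, ← Finset.sum_add_distrib]
  refine Finset.sum_congr rfl fun k _ => Finset.sum_congr rfl fun l _ => ?_
  rw [deriv_map_smul, deriv_leibniz, (hf.deriv k).twist_eq, deriv_deriv i k, deriv_deriv i l]
  simp only [mul_smul_left, mul_smul_right, smul_smul, smul_add]
  by_cases h0 : P k l = 0
  · simp [h0]
  · have hl := hP.odd k l h0
    congr 2
    · rw [hl]
      rcases zmod_two_cases (p i) with h | h <;> rcases zmod_two_cases (p k) with h' | h' <;>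
        rcases zmod_two_cases a with h'' | h'' <;>
        simp [h, h', h'', sgn_zero_left, sgn_zero_right, sgn_one_one, zmod_two_one_add_one]
    · rw [hl]
      rcases zmod_two_cases (p i) with h | h <;> rcases zmod_two_cases (p k) with h' | h' <;>
        rcases zmod_two_cases a with h'' | h'' <;>
        simp [h, h', h'', sgn_zero_left, sgn_zero_right, sgn_one_one, zmod_two_one_add_one]

theorem FormalFunctions.HasParity.poisson (hP : IsOddSymmetric p P) {a b : ZMod 2}
    {f g : FormalFunctions K p}
    (hf : HasParity a f) (hg : HasParity b g) : HasParity (a + b + 1) (poisson P f g) := by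
  rw [poisson_eq_sum hf]
  refine HasParity.sum fun k _ => HasParity.sum fun l _ => ?_
  by_cases h0 : P k l = 0
  · rw [h0, zero_mul, zero_smul]
    exact HasParity.zero _
  · have := ((hf.deriv k).mul (hg.deriv l)).smul (P k l * sgn K (p l) a)
    rw [hP.odd k l h0] at this
    convert this using 1
    · have h (a b q : ZMod 2) : a + b + 1 = a + q + (b + (q + 1)) := by
        revert a b q; decide
      exact h a b (p k)
    · rw [hP.odd k l h0]

end PoissonCalculus

/-! ### Lie and Batalin-Vilkovisky identities -/

section PoissonIdentities

open FormalFunctions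

variable {K I : Type*} [Field K] [Fintype I] {p : I → ZMod 2} {P : Matrix I I K}

/-- Exchanging two contractions with P. Each contraction is odd, so the exchange produces the signs
behind the cancellations below. -/
theorem sum_four_swap {M : Type*} [AddCommMonoid M] (F : I → I → I → I → M) :
    ∑ k, ∑ l, ∑ i, ∑ j, F k l i j = ∑ k, ∑ l, ∑ i, ∑ j, F i j k l := by
  have h (G : I → I → I → I → M) : ∑ k, ∑ l, ∑ i, ∑ j, G k l i j =
      ∑ x : I × I, ∑ y : I × I, G x.1 x.2 y.1 y.2 := by
    simp only [Fintype.sum_prod_type]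
  rw [h, h, Finset.sum_comm]

/-- By induction on the word only constant terms matter. They are bilinear in the linear
coefficients, where the claim is the symmetry of P. -/
theorem poisson_symm (hP : IsOddSymmetric p P) {a b : ZMod 2} {f g : FormalFunctions K p}
    (hf : HasParity a f) (hg : HasParity b g) : poisson P f g = sgn K a b • poisson P g f := by
  refine ext_coeff fun w => ?_
  induction w generalizing a b f g with
  | nil =>
    rw [Submodule.coe_smul, Pi.smul_apply, poisson_nil hf, poisson_nil hg, Finset.smul_sum,
      Finset.sum_comm]
    refine Finset.sum_congr rfl fun k _ => ?_
    rw [Finset.smul_sum]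
    refine Finset.sum_congr rfl fun l _ => ?_
    rw [hP.symm l k]
    by_cases h0 : P k l = 0
    · simp [h0]
    have hl := hP.odd k l h0
    rcases hf.eq_or_eq_zero [l] with h1 | h1
    · rcases hg.eq_or_eq_zero [k] with h2 | h2
      · simp only [wordParity, List.map_cons, List.map_nil, List.sum_cons, List.sum_nil,
          add_zero] at h1 h2
        rw [← h1, ← h2, hl, smul_eq_mul]
        rcases zmod_two_cases (p k) with h | h <;>
          simp [h, sgn_zero_left, sgn_zero_right, zmod_two_one_add_one, mul_comm]
      · simp [h2]
    · simp [h1]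
  | cons i w ih =>
    rw [Submodule.coe_smul, Pi.smul_apply, ← deriv_apply, ← deriv_apply, deriv_poisson hP hf,
      deriv_poisson hP hg]
    simp only [Submodule.coe_add, Pi.add_apply, Submodule.coe_smul, Pi.smul_apply, smul_eq_mul]
    rw [ih (hf.deriv i) hg, ih hf (hg.deriv i)]
    simp only [Submodule.coe_smul, Pi.smul_apply, smul_eq_mul]
    rcases zmod_two_cases (p i) with h | h <;> rcases zmod_two_cases a with h' | h' <;>
      rcases zmod_two_cases b with h'' | h'' <;>
      simp [h, h', h'', sgn_zero_left, sgn_zero_right, sgn_one_one, zmod_two_one_add_one] <;> ring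

theorem poisson_singleton (hP : IsOddSymmetric p P) {a : ZMod 2} {f : FormalFunctions K p}
    (hf : HasParity a f) (g : FormalFunctions K p) (k : I) :
    (poisson P f g : List I → K) [k] =
      ∑ i, ∑ j, (P i j * (sgn K (p k) 1 * sgn K (p j) (a + p k) *
          ((f : List I → K) [k, i] * (g : List I → K) [j])) +
        P i j * (sgn K (p k) (a + 1) * sgn K (p j) a *
          ((f : List I → K) [i] * (g : List I → K) [k, j]))) := by
  rw [← deriv_apply, deriv_poisson hP hf]
  simp only [Submodule.coe_add, Pi.add_apply, Submodule.coe_smul, Pi.smul_apply, smul_eq_mul]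
  rw [poisson_nil hf, poisson_nil (hf.deriv k)]
  simp only [Finset.mul_sum, ← Finset.sum_add_distrib, deriv_apply]
  refine Finset.sum_congr rfl fun i _ => Finset.sum_congr rfl fun j _ => ?_
  ring

/-- Each constant term contains a second derivative of exactly one of f, g, h. After exchanging the
two contractions, the terms with second derivatives of g and of h match across the equation (`e1`,
`e2`), and those with second derivatives of f cancel on the right (`e3`). -/
theorem poisson_jacobi_nil (hP : IsOddSymmetric p P) {a b : ZMod 2} {f g : FormalFunctions K p}
    (hf : HasParity a f) (hg : HasParity b g) (h : FormalFunctions K p) :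
    (poisson P f (poisson P g h) : List I → K) [] =
      sgn K 1 (a + 1) * (poisson P (poisson P f g) h : List I → K) [] +
      sgn K (a + 1) (b + 1) * (poisson P g (poisson P f h) : List I → K) [] := by
  rw [poisson_nil hf, poisson_nil hg, poisson_nil (hf.poisson hP hg)]
  simp only [poisson_singleton hP hf, poisson_singleton hP hg]
  simp only [Finset.mul_sum, Finset.sum_mul, mul_add, add_mul, Finset.sum_add_distrib]
  have e1 : ∑ k, ∑ l, ∑ i, ∑ j, P k l * sgn K (p l) a * ((f : List I → K) [k] * (P i j *
      (sgn K (p l) 1 * sgn K (p j) (b + p l) *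
        ((g : List I → K) [l, i] * (h : List I → K) [j])))) =
      ∑ k, ∑ l, ∑ i, ∑ j, sgn K 1 (a + 1) * (P k l * sgn K (p l) (a + b + 1) * (P i j *
      (sgn K (p k) (a + 1) * sgn K (p j) a *
        ((f : List I → K) [i] * (g : List I → K) [k, j])) * (h : List I → K) [l])) := by
    rw [sum_four_swap]
    refine Finset.sum_congr rfl fun k _ => Finset.sum_congr rfl fun l _ =>
      Finset.sum_congr rfl fun i _ => Finset.sum_congr rfl fun j _ => ?_
    by_cases h0 : P k l = 0
    · simp [h0]
    by_cases h0' : P i j = 0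
    · simp [h0']
    have hl := hP.odd k l h0
    have hj := hP.odd i j h0'
    rcases hf.eq_or_eq_zero [i] with h1 | h1
    · rcases hg.eq_or_eq_zero [j, k] with h2 | h2
      · rw [wordParity_singleton] at h1
        rw [wordParity_pair] at h2
        rw [coeff_swap g k j, ← h1, ← h2, hl, hj]
        rcases zmod_two_cases (p k) with h | h <;> rcases zmod_two_cases (p i) with h' | h' <;>
          simp [h, h', sgn_zero_left, sgn_zero_right, sgn_one_one, zmod_two_one_add_one] <;> ring
      · rw [coeff_swap g k j, h2]
        simp
    · simp [h1]
  have e2 : ∑ k, ∑ l, ∑ i, ∑ j, P k l * sgn K (p l) a * ((f : List I → K) [k] * (P i j *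
      (sgn K (p l) (b + 1) * sgn K (p j) b *
        ((g : List I → K) [i] * (h : List I → K) [l, j])))) =
      ∑ k, ∑ l, ∑ i, ∑ j, sgn K (a + 1) (b + 1) * (P k l * sgn K (p l) b *
      ((g : List I → K) [k] * (P i j * (sgn K (p l) (a + 1) * sgn K (p j) a *
        ((f : List I → K) [i] * (h : List I → K) [l, j]))))) := by
    rw [sum_four_swap]
    refine Finset.sum_congr rfl fun k _ => Finset.sum_congr rfl fun l _ =>
      Finset.sum_congr rfl fun i _ => Finset.sum_congr rfl fun j _ => ?_
    by_cases h0 : P k l = 0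
    · simp [h0]
    by_cases h0' : P i j = 0
    · simp [h0']
    have hl := hP.odd k l h0
    have hj := hP.odd i j h0'
    rcases hf.eq_or_eq_zero [i] with h1 | h1
    · rcases hg.eq_or_eq_zero [k] with h2 | h2
      · rw [wordParity_singleton] at h1 h2
        rw [coeff_swap h j l, ← h1, ← h2, hl, hj]
        rcases zmod_two_cases (p k) with h | h <;> rcases zmod_two_cases (p i) with h' | h' <;>
          simp [h, h', sgn_zero_left, sgn_zero_right, sgn_one_one, zmod_two_one_add_one] <;> ring
      · simp [h2]
    · simp [h1]
  have e3 : (∑ k, ∑ l, ∑ i, ∑ j, sgn K 1 (a + 1) * (P k l * sgn K (p l) (a + b + 1) * (P i j *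
      (sgn K (p k) 1 * sgn K (p j) (a + p k) *
        ((f : List I → K) [k, i] * (g : List I → K) [j])) * (h : List I → K) [l]))) +
      ∑ k, ∑ l, ∑ i, ∑ j, sgn K (a + 1) (b + 1) * (P k l * sgn K (p l) b *
      ((g : List I → K) [k] * (P i j * (sgn K (p l) 1 * sgn K (p j) (a + p l) *
        ((f : List I → K) [l, i] * (h : List I → K) [j]))))) = 0 := by
    rw [sum_four_swap (fun k l i j => sgn K (a + 1) (b + 1) * (P k l * sgn K (p l) b *
      ((g : List I → K) [k] * (P i j * (sgn K (p l) 1 * sgn K (p j) (a + p l) *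
        ((f : List I → K) [l, i] * (h : List I → K) [j]))))))]
    rw [← Finset.sum_add_distrib]
    refine Finset.sum_eq_zero fun k _ => ?_
    rw [← Finset.sum_add_distrib]
    refine Finset.sum_eq_zero fun l _ => ?_
    rw [Finset.sum_comm, ← Finset.sum_add_distrib]
    refine Finset.sum_eq_zero fun j _ => ?_
    rw [← Finset.sum_add_distrib]
    refine Finset.sum_eq_zero fun i _ => ?_
    rw [hP.symm i j]
    by_cases h0 : P k l = 0
    · simp [h0]
    by_cases h0' : P j i = 0
    · simp [h0']
    have hl := hP.odd k l h0
    have hj := hP.odd j i h0'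
    rcases hf.eq_or_eq_zero [k, i] with h1 | h1
    · rcases hg.eq_or_eq_zero [j] with h2 | h2
      · rw [wordParity_singleton] at h2
        rw [wordParity_pair] at h1
        rw [coeff_swap f i k, ← h1, ← h2, hl, hj]
        rcases zmod_two_cases (p k) with h | h <;> rcases zmod_two_cases (p j) with h' | h' <;>
          simp [h, h', sgn_zero_left, sgn_zero_right, sgn_one_one, zmod_two_one_add_one] <;> ring
      · simp [h2]
    · rw [coeff_swap f i k, h1]
      simp
  rw [e1, e2]
  linear_combination -e3

/-- The graded Jacobi identity. -/
theorem poisson_jacobi (hP : IsOddSymmetric p P) {a b : ZMod 2} {f g : FormalFunctions K p}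
    (hf : HasParity a f) (hg : HasParity b g) (h : FormalFunctions K p) :
    poisson P f (poisson P g h) = sgn K 1 (a + 1) • poisson P (poisson P f g) h +
      sgn K (a + 1) (b + 1) • poisson P g (poisson P f h) := by
  refine ext_coeff fun w => ?_
  induction w generalizing a b f g h with
  | nil => exact poisson_jacobi_nil hP hf hg h
  | cons i w ih =>
    rw [← deriv_apply, ← deriv_apply, deriv_map_add, deriv_map_smul, deriv_map_smul,
      deriv_poisson hP hf, deriv_poisson hP hg, deriv_poisson hP (hf.poisson hP hg),
      deriv_poisson hP hg, deriv_poisson hP hf, deriv_poisson hP hf]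
    simp only [poisson_add_left, poisson_add_right, poisson_smul_left, poisson_smul_right]
    have h1 := ih (hf.deriv i) hg h
    have h2 := ih hf (hg.deriv i) h
    have h3 := ih hf hg (deriv i h)
    simp only [Submodule.coe_add, Pi.add_apply, Submodule.coe_smul, Pi.smul_apply,
      smul_eq_mul] at h1 h2 h3 ⊢
    rw [h1, h2, h3]
    rcases zmod_two_cases (p i) with h | h <;> rcases zmod_two_cases a with h' | h' <;>
      rcases zmod_two_cases b with h'' | h'' <;>
      simp [h, h', h'', sgn_zero_left, sgn_zero_right, sgn_one_one, zmod_two_one_add_one] <;> ring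

theorem FormalFunctions.HasParity.laplacian (hP : IsOddSymmetric p P) {a : ZMod 2}
    {f : FormalFunctions K p} (hf : HasParity a f) :
    HasParity (a + 1) (BVQuant.laplacian P f) := by
  refine HasParity.smul _ (HasParity.sum fun k _ => HasParity.sum fun l _ => ?_)
  by_cases h0 : P k l = 0
  · rw [h0, zero_smul]
    exact HasParity.zero _
  · have := ((hf.deriv l).deriv k).smul (P k l)
    have h (a q : ZMod 2) : a + (q + 1) + q = a + 1 := by
      revert a q; decide
    rwa [hP.odd k l h0, h] at this

variable [CharZero K]

theorem eq_zero_of_eq_neg {M : Type*} [AddCommGroup M] [Module K M] {x : M} (h : x = -x) :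
    x = 0 := by
  have h2 : (2 : K) • x = 0 := by
    rw [two_smul]
    nth_rewrite 2 [h]
    exact add_neg_cancel x
  exact (smul_eq_zero.1 h2).resolve_left two_ne_zero

/-- The operator ∑ P k l ∂_k ∂_l is odd and has constant coefficients, so it anticommutes with
itself. -/
theorem laplacian_laplacian (hP : IsOddSymmetric p P) (f : FormalFunctions K p) :
    laplacian P (laplacian P f) = 0 := by
  have h : ∑ k, ∑ l, ∑ i, ∑ j, (P k l * P i j) • deriv k (deriv l (deriv i (deriv j f))) = 0 := by
    apply eq_zero_of_eq_neg (K := K)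
    nth_rewrite 1 [sum_four_swap]
    simp only [← Finset.sum_neg_distrib]
    refine Finset.sum_congr rfl fun k _ => Finset.sum_congr rfl fun l _ =>
      Finset.sum_congr rfl fun i _ => Finset.sum_congr rfl fun j _ => ?_
    by_cases h0 : P k l = 0
    · simp [h0]
    by_cases h0' : P i j = 0
    · simp [h0']
    rw [deriv_deriv j k, deriv_map_smul, deriv_deriv i k, deriv_deriv j l]
    simp only [deriv_map_smul]
    rw [deriv_deriv i l, smul_smul, smul_smul, smul_smul]
    simp only [deriv_map_smul, smul_smul]
    rw [← neg_smul_eq]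
    congr 1
    rw [hP.odd k l h0, hP.odd i j h0']
    rcases zmod_two_cases (p i) with h | h <;> rcases zmod_two_cases (p k) with h' | h' <;>
      simp [h, h', sgn_zero_left, sgn_zero_right, sgn_one_one, zmod_two_one_add_one, mul_comm]
  rw [laplacian, laplacian]
  simp only [deriv_map_smul, deriv_map_sum, Finset.smul_sum, smul_smul]
  rw [← smul_zero ((2 : K)⁻¹ * 2⁻¹), ← h]
  simp only [Finset.smul_sum, smul_smul]
  refine Finset.sum_congr rfl fun k _ => Finset.sum_congr rfl fun l _ =>
    Finset.sum_congr rfl fun i _ => Finset.sum_congr rfl fun j _ => ?_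
  congr 1
  ring

/-- These are the mixed terms of Δ{f, g}, with one derivative of Δ on each argument. Exchanging the
contraction of Δ with that of the bracket changes the sign. -/
theorem sum_smul_poisson_deriv (hP : IsOddSymmetric p P) {a : ZMod 2} {f : FormalFunctions K p}
    (hf : HasParity a f) (g : FormalFunctions K p) :
    ∑ k, ∑ l, (P k l * (sgn K (p k) 1 * sgn K (p l) (a + 1))) •
      poisson P (deriv k f) (deriv l g) = 0 := by
  have h : ∑ k, ∑ l, ∑ i, ∑ j, (P k l * P i j *
      (sgn K (p k) 1 * sgn K (p l) (a + 1) * sgn K (p j) (a + p k))) •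
        mul (deriv i (deriv k f)) (deriv j (deriv l g)) = 0 := by
    apply eq_zero_of_eq_neg (K := K)
    nth_rewrite 1 [sum_four_swap]
    simp only [← Finset.sum_neg_distrib]
    refine Finset.sum_congr rfl fun k _ => Finset.sum_congr rfl fun l _ =>
      Finset.sum_congr rfl fun i _ => Finset.sum_congr rfl fun j _ => ?_
    by_cases h0 : P k l = 0
    · simp [h0]
    by_cases h0' : P i j = 0
    · simp [h0']
    rw [deriv_deriv k i, deriv_deriv l j, mul_smul_left, mul_smul_right, smul_smul, smul_smul,
      ← neg_smul_eq]
    congr 1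
    rw [hP.odd k l h0, hP.odd i j h0']
    rcases zmod_two_cases (p i) with h | h <;> rcases zmod_two_cases (p k) with h' | h' <;>
      rcases zmod_two_cases a with h'' | h'' <;>
      simp [h, h', h'', sgn_zero_left, sgn_zero_right, sgn_one_one, zmod_two_one_add_one, mul_comm]
  rw [← h]
  refine Finset.sum_congr rfl fun k _ => Finset.sum_congr rfl fun l _ => ?_
  rw [poisson_eq_sum (hf.deriv k)]
  simp only [Finset.smul_sum, smul_smul]
  refine Finset.sum_congr rfl fun i _ => Finset.sum_congr rfl fun j _ => ?_
  congr 1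
  ring

/-- The BV Laplacian is a derivation of the bracket. -/
theorem laplacian_poisson (hP : IsOddSymmetric p P) {a : ZMod 2} {f : FormalFunctions K p}
    (hf : HasParity a f) (g : FormalFunctions K p) :
    laplacian P (poisson P f g) =
      -poisson P (laplacian P f) g - sgn K 1 a • poisson P f (laplacian P g) := by
  -- Differentiating the bracket twice gives two pure terms, which form the right-hand side, and two
  -- mixed terms, each of which sums to zero.
  have e0 : laplacian P (poisson P f g) = (2 : K)⁻¹ • ∑ k, ∑ l,
      (-(P k l • poisson P (deriv k (deriv l f)) g) +
        (P k l * (sgn K (p l) 1 * sgn K (p k) (a + 1))) • poisson P (deriv l f) (deriv k g) +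
        (P k l * (sgn K (p k) 1 * sgn K (p l) (a + 1))) • poisson P (deriv k f) (deriv l g) -
        sgn K 1 a • (P k l • poisson P f (deriv k (deriv l g)))) := by
    rw [laplacian]
    congr 1
    refine Finset.sum_congr rfl fun k _ => Finset.sum_congr rfl fun l _ => ?_
    by_cases h0 : P k l = 0
    · simp [h0]
    rw [deriv_poisson hP hf, deriv_map_add, deriv_map_smul, deriv_map_smul,
      deriv_poisson hP (hf.deriv l), deriv_poisson hP hf]
    simp only [smul_add, smul_smul]
    rw [← neg_smul_eq, sub_eq_add_neg, ← neg_smul_eq]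
    rw [hP.odd k l h0]
    have e1 : P k l * (sgn K (p k + 1) 1 * sgn K (p k) 1) = -P k l := by
      rcases zmod_two_cases (p k) with h' | h' <;>
        simp [h', sgn_zero_left, sgn_one_one, zmod_two_one_add_one]
    have e2 : P k l * (sgn K (p k + 1) 1 * sgn K (p k) (a + (p k + 1) + 1)) =
        P k l * (sgn K (p k + 1) 1 * sgn K (p k) (a + 1)) := by
      rcases zmod_two_cases (p k) with h' | h' <;> rcases zmod_two_cases a with h'' | h'' <;>
        simp [h', h'', sgn_zero_left, sgn_zero_right, sgn_one_one, zmod_two_one_add_one]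
    have e3 : P k l * (sgn K (p k + 1) (a + 1) * sgn K (p k) 1) =
        P k l * (sgn K (p k) 1 * sgn K (p k + 1) (a + 1)) := by ring
    have e4 : P k l * (sgn K (p k + 1) (a + 1) * sgn K (p k) (a + 1)) = -(sgn K 1 a * P k l) := by
      rcases zmod_two_cases (p k) with h' | h' <;> rcases zmod_two_cases a with h'' | h'' <;>
        simp [h', h'', sgn_zero_left, sgn_zero_right, sgn_one_one, zmod_two_one_add_one]
    rw [← e1, ← e2, ← e3, ← e4]
    abel
  have e5 : ∑ k, ∑ l, (P k l * (sgn K (p l) 1 * sgn K (p k) (a + 1))) •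
      poisson P (deriv l f) (deriv k g) = 0 := by
    rw [Finset.sum_comm, ← sum_smul_poisson_deriv hP hf g]
    refine Finset.sum_congr rfl fun k _ => Finset.sum_congr rfl fun l _ => ?_
    rw [hP.symm l k]
  rw [e0]
  simp only [Finset.sum_add_distrib, Finset.sum_sub_distrib, Finset.sum_neg_distrib]
  rw [e5, sum_smul_poisson_deriv hP hf g, add_zero, add_zero, laplacian, laplacian,
    poisson_smul_left, poisson_smul_right]
  simp only [poisson_sum_left, poisson_sum_right, poisson_smul_left, poisson_smul_right,
    smul_sub, smul_neg, Finset.smul_sum]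
  congr 1
  refine Finset.sum_congr rfl fun k _ => Finset.sum_congr rfl fun l _ => ?_
  rw [smul_comm]

end PoissonIdentities

/-! ## Series of operators acting on series of vectors -/

section SeriesAct

open PowerSeries

variable {K E : Type*} [Field K] [AddCommGroup E] [Module K E]

/-- The action of a power series of operators on a power series of vectors. -/
noncomputable def seriesAct (F : PowerSeries (Module.End K E)) (m : ℕ → E) : ℕ → E :=
  fun n => ∑ x ∈ Finset.HasAntidiagonal.antidiagonal n, coeff x.1 F (m x.2)

theorem seriesAct_mul (F G : PowerSeries (Module.End K E)) (m : ℕ → E) :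
    seriesAct (F * G) m = seriesAct F (seriesAct G m) := by
  funext n
  simp only [seriesAct, coeff_mul, LinearMap.sum_apply, map_sum, Module.End.mul_apply,
    Finset.sum_sigma']
  apply Finset.sum_nbij' (fun ⟨⟨_i, j⟩, ⟨k, l⟩⟩ ↦ ⟨(k, l + j), (l, j)⟩)
    (fun ⟨⟨i, _j⟩, ⟨k, l⟩⟩ ↦ ⟨(i + k, l), (i, k)⟩)
  · rintro ⟨⟨i, j⟩, ⟨k, l⟩⟩ h
    simp only [Finset.mem_sigma, Finset.HasAntidiagonal.mem_antidiagonal] at h ⊢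
    exact ⟨by omega, trivial⟩
  · rintro ⟨⟨i, j⟩, ⟨k, l⟩⟩ h
    simp only [Finset.mem_sigma, Finset.HasAntidiagonal.mem_antidiagonal] at h ⊢
    exact ⟨by omega, trivial⟩
  · rintro ⟨⟨i, j⟩, ⟨k, l⟩⟩ h
    simp only [Finset.mem_sigma, Finset.HasAntidiagonal.mem_antidiagonal] at h
    obtain ⟨_, rfl⟩ := h
    rfl
  · rintro ⟨⟨i, j⟩, ⟨k, l⟩⟩ h
    simp only [Finset.mem_sigma, Finset.HasAntidiagonal.mem_antidiagonal] at h
    obtain ⟨_, rfl⟩ := h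
    rfl
  · rintro ⟨⟨i, j⟩, ⟨k, l⟩⟩ _
    rfl

theorem seriesAct_one (m : ℕ → E) : seriesAct (1 : PowerSeries (Module.End K E)) m = m := by
  funext n
  rw [seriesAct, Finset.sum_eq_single (0, n)]
  · simp [coeff_one]
  · rintro ⟨a, b⟩ hx hne
    simp only [Finset.HasAntidiagonal.mem_antidiagonal, ne_eq, Prod.mk.injEq, not_and] at hx hne
    rw [coeff_one, if_neg (by omega), LinearMap.zero_apply]
  · simp

theorem seriesAct_pow (F : PowerSeries (Module.End K E)) (m : ℕ → E) (k : ℕ) :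
    seriesAct (F ^ k) m = (seriesAct F)^[k] m := by
  induction k with
  | zero => exact seriesAct_one m
  | succ k ih => rw [pow_succ', seriesAct_mul, ih, Function.iterate_succ_apply']

theorem seriesAct_zero_right (F : PowerSeries (Module.End K E)) : seriesAct F 0 = 0 := by
  funext n
  simp [seriesAct]

theorem seriesAct_expSeries {Y : PowerSeries (Module.End K E)} (hY : coeff 0 Y = 0) (m : ℕ → E)
    (n : ℕ) : seriesAct (expSeries K Y) m n =
      ∑ k ∈ Finset.range (n + 1), (k.factorial : K)⁻¹ • (seriesAct Y)^[k] m n := by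
  have h : ∀ x ∈ Finset.HasAntidiagonal.antidiagonal n, coeff x.1 (expSeries K Y) (m x.2) =
      ∑ k ∈ Finset.range (n + 1), (k.factorial : K)⁻¹ • coeff x.1 (Y ^ k) (m x.2) := by
    intro x hx
    rw [Finset.HasAntidiagonal.mem_antidiagonal] at hx
    rw [expSeries, coeff_sumSeries_of_le (coeff_dividedPower_eq_zero hY) (n := n) (by omega),
      LinearMap.sum_apply]
    rfl
  rw [seriesAct, Finset.sum_congr rfl h, Finset.sum_comm]
  refine Finset.sum_congr rfl fun k _ => ?_
  rw [← seriesAct_pow, seriesAct, Finset.smul_sum]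

end SeriesAct

/-! ## The gauge action -/

section Gauge

open FormalFunctions PowerSeries

variable {K I : Type*} [Field K] [Fintype I] {p : I → ZMod 2} {P : Matrix I I K}

/-- The extension of `Ŝ V^*` by the Laplacian: the pair `(f, c)` stands for `f + c Δ`. -/
structure LaplacianExtension (K : Type*) {I : Type*} [Field K] (p : I → ZMod 2) where
  /-- The formal function. -/
  fst : FormalFunctions K p
  /-- The coefficient of the Laplacian. -/
  snd : K

namespace LaplacianExtension

variable {J : Type*} {q : J → ZMod 2}

/-- The underlying pair. -/
def equivProd : LaplacianExtension K q ≃ FormalFunctions K q × K where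
  toFun v := (v.fst, v.snd)
  invFun v := ⟨v.1, v.2⟩
  left_inv _ := rfl
  right_inv _ := rfl

instance : AddCommGroup (LaplacianExtension K q) := equivProd.addCommGroup

instance : Module K (LaplacianExtension K q) := equivProd.module K

@[simp] theorem fst_add (v w : LaplacianExtension K q) : (v + w).fst = v.fst + w.fst := rfl
@[simp] theorem snd_add (v w : LaplacianExtension K q) : (v + w).snd = v.snd + w.snd := rfl
@[simp] theorem fst_sub (v w : LaplacianExtension K q) : (v - w).fst = v.fst - w.fst := rfl
@[simp] theorem fst_neg (v : LaplacianExtension K q) : (-v).fst = -v.fst := rfl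
@[simp] theorem snd_sub (v w : LaplacianExtension K q) : (v - w).snd = v.snd - w.snd := rfl
@[simp] theorem snd_neg (v : LaplacianExtension K q) : (-v).snd = -v.snd := rfl
@[simp] theorem fst_zero : (0 : LaplacianExtension K q).fst = 0 := rfl
@[simp] theorem snd_zero : (0 : LaplacianExtension K q).snd = 0 := rfl
@[simp] theorem fst_smul (c : K) (v : LaplacianExtension K q) : (c • v).fst = c • v.fst := rfl
@[simp] theorem snd_smul (c : K) (v : LaplacianExtension K q) : (c • v).snd = c * v.snd := rfl

/-- The first component, as a linear map. -/
def fstHom : LaplacianExtension K q →ₗ[K] FormalFunctions K q where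
  toFun v := v.fst
  map_add' _ _ := rfl
  map_smul' _ _ := rfl

/-- The second component, as a linear map. -/
def sndHom : LaplacianExtension K q →ₗ[K] K where
  toFun v := v.snd
  map_add' _ _ := rfl
  map_smul' _ _ := rfl

theorem fst_sum {T : Type*} (s : Finset T) (v : T → LaplacianExtension K q) :
    (∑ t ∈ s, v t).fst = ∑ t ∈ s, (v t).fst := map_sum fstHom v s

theorem snd_sum {T : Type*} (s : Finset T) (v : T → LaplacianExtension K q) :
    (∑ t ∈ s, v t).snd = ∑ t ∈ s, (v t).snd := map_sum sndHom v s

theorem ext {v w : LaplacianExtension K q} (h1 : v.fst = w.fst) (h2 : v.snd = w.snd) :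
    v = w := by
  cases v
  cases w
  cases h1
  cases h2
  rfl

end LaplacianExtension

open LaplacianExtension

/-- The adjoint action of `y` on the extension of `Ŝ V^*` by the Laplacian. -/
def adjointOp (P : Matrix I I K) (y : FormalFunctions K p) :
    Module.End K (LaplacianExtension K p) where
  -- The bracket of y with Δ is taken to be Δ y, matching the term d y = ħ Δ y of the gauge action;
  -- no multiple of Δ is ever produced.
  toFun v := .mk (poisson P y v.fst + v.snd • laplacian P y) 0
  map_add' v w := by
    refine LaplacianExtension.ext ?_ (by simp)
    simp only [fst_add, snd_add, poisson_add_right, add_smul]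
    abel
  map_smul' c v := by
    refine LaplacianExtension.ext ?_ (by simp)
    simp only [fst_smul, snd_smul,
    poisson_smul_right, smul_add, mul_smul,
      RingHom.id_apply]

theorem adjointOp_apply (y : FormalFunctions K p) (v : LaplacianExtension K p) :
    adjointOp P y v = .mk (poisson P y v.fst + v.snd • laplacian P y) 0 := rfl

/-- `adjointOp` as a linear map. -/
def adjointHom (P : Matrix I I K) :
    FormalFunctions K p →ₗ[K] Module.End K (LaplacianExtension K p) where
  toFun := adjointOp P
  map_add' y z := LinearMap.ext fun v => by
    refine LaplacianExtension.ext ?_ (by simp [adjointOp_apply])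
    simp only [fst_add, adjointOp_apply, LinearMap.add_apply, poisson_add_left,
      laplacian_add, smul_add]
    abel
  map_smul' c y := LinearMap.ext fun v => by
    refine LaplacianExtension.ext ?_ (by simp [adjointOp_apply])
    simp only [fst_smul, adjointOp_apply, LinearMap.smul_apply, poisson_smul_left,
      laplacian_smul, smul_add, RingHom.id_apply]
    rw [smul_comm]

theorem adjointHom_apply (y : FormalFunctions K p) : adjointHom P y = adjointOp P y := rfl

/-- The adjoint action of an even element `m` of the extension of `Ŝ V^*` by the Laplacian. -/
def evenAdjointOp (P : Matrix I I K) (m : LaplacianExtension K p) :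
    Module.End K (LaplacianExtension K p) where
  toFun v := .mk (poisson P m.fst v.fst + m.snd • laplacian P v.fst + v.snd • laplacian P m.fst) 0
  map_add' v w := by
    refine LaplacianExtension.ext ?_ (by simp)
    simp only [fst_add, snd_add, poisson_add_right, add_smul, laplacian_add, smul_add]
    abel
  map_smul' c v := by
    refine LaplacianExtension.ext ?_ (by simp)
    simp only [fst_smul, snd_smul,
    poisson_smul_right, smul_add, mul_smul,
      RingHom.id_apply, laplacian_smul]
    rw [smul_comm m.snd c]

theorem evenAdjointOp_apply (m v : LaplacianExtension K p) : evenAdjointOp P m v =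
    .mk (poisson P m.fst v.fst + m.snd • laplacian P v.fst + v.snd • laplacian P m.fst) 0 := rfl

/-- `evenAdjointOp` as a linear map. -/
def evenAdjointHom (P : Matrix I I K) :
    LaplacianExtension K p →ₗ[K] Module.End K (LaplacianExtension K p) where
  toFun := evenAdjointOp P
  map_add' y z := LinearMap.ext fun v => by
    refine LaplacianExtension.ext ?_ (by simp [evenAdjointOp_apply])
    simp only [fst_add, snd_add, evenAdjointOp_apply, LinearMap.add_apply,
      poisson_add_left, laplacian_add, smul_add, add_smul]
    abel
  map_smul' c y := LinearMap.ext fun v => by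
    refine LaplacianExtension.ext ?_ (by simp [evenAdjointOp_apply])
    simp only [fst_smul, snd_smul,
    evenAdjointOp_apply, LinearMap.smul_apply, poisson_smul_left, laplacian_smul, smul_add,
      RingHom.id_apply, mul_smul]
    rw [smul_comm v.snd c]

theorem evenAdjointHom_apply (m : LaplacianExtension K p) :
    evenAdjointHom P m = evenAdjointOp P m := rfl

theorem poisson_jacobi_odd_odd (hP : IsOddSymmetric p P) {y z : FormalFunctions K p}
    (hy : HasParity 1 y) (hz : HasParity 1 z) (f : FormalFunctions K p) :
    poisson P y (poisson P z f) = poisson P (poisson P y z) f + poisson P z (poisson P y f) := by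
  rw [poisson_jacobi hP hy hz, zmod_two_one_add_one, sgn_zero_right, sgn_zero_right, one_smul,
    one_smul]

theorem poisson_jacobi_odd_even (hP : IsOddSymmetric p P) {y x : FormalFunctions K p}
    (hy : HasParity 1 y) (hx : HasParity 0 x) (f : FormalFunctions K p) :
    poisson P y (poisson P x f) = poisson P (poisson P y x) f + poisson P x (poisson P y f) := by
  rw [poisson_jacobi hP hy hx, zmod_two_one_add_one, sgn_zero_right, sgn_zero_left, one_smul,
    one_smul]

theorem poisson_jacobi_even_even (hP : IsOddSymmetric p P) {x z : FormalFunctions K p}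
    (hx : HasParity 0 x) (hz : HasParity 0 z) (f : FormalFunctions K p) :
    poisson P x (poisson P z f) + poisson P z (poisson P x f) = -poisson P (poisson P x z) f := by
  rw [poisson_jacobi hP hx hz, zero_add, sgn_one_one, neg_smul_eq, one_smul, neg_smul_eq, one_smul]
  abel

theorem poisson_symm_even (hP : IsOddSymmetric p P) {a : ZMod 2} {x f : FormalFunctions K p}
    (hx : HasParity 0 x) (hf : HasParity a f) : poisson P f x = poisson P x f := by
  rw [poisson_symm hP hf hx, sgn_zero_right, one_smul]

theorem HasParity.laplacian_of_odd (hP : IsOddSymmetric p P) {y : FormalFunctions K p}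
    (hy : HasParity 1 y) : HasParity 0 (laplacian P y) := hy.laplacian hP

theorem HasParity.poisson_odd_odd (hP : IsOddSymmetric p P) {y z : FormalFunctions K p}
    (hy : HasParity 1 y) (hz : HasParity 1 z) : HasParity 1 (poisson P y z) := hy.poisson hP hz

theorem HasParity.poisson_odd_even (hP : IsOddSymmetric p P) {y x : FormalFunctions K p}
    (hy : HasParity 1 y) (hx : HasParity 0 x) : HasParity 0 (poisson P y x) := hy.poisson hP hx

/-- The series of operators given by `y`. -/
noncomputable def adjointSeries (P : Matrix I I K) (y : ComBV K p) :
    PowerSeries (Module.End K (LaplacianExtension K p)) :=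
  PowerSeries.mk fun n => adjointOp P (y n)

theorem coeff_adjointSeries (y : ComBV K p) (n : ℕ) :
    coeff n (adjointSeries P y) = adjointOp P (y n) := coeff_mk _ _

/-- The element `x + ħ Δ` of the extension by the Laplacian. -/
def addLaplacian (x : ComBV K p) : ℕ → LaplacianExtension K p :=
  fun n => .mk (x n) (if n = 1 then 1 else 0)

/-- The element `x`, in the extension by the Laplacian. -/
def withoutLaplacian (x : ComBV K p) : ℕ → LaplacianExtension K p := fun n => .mk (x n) 0

variable [CharZero K]

theorem laplacian_poisson_odd (hP : IsOddSymmetric p P) {y : FormalFunctions K p}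
    (hy : HasParity 1 y) (f : FormalFunctions K p) :
    laplacian P (poisson P y f) = -poisson P (laplacian P y) f + poisson P y (laplacian P f) := by
  rw [laplacian_poisson hP hy, sgn_one_one, neg_smul_eq, one_smul, sub_neg_eq_add]

theorem laplacian_poisson_even (hP : IsOddSymmetric p P) {x : FormalFunctions K p}
    (hx : HasParity 0 x) (f : FormalFunctions K p) :
    laplacian P (poisson P x f) = -poisson P (laplacian P x) f - poisson P x (laplacian P f) := by
  rw [laplacian_poisson hP hx, sgn_zero_right, one_smul]

/-- This is the Jacobi identity in the extension: on Ŝ V^* it is Jacobi for the bracket, and on Δ it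
is the derivation property of Δ. It makes the operators of odd elements a Lie algebra to which
Campbell-Hausdorff applies. -/
theorem adjointOp_commutator (hP : IsOddSymmetric p P) {y z : FormalFunctions K p}
    (hy : HasParity 1 y) (hz : HasParity 1 z) :
    adjointOp P y * adjointOp P z - adjointOp P z * adjointOp P y =
      adjointOp P (poisson P y z) := by
  refine LinearMap.ext fun v => LaplacianExtension.ext ?_ (by simp [adjointOp_apply])
  simp only [fst_sub, LinearMap.sub_apply, Module.End.mul_apply, adjointOp_apply, zero_smul,
    add_zero, poisson_add_right, poisson_smul_right]
  rw [poisson_jacobi_odd_odd hP hy hz, laplacian_poisson_odd hP hy,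
    poisson_symm_even hP (HasParity.laplacian_of_odd hP hy) hz |>.symm, smul_add, smul_neg]
  abel

/-- The operators given by the odd elements. -/
def oddAdjoint (p : I → ZMod 2) (P : Matrix I I K) :
    Submodule K (Module.End K (LaplacianExtension K p)) :=
  (ofParity K p 1).map (adjointHom P)

theorem oddAdjoint_commutator (hP : IsOddSymmetric p P) :
    ∀ a ∈ oddAdjoint p P, ∀ b ∈ oddAdjoint p P, a * b - b * a ∈ oddAdjoint p P := by
  rintro _ ⟨y, hy, rfl⟩ _ ⟨z, hz, rfl⟩
  exact ⟨poisson P y z, HasParity.poisson_odd_odd hP hy hz, (adjointOp_commutator hP hy hz).symm⟩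

/-- Jacobi for an odd and an even element of the extension; here Δ² = 0 is used as well, expressing
that Δ has zero bracket with itself. -/
theorem adjointOp_evenAdjointOp (hP : IsOddSymmetric p P) {y : FormalFunctions K p}
    {m : LaplacianExtension K p} (hy : HasParity 1 y) (hm : HasParity 0 m.fst) :
    adjointOp P y * evenAdjointOp P m - evenAdjointOp P m * adjointOp P y =
      evenAdjointOp P (adjointOp P y m) := by
  refine LinearMap.ext fun v =>
    LaplacianExtension.ext ?_ (by simp [adjointOp_apply, evenAdjointOp_apply])
  simp only [fst_sub, LinearMap.sub_apply, Module.End.mul_apply,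
    adjointOp_apply, evenAdjointOp_apply,
    zero_smul, add_zero, poisson_add_right, poisson_smul_right, poisson_add_left,
    poisson_smul_left, laplacian_add, laplacian_smul, laplacian_laplacian hP, smul_zero]
  rw [poisson_jacobi_odd_even hP hy hm, laplacian_poisson_odd hP hy, laplacian_poisson_odd hP hy,
    poisson_symm_even hP hm (HasParity.laplacian_of_odd hP hy)]
  simp only [smul_add, smul_neg]
  abel

/-- Jacobi for two even elements. For equal arguments it expresses the square of a twisted
differential through the Maurer-Cartan expression. -/
theorem evenAdjointOp_anticommutator (hP : IsOddSymmetric p P) {m n : LaplacianExtension K p}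
    (hm : HasParity 0 m.fst) (hn : HasParity 0 n.fst) :
    evenAdjointOp P m * evenAdjointOp P n + evenAdjointOp P n * evenAdjointOp P m =
      -adjointOp P (evenAdjointOp P m n).fst := by
  refine LinearMap.ext fun v =>
    LaplacianExtension.ext ?_ (by simp [adjointOp_apply, evenAdjointOp_apply])
  have h1 := poisson_jacobi_even_even hP hm hn v.fst
  have h2 : poisson P (laplacian P m.fst) n.fst = poisson P n.fst (laplacian P m.fst) :=
    poisson_symm_even hP hn (hm.laplacian hP)
  simp only [fst_add, fst_neg, LinearMap.add_apply, LinearMap.neg_apply, Module.End.mul_apply,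
    adjointOp_apply, evenAdjointOp_apply, zero_smul, add_zero, poisson_add_right,
    poisson_smul_right, poisson_add_left, poisson_smul_left, laplacian_add, laplacian_smul,
    laplacian_laplacian hP, smul_zero]
  rw [← sub_eq_zero] at h1 ⊢
  rw [← h1, laplacian_poisson_even hP hm, laplacian_poisson_even hP hm,
    laplacian_poisson_even hP hn, h2]
  simp only [smul_neg, smul_sub]
  abel


end Gauge

/-! ### Gauge action and Maurer-Cartan equation as operator identities -/

section GaugeAction

open FormalFunctions PowerSeries

variable {K I : Type*} [Field K] {p : I → ZMod 2}

theorem IsOfParity.add {a : ZMod 2} {x y : ComBV K p} (hx : IsOfParity a x)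
    (hy : IsOfParity a y) : IsOfParity a (x + y) := fun n => (hx n).add (hy n)

theorem IsOfParity.neg {a : ZMod 2} {x : ComBV K p} (hx : IsOfParity a x) :
    IsOfParity a (-x) := fun n => (hx n).neg

theorem mem_filtration_zero (x : ComBV K p) : x ∈ filtration K p 0 := fun n hn => by omega

theorem filtration_antitone {m n : ℕ} (h : m ≤ n) : filtration K p n ≤ filtration K p m :=
  fun _ hx k hk => hx k (by omega)

theorem addLaplacian_injective : Function.Injective (addLaplacian (K := K) (p := p)) :=
  fun _ _ h => funext fun n => congrArg LaplacianExtension.fst (congrFun h n)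

theorem withoutLaplacian_eq_zero {x : ComBV K p} : withoutLaplacian x = 0 ↔ x = 0 :=
  ⟨fun h => funext fun n => congrArg LaplacianExtension.fst (congrFun h n), fun h => by rw [h]; rfl⟩

variable [Fintype I] {P : Matrix I I K}

theorem bracket_zero_right (x : ComBV K p) : bracket P x 0 = 0 := by
  funext n
  simp only [bracket, Pi.zero_apply, poisson_zero_right, Finset.sum_const_zero]

theorem IsOfParity.bracket (hP : IsOddSymmetric p P) {a b : ZMod 2} {x y : ComBV K p}
    (hx : IsOfParity a x) (hy : IsOfParity b y) : IsOfParity (a + b + 1) (bracket P x y) :=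
  fun _ => HasParity.sum fun _ _ => (hx _).poisson hP (hy _)

theorem IsOfParity.differential (hP : IsOddSymmetric p P) {a : ZMod 2} {x : ComBV K p}
    (hx : IsOfParity a x) : IsOfParity (a + 1) (differential P x)
  | 0 => HasParity.zero _
  | n + 1 => (hx n).laplacian hP

theorem bracket_mem_filtration {x y : ComBV K p} {m n : ℕ} (hx : x ∈ filtration K p m)
    (hy : y ∈ filtration K p n) : bracket P x y ∈ filtration K p (m + n) := by
  intro k hk
  refine Finset.sum_eq_zero fun i hi => ?_
  rw [Finset.HasAntidiagonal.mem_antidiagonal] at hi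
  by_cases h : i.1 < m
  · rw [hx _ h, poisson_zero_left]
  · rw [hy _ (by omega), poisson_zero_right]

theorem differential_mem_filtration {x : ComBV K p} {m : ℕ} (hx : x ∈ filtration K p m) :
    differential P x ∈ filtration K p (m + 1)
  | 0, _ => rfl
  | n + 1, hn => by
    change laplacian P (x n) = 0
    rw [hx n (by omega), laplacian_zero]

theorem bracket_iterate_mem_filtration {y z : ComBV K p} (hy : y ∈ filtration K p 1)
    (hz : z ∈ filtration K p 1) (i : ℕ) :
    (bracket P y)^[i] z ∈ filtration K p (i + 1) := by
  induction i with
  | zero => exact hz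
  | succ i ih =>
    rw [Function.iterate_succ_apply', add_comm]
    exact bracket_mem_filtration hy ih

theorem seriesAct_withoutLaplacian (y x : ComBV K p) :
    seriesAct (adjointSeries P y) (withoutLaplacian x) = withoutLaplacian (bracket P y x) := by
  funext n
  simp only [seriesAct, coeff_adjointSeries, adjointOp_apply, withoutLaplacian, zero_smul,
    add_zero]
  refine LaplacianExtension.ext ?_ ?_
  · rw [LaplacianExtension.fst_sum]
    rfl
  · rw [LaplacianExtension.snd_sum]
    exact Finset.sum_const_zero

/-- In x + ħΔ the Laplacian sits in degree one, so convolution with it shifts the index; the value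
zero in degree zero matches d = ħΔ. -/
theorem sum_antidiagonal_ite {M : Type*} [AddCommMonoid M] [Module K M] (f : ℕ → M) (n : ℕ) :
    ∑ x ∈ Finset.HasAntidiagonal.antidiagonal n, (if x.2 = 1 then (1 : K) else 0) • f x.1 =
      if n = 0 then 0 else f (n - 1) := by
  rcases n with _ | n
  · simp
  · rw [Finset.sum_eq_single (n, 1)]
    · simp
    · rintro ⟨a, b⟩ hx hne
      simp only [Finset.HasAntidiagonal.mem_antidiagonal, ne_eq, Prod.mk.injEq, not_and] at hx hne
      rw [if_neg (by omega), zero_smul]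
    · simp

theorem differential_apply (y : ComBV K p) (n : ℕ) :
    differential P y n = if n = 0 then 0 else laplacian P (y (n - 1)) := by
  rcases n with _ | n
  · rfl
  · rfl

/-- The inhomogeneous term d y of the gauge action is the bracket of y with ħΔ. -/
theorem seriesAct_addLaplacian (y x : ComBV K p) :
    seriesAct (adjointSeries P y) (addLaplacian x) =
      withoutLaplacian (differential P y + bracket P y x) := by
  funext n
  simp only [seriesAct, coeff_adjointSeries, adjointOp_apply, addLaplacian]
  refine LaplacianExtension.ext ?_ ?_
  · simp only [LaplacianExtension.fst_sum]
    rw [Finset.sum_add_distrib, sum_antidiagonal_ite (fun n => laplacian P (y n)), add_comm,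
      ← differential_apply]
    rfl
  · rw [LaplacianExtension.snd_sum]
    exact Finset.sum_const_zero

theorem coeff_zero_adjointSeries {y : ComBV K p} (hy : y ∈ filtration K p 1) :
    coeff 0 (adjointSeries P y) = 0 := by
  rw [coeff_adjointSeries, hy 0 one_pos, ← adjointHom_apply, map_zero]

theorem seriesAct_iterate_withoutLaplacian (y x : ComBV K p) (k : ℕ) :
    (seriesAct (adjointSeries P y))^[k] (withoutLaplacian x) =
      withoutLaplacian ((bracket P y)^[k] x) := by
  induction k with
  | zero => rfl
  | succ k ih =>
    rw [Function.iterate_succ_apply', ih, seriesAct_withoutLaplacian, Function.iterate_succ_apply']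

/-- The denominators (i+1)! in the gauge action are those of the exponential once the first
application of ad y, which turns x + ħΔ into d y + {y, x}, has been split off. -/
theorem seriesAct_gauge {y : ComBV K p} (hy : y ∈ filtration K p 1) (x : ComBV K p) :
    seriesAct (expSeries K (adjointSeries P y)) (addLaplacian x) =
      addLaplacian (gaugeAct P y x) := by
  funext n
  rw [seriesAct_expSeries (coeff_zero_adjointSeries hy), Finset.sum_range_succ']
  simp only [Function.iterate_succ_apply, seriesAct_addLaplacian,
    seriesAct_iterate_withoutLaplacian, Function.iterate_zero, id_eq, Nat.factorial_zero,
    Nat.cast_one, inv_one, one_smul]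
  -- The gauge formula also sums the term i = n, which corresponds to the power n+1 and is absent
  -- from the truncated exponential. It lies in F_{n+1}, so it has no coefficient at ħ^n.
  have h0 : (bracket P y)^[n] (differential P y + bracket P y x) n = 0 :=
    bracket_iterate_mem_filtration hy (Submodule.add_mem _
      (filtration_antitone (by omega) (differential_mem_filtration hy))
      (by simpa using bracket_mem_filtration (n := 0) hy (mem_filtration_zero x))) n n (by omega)
  refine LaplacianExtension.ext ?_ ?_
  · rw [LaplacianExtension.fst_add, LaplacianExtension.fst_sum]
    change _ + x n = x n + ∑ i ∈ Finset.range (n + 1), _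
    rw [Finset.sum_range_succ, h0, smul_zero, add_zero, add_comm]
    rfl
  · rw [LaplacianExtension.snd_add, LaplacianExtension.snd_sum]
    simp [withoutLaplacian, addLaplacian]

theorem gaugeAct_eq_self {y x : ComBV K p} (h : differential P y + bracket P y x = 0) :
    gaugeAct P y x = x := by
  have h' (i : ℕ) : (bracket P y)^[i] (0 : ComBV K p) = 0 := by
    induction i with
    | zero => rfl
    | succ i ih => rw [Function.iterate_succ_apply', ih, bracket_zero_right]
  funext n
  simp [gaugeAct, h, h']

theorem IsOfParity.gaugeAct (hP : IsOddSymmetric p P) {y x : ComBV K p} (hy : IsOfParity 1 y)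
    (hx : IsOfParity 0 x) : IsOfParity 0 (gaugeAct P y x) := by
  intro n
  refine (hx n).add (HasParity.sum fun i _ => HasParity.smul _ ?_)
  have h (i : ℕ) : IsOfParity 0
      ((BVQuant.bracket P y)^[i] (BVQuant.differential P y + BVQuant.bracket P y x)) := by
    induction i with
    | zero => exact (hy.differential hP).add (hy.bracket hP hx)
    | succ i ih =>
      rw [Function.iterate_succ_apply']
      exact hy.bracket hP ih
  exact h i n

theorem bracket_symm_even (hP : IsOddSymmetric p P) {a : ZMod 2} {x y : ComBV K p}
    (hx : IsOfParity 0 x) (hy : IsOfParity a y) : bracket P y x = bracket P x y := by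
  funext n
  rw [bracket, ← Finset.Nat.sum_antidiagonal_swap]
  exact Finset.sum_congr rfl fun i _ => poisson_symm_even hP (hx _) (hy _)

/-- The series of operators given by the series `m` of even elements. -/
noncomputable def evenAdjointSeries (P : Matrix I I K) (m : ℕ → LaplacianExtension K p) :
    PowerSeries (Module.End K (LaplacianExtension K p)) :=
  PowerSeries.mk fun n => evenAdjointOp P (m n)

theorem coeff_evenAdjointSeries (m : ℕ → LaplacianExtension K p) (n : ℕ) :
    coeff n (evenAdjointSeries P m) = evenAdjointOp P (m n) := coeff_mk _ _

theorem seriesAct_adjointSeries_even (hP : IsOddSymmetric p P) {y : ComBV K p}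
    (hy : IsOfParity 1 y) {m : ℕ → LaplacianExtension K p} (hm : ∀ n, HasParity 0 (m n).fst)
    (n : ℕ) : HasParity 0 (seriesAct (adjointSeries P y) m n).fst := by
  rw [seriesAct, LaplacianExtension.fst_sum]
  refine HasParity.sum fun x _ => ?_
  rw [coeff_adjointSeries, adjointOp_apply]
  exact (HasParity.poisson_odd_even hP (hy _) (hm _)).add
    ((HasParity.laplacian_of_odd hP (hy _)).smul _)

/-- At the first order where the parameters differ, only the linear term of the exponential notices,
and it meets the constant term of x + ħΔ, which is x 0. This identifies the effect of one gauge
coefficient with δ up to sign. -/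
theorem gaugeAct_sub {y y' : ComBV K p} (hy : y ∈ filtration K p 1)
    (hy' : y' ∈ filtration K p 1) (x : ComBV K p) {n : ℕ} (h : ∀ k < n, y k = y' k) :
    gaugeAct P y x n - gaugeAct P y' x n = poisson P (y n - y' n) (x 0) := by
  have h1 := congrArg LaplacianExtension.fst (congrFun (seriesAct_gauge (P := P) hy x) n)
  have h2 := congrArg LaplacianExtension.fst (congrFun (seriesAct_gauge (P := P) hy' x) n)
  change _ = gaugeAct P y x n at h1
  change _ = gaugeAct P y' x n at h2
  have h3 : ∀ k ≤ n, coeff k (expSeries K (adjointSeries P y)) -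
      coeff k (expSeries K (adjointSeries P y')) = adjointOp P (y k - y' k) := by
    intro k hk
    rw [coeff_expSeries_sub (n := n) (coeff_zero_adjointSeries hy) (coeff_zero_adjointSeries hy')
      _ k hk, coeff_adjointSeries, coeff_adjointSeries, ← adjointHom_apply, ← adjointHom_apply,
      ← map_sub, adjointHom_apply]
    intro k hk
    rw [coeff_adjointSeries, coeff_adjointSeries, h k hk]
  rw [← h1, ← h2, ← LaplacianExtension.fst_sub, seriesAct, seriesAct, ← Finset.sum_sub_distrib,
    Finset.sum_eq_single (n, 0)]
  · rw [← LinearMap.sub_apply, h3 n le_rfl]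
    simp [adjointOp_apply, addLaplacian]
  · rintro ⟨a, b⟩ hx hne
    simp only [Finset.HasAntidiagonal.mem_antidiagonal, ne_eq, Prod.mk.injEq, not_and] at hx hne
    rw [← LinearMap.sub_apply, h3 a (by omega), h a (by omega), sub_self, ← adjointHom_apply,
      map_zero, LinearMap.zero_apply]
  · simp

theorem seriesAct_evenAdjointSeries_withoutLaplacian (x w : ComBV K p) :
    seriesAct (evenAdjointSeries P (addLaplacian x)) (withoutLaplacian w) =
      withoutLaplacian (differential P w + bracket P x w) := by
  funext n
  simp only [seriesAct, coeff_evenAdjointSeries, evenAdjointOp_apply, addLaplacian,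
    withoutLaplacian, zero_smul, add_zero]
  refine LaplacianExtension.ext ?_ ?_
  · rw [LaplacianExtension.fst_sum]
    simp only
    rw [Finset.sum_add_distrib, ← Finset.Nat.sum_antidiagonal_swap (f := fun y : ℕ × ℕ =>
      (if y.1 = 1 then (1 : K) else 0) • laplacian P (w y.2))]
    simp only [Prod.fst_swap, Prod.snd_swap]
    rw [sum_antidiagonal_ite (fun n => laplacian P (w n)), add_comm, ← differential_apply]
    rfl
  · rw [LaplacianExtension.snd_sum]
    exact Finset.sum_const_zero

variable [CharZero K]

/-- The composition of two gauge transformations is a gauge transformation. -/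
theorem exists_gaugeAct_comp (hP : IsOddSymmetric p P) {u y : ComBV K p} (hu : IsOfParity 1 u)
    (hy : IsOfParity 1 y) (hy1 : y ∈ filtration K p 1) {n : ℕ} (hn : n ≠ 0)
    (hun : u ∈ filtration K p n) :
    ∃ c : ComBV K p, IsOfParity 1 c ∧ c ∈ filtration K p 1 ∧ (∀ k ≤ n, c k = u k + y k) ∧
      ∀ x, gaugeAct P c x = gaugeAct P u (gaugeAct P y x) := by
  have hu1 : u ∈ filtration K p 1 := filtration_antitone (by omega) hun
  obtain ⟨C, h1, h2, h3⟩ := exists_expSeries_mul (oddAdjoint_commutator hP)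
    (U := adjointSeries P u) (Y := adjointSeries P y)
    (fun k => Submodule.mem_map.2 ⟨u k, hu k, (coeff_adjointSeries u k).symm⟩)
    (fun k => Submodule.mem_map.2 ⟨y k, hy k, (coeff_adjointSeries y k).symm⟩)
    (coeff_zero_adjointSeries hy1) hn
    (fun k hk => by rw [coeff_adjointSeries, hun k hk, ← adjointHom_apply, map_zero])
  choose d hd hdC using h1
  -- A coefficient of C determines an odd element only modulo the kernel of the adjoint action,
  -- which need not vanish. Up to n the preimage u k + y k is chosen, so that equality holds exactly
  -- and not just for the operators.
  set c : ComBV K p := fun k => if k ≤ n then u k + y k else d k with hc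
  have hcC : adjointSeries P c = C := by
    refine PowerSeries.ext fun k => ?_
    rw [coeff_adjointSeries]
    by_cases hk : k ≤ n
    · rw [h2 k hk, hc, coeff_adjointSeries, coeff_adjointSeries]
      simp only [hk, if_true]
      rw [← adjointHom_apply, map_add]
      rfl
    · rw [← hdC k, hc]
      simp only [hk, if_false]
      rfl
  have hc1 : c ∈ filtration K p 1 := by
    intro k hk
    have : k ≤ n := by omega
    simp only [hc, this, if_true]
    rw [hu1 k hk, hy1 k hk, add_zero]
  refine ⟨c, ?_, hc1, ?_, ?_⟩
  · intro k
    by_cases hk : k ≤ n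
    · simp only [hc, hk, if_true]
      exact (hu k).add (hy k)
    · simp only [hc, hk, if_false]
      exact hd k
  · intro k hk
    simp only [hc, hk, if_true]
  · intro x
    apply addLaplacian_injective
    rw [← seriesAct_gauge hc1, hcC, h3, seriesAct_mul, seriesAct_gauge hy1, seriesAct_gauge hu1]

theorem gaugeAct_neg_gaugeAct {y : ComBV K p} (hy : y ∈ filtration K p 1) (x : ComBV K p) :
    gaugeAct P (-y) (gaugeAct P y x) = x := by
  have hneg : adjointSeries P (-y) = -adjointSeries P y := by
    refine PowerSeries.ext fun k => ?_
    rw [map_neg, coeff_adjointSeries, coeff_adjointSeries, ← adjointHom_apply, Pi.neg_apply,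
      map_neg]
    rfl
  apply addLaplacian_injective
  rw [← seriesAct_gauge (Submodule.neg_mem _ hy), ← seriesAct_gauge hy, ← seriesAct_mul, hneg,
    expSeries_neg_mul (coeff_zero_adjointSeries hy), seriesAct_one]

/-! ### The Maurer-Cartan equation -/

theorem commutator_evenAdjointSeries (hP : IsOddSymmetric p P) {y : ComBV K p}
    (hy : IsOfParity 1 y) {m : ℕ → LaplacianExtension K p} (hm : ∀ n, HasParity 0 (m n).fst) :
    commutator (adjointSeries P y) (evenAdjointSeries P m) =
      evenAdjointSeries P (seriesAct (adjointSeries P y) m) := by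
  refine PowerSeries.ext fun n => ?_
  have h : coeff n (evenAdjointSeries P m * adjointSeries P y) =
      ∑ x ∈ Finset.HasAntidiagonal.antidiagonal n,
        coeff x.2 (evenAdjointSeries P m) * coeff x.1 (adjointSeries P y) := by
    rw [coeff_mul, ← Finset.Nat.sum_antidiagonal_swap]
    rfl
  rw [commutator, map_sub, h, coeff_mul, ← Finset.sum_sub_distrib, coeff_evenAdjointSeries,
    ← evenAdjointHom_apply, seriesAct, map_sum]
  refine Finset.sum_congr rfl fun x _ => ?_
  rw [coeff_adjointSeries, coeff_evenAdjointSeries, adjointOp_evenAdjointOp hP (hy _) (hm _)]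
  rfl

/-- The exponentiated Jacobi identity: exp(ad y) is an automorphism, hence carries bracketing with m
to bracketing with its image. Invariance of the Maurer-Cartan equation follows. -/
theorem expSeries_mul_evenAdjointSeries (hP : IsOddSymmetric p P) {y : ComBV K p}
    (hy : IsOfParity 1 y) (hy1 : y ∈ filtration K p 1) {m : ℕ → LaplacianExtension K p}
    (hm : ∀ n, HasParity 0 (m n).fst) :
    expSeries K (adjointSeries P y) * evenAdjointSeries P m =
      evenAdjointSeries P (seriesAct (expSeries K (adjointSeries P y)) m) *
        expSeries K (adjointSeries P y) := by
  have h (k : ℕ) : (∀ n, HasParity 0 ((seriesAct (adjointSeries P y))^[k] m n).fst) ∧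
      (commutator (adjointSeries P y))^[k] (evenAdjointSeries P m) =
        evenAdjointSeries P ((seriesAct (adjointSeries P y))^[k] m) := by
    induction k with
    | zero => exact ⟨hm, rfl⟩
    | succ k ih =>
      rw [Function.iterate_succ_apply', Function.iterate_succ_apply', ih.2]
      exact ⟨seriesAct_adjointSeries_even hP hy ih.1, commutator_evenAdjointSeries hP hy ih.1⟩
  rw [expSeries_mul_eq (coeff_zero_adjointSeries hy1)]
  congr 1
  refine PowerSeries.ext fun n => ?_
  rw [coeff_sumSeries, coeff_evenAdjointSeries, seriesAct_expSeries (coeff_zero_adjointSeries hy1),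
    ← evenAdjointHom_apply, map_sum]
  refine Finset.sum_congr rfl fun k _ => ?_
  rw [coeff_smul_field, (h k).2, coeff_evenAdjointSeries, map_smul, evenAdjointHom_apply]

/-- The bracket of x + ħΔ with itself contains d x twice, once for each order, and has no ΔΔ term;
the Maurer-Cartan equation thus becomes homogeneous quadratic. -/
theorem seriesAct_evenAdjointSeries_self (x : ComBV K p) :
    seriesAct (evenAdjointSeries P (addLaplacian x)) (addLaplacian x) =
      withoutLaplacian ((2 : K) • (differential P x + (2 : K)⁻¹ • bracket P x x)) := by
  have h2 : (2 : K) ≠ 0 := two_ne_zero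
  rw [smul_add, smul_smul, mul_inv_cancel₀ h2, one_smul]
  funext n
  simp only [seriesAct, coeff_evenAdjointSeries, evenAdjointOp_apply, addLaplacian,
    withoutLaplacian]
  refine LaplacianExtension.ext ?_ ?_
  · rw [LaplacianExtension.fst_sum]
    simp only
    rw [Finset.sum_add_distrib, Finset.sum_add_distrib,
      ← Finset.Nat.sum_antidiagonal_swap (f := fun y : ℕ × ℕ =>
      (if y.1 = 1 then (1 : K) else 0) • laplacian P (x y.2))]
    simp only [Prod.fst_swap, Prod.snd_swap]
    rw [sum_antidiagonal_ite (fun n => laplacian P (x n)), ← differential_apply, Pi.add_apply,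
      Pi.smul_apply, two_smul]
    change bracket P x x n + _ + _ = _
    abel
  · rw [LaplacianExtension.snd_sum]
    exact Finset.sum_const_zero

theorem isMaurerCartan_iff (x : ComBV K p) : IsMaurerCartan P x ↔
    seriesAct (evenAdjointSeries P (addLaplacian x)) (addLaplacian x) = 0 := by
  rw [seriesAct_evenAdjointSeries_self, withoutLaplacian_eq_zero,
    smul_eq_zero_iff_right two_ne_zero]
  rfl

/-- The gauge action preserves the Maurer-Cartan equation. -/
theorem IsMaurerCartan.gaugeAct (hP : IsOddSymmetric p P) {x y : ComBV K p}
    (hx : IsMaurerCartan P x) (hx0 : IsOfParity 0 x) (hy : IsOfParity 1 y)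
    (hy1 : y ∈ filtration K p 1) : IsMaurerCartan P (gaugeAct P y x) := by
  rw [isMaurerCartan_iff] at hx ⊢
  rw [← seriesAct_gauge hy1, ← seriesAct_mul,
    ← expSeries_mul_evenAdjointSeries hP hy hy1 (m := addLaplacian x) hx0, seriesAct_mul, hx,
    seriesAct_zero_right]

/-- The twisted differential `d + {x, -}` squares to zero. -/
theorem IsMaurerCartan.twisted_twisted (hP : IsOddSymmetric p P) {x : ComBV K p}
    (hx : IsMaurerCartan P x) (hx0 : IsOfParity 0 x) (w : ComBV K p) :
    differential P (differential P w + bracket P x w) +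
      bracket P x (differential P w + bracket P x w) = 0 := by
  rw [isMaurerCartan_iff] at hx
  set m := addLaplacian x with hm_def
  have hm : ∀ n, HasParity 0 (m n).fst := hx0
  -- Doubling the square pairs the index (i, j) with (j, i). The resulting anticommutators add up to
  -- minus the adjoint operator of the Maurer-Cartan expression, which is zero.
  have hsq : evenAdjointSeries P m * evenAdjointSeries P m = 0 := by
    refine PowerSeries.ext fun n => ?_
    have h2 : (2 : K) • coeff n (evenAdjointSeries P m * evenAdjointSeries P m) = 0 := by
      rw [two_smul]
      nth_rewrite 2 [coeff_mul]
      rw [← Finset.Nat.sum_antidiagonal_swap, coeff_mul, ← Finset.sum_add_distrib]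
      simp only [Prod.fst_swap, Prod.snd_swap, coeff_evenAdjointSeries,
        evenAdjointOp_anticommutator hP (hm _) (hm _)]
      have h := congrArg LaplacianExtension.fst (congrFun hx n)
      rw [seriesAct, LaplacianExtension.fst_sum] at h
      simp only [coeff_evenAdjointSeries] at h
      rw [Finset.sum_neg_distrib]
      simp only [← adjointHom_apply]
      rw [← map_sum, h]
      simp
    rw [smul_eq_zero_iff_right two_ne_zero] at h2
    rw [h2, map_zero]
  have h := seriesAct_mul (evenAdjointSeries P m) (evenAdjointSeries P m) (withoutLaplacian w)
  rw [hsq, hm_def, seriesAct_evenAdjointSeries_withoutLaplacian,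
    seriesAct_evenAdjointSeries_withoutLaplacian] at h
  rw [← withoutLaplacian_eq_zero, ← h]
  funext n
  simp [seriesAct]

/-- The gauge transformations by `d w + {x, w}` stabilise the Maurer-Cartan element `x`. -/
theorem IsMaurerCartan.gaugeAct_twisted (hP : IsOddSymmetric p P) {x w : ComBV K p}
    (hx : IsMaurerCartan P x) (hx0 : IsOfParity 0 x) (hw : IsOfParity 0 w) :
    BVQuant.gaugeAct P (differential P w + bracket P x w) x = x := by
  apply gaugeAct_eq_self
  rw [bracket_symm_even hP hx0 ((hw.differential hP).add (hx0.bracket hP hw))]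
  exact hx.twisted_twisted hP hx0 w

end GaugeAction

/-! ## The Casimir operator of a transpose-closed family of derivations -/

section RawPairing

/-- Linear functionals over ℚ separate the points of K. As the action has a rational matrix, this
transfers positivity arguments from ℚ to an arbitrary field of characteristic zero. -/
theorem eq_zero_of_forall_comp {K I : Type*} [Field K] [CharZero K] {f : List I → K}
    (h : ∀ φ : K →ₗ[ℚ] ℚ, φ ∘ f = 0) : f = 0 :=
  funext fun w => (Module.forall_dual_apply_eq_zero_iff ℚ (f w)).1 fun φ => congrFun (h φ) w

variable {K I : Type*} [Field K] [Fintype I]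

/-- `rawLinAct` as a linear map. -/
def rawLinHom (c : Matrix I I K) : (List I → K) →ₗ[K] (List I → K) where
  toFun f w := rawLinAct c w f
  map_add' f g := funext fun w => rawLinAct_add c w f g
  map_smul' t f := funext fun w => rawLinAct_smul c w t f

theorem rawLinHom_apply (c : Matrix I I K) (f : List I → K) (w : List I) :
    rawLinHom c f w = rawLinAct c w f := rfl

theorem rawDeriv_rawLinHom (c : Matrix I I K) (f : List I → K) (i : I) :
    rawDeriv i (rawLinHom c f) = (∑ j, c j i • rawDeriv j f) + rawLinHom c (rawDeriv i f) := by
  funext w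
  simp [rawDeriv, rawLinHom_apply, rawLinAct]

/-- The standard pairing on the coefficients of the words of length `n`. -/
def rawPairing : ℕ → (List I → K) → (List I → K) → K
  | 0, f, g => f [] * g []
  | n + 1, f, g => ∑ i, rawPairing n (rawDeriv i f) (rawDeriv i g)

theorem rawPairing_comm (n : ℕ) (f g : List I → K) : rawPairing n f g = rawPairing n g f := by
  induction n generalizing f g with
  | zero => exact mul_comm _ _
  | succ n ih => exact Finset.sum_congr rfl fun i _ => ih _ _

theorem rawPairing_add_left (n : ℕ) (f f' g : List I → K) :
    rawPairing n (f + f') g = rawPairing n f g + rawPairing n f' g := by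
  induction n generalizing f f' g with
  | zero => exact add_mul _ _ _
  | succ n ih =>
    rw [rawPairing, rawPairing, rawPairing, ← Finset.sum_add_distrib]
    exact Finset.sum_congr rfl fun i _ => ih _ _ _

theorem rawPairing_smul_left (n : ℕ) (t : K) (f g : List I → K) :
    rawPairing n (t • f) g = t * rawPairing n f g := by
  induction n generalizing f g with
  | zero => exact mul_assoc _ _ _
  | succ n ih =>
    rw [rawPairing, rawPairing, Finset.mul_sum]
    exact Finset.sum_congr rfl fun i _ => ih _ _

/-- `rawPairing` as a linear map in its first argument. -/
def rawPairingHom (n : ℕ) (g : List I → K) : (List I → K) →ₗ[K] K where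
  toFun f := rawPairing n f g
  map_add' f f' := rawPairing_add_left n f f' g
  map_smul' t f := rawPairing_smul_left n t f g

theorem rawPairingHom_apply (n : ℕ) (f g : List I → K) :
    rawPairingHom n g f = rawPairing n f g := rfl

/-- The derivation acts letter by letter, and on a single letter the adjoint of a matrix for the
standard pairing is its transpose. -/
theorem rawPairing_rawLinHom (c : Matrix I I K) (n : ℕ) (f g : List I → K) :
    rawPairing n (rawLinHom c f) g = rawPairing n f (rawLinHom c.transpose g) := by
  induction n generalizing f g with
  | zero => simp [rawPairing, rawLinHom_apply, rawLinAct]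
  | succ n ih =>
    have h (i : I) (u : List I → K) (v : List I → K) (d : I → K) :
        rawPairing n ((∑ j, d j • rawDeriv j u) + v) (rawDeriv i g) =
          (∑ j, d j * rawPairing n (rawDeriv j u) (rawDeriv i g)) +
            rawPairing n v (rawDeriv i g) := by
      simp only [← rawPairingHom_apply, map_add, map_sum, map_smul, smul_eq_mul]
    have h' (i : I) (u : List I → K) (v : List I → K) (d : I → K) :
        rawPairing n (rawDeriv i f) ((∑ j, d j • rawDeriv j u) + v) =
          (∑ j, d j * rawPairing n (rawDeriv i f) (rawDeriv j u)) +
            rawPairing n (rawDeriv i f) v := by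
      rw [rawPairing_comm]
      simp only [rawPairing_comm n (rawDeriv i f)]
      simp only [← rawPairingHom_apply, map_add, map_sum, map_smul, smul_eq_mul]
    simp only [rawPairing, rawDeriv_rawLinHom, h, h', ih, Finset.sum_add_distrib,
      Matrix.transpose_apply]
    rw [Finset.sum_comm]

theorem rawPairing_self_nonneg (n : ℕ) (f : List I → ℚ) : 0 ≤ rawPairing n f f := by
  induction n generalizing f with
  | zero => exact mul_self_nonneg _
  | succ n ih => exact Finset.sum_nonneg fun i _ => ih _

theorem eq_zero_of_rawPairing_self {f : List I → ℚ} (h : ∀ n, rawPairing n f f = 0) : f = 0 := by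
  funext w
  suffices h' : ∀ (w : List I) (f : List I → ℚ), rawPairing w.length f f = 0 → f w = 0 from
    h' w f (h _)
  clear h
  intro w
  induction w with
  | nil => exact fun f h => mul_self_eq_zero.1 h
  | cons i w ih =>
    intro f h
    rw [List.length_cons, rawPairing,
      Finset.sum_eq_zero_iff_of_nonneg fun i _ => rawPairing_self_nonneg _ _] at h
    exact ih (rawDeriv i f) (h i (Finset.mem_univ i))

variable {T : Type*} [Fintype T] {c : T → Matrix I I ℚ} {σ : T → T}

/-- The Casimir operator of the family `c`. -/
def rawCasimir (c : T → Matrix I I K) (σ : T → T) : (List I → K) →ₗ[K] (List I → K) :=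
  ∑ t, rawLinHom (c t) ∘ₗ rawLinHom (c (σ t))

theorem rawCasimir_apply (c : T → Matrix I I K) (σ : T → T) (f : List I → K) :
    rawCasimir c σ f = ∑ t, rawLinHom (c t) (rawLinHom (c (σ t)) f) := by
  simp [rawCasimir]

theorem rawPairing_rawCasimir (hσ : ∀ t, (c t).transpose = c (σ t)) (n : ℕ) (f g : List I → ℚ) :
    rawPairing n (rawCasimir c σ f) g =
      ∑ t, rawPairing n (rawLinHom (c (σ t)) f) (rawLinHom (c (σ t)) g) := by
  rw [rawCasimir_apply, ← rawPairingHom_apply, map_sum]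
  exact Finset.sum_congr rfl fun t _ => by rw [rawPairingHom_apply, rawPairing_rawLinHom, hσ]

/-- Pairing the Casimir image of f with f gives a sum of squared norms over ℚ, so every summand
vanishes. -/
theorem rawLinHom_eq_zero_of_rawCasimir (hσ : ∀ t, (c t).transpose = c (σ t)) {f : List I → ℚ}
    (h : rawCasimir c σ f = 0) (t : T) : rawLinHom (c (σ t)) f = 0 := by
  refine eq_zero_of_rawPairing_self fun n => ?_
  have h1 := rawPairing_rawCasimir hσ n f f
  rw [h, ← rawPairingHom_apply, map_zero, eq_comm,
    Finset.sum_eq_zero_iff_of_nonneg fun _ _ => rawPairing_self_nonneg _ _] at h1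
  exact h1 t (Finset.mem_univ t)

/-- The squared norm of the Casimir image g of f is a sum of pairings of c (σ t) f with c (σ t) g.
The second entries vanish because g is killed by the Casimir operator. -/
theorem rawCasimir_eq_zero_of_sq (hσ : ∀ t, (c t).transpose = c (σ t)) {f : List I → ℚ}
    (h : rawCasimir c σ (rawCasimir c σ f) = 0) : rawCasimir c σ f = 0 := by
  refine eq_zero_of_rawPairing_self fun n => ?_
  rw [rawPairing_rawCasimir hσ]
  simp only [rawLinHom_eq_zero_of_rawCasimir hσ h]
  refine Finset.sum_eq_zero fun t _ => ?_
  rw [rawPairing_comm, ← rawPairingHom_apply, map_zero]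

variable [CharZero K]

theorem map_rawLinAct (φ : K →ₗ[ℚ] ℚ) (c : Matrix I I ℚ) (w : List I) (f : List I → K) :
    φ (rawLinAct (c.map fun q => (q : K)) w f) = rawLinAct c w (φ ∘ f) := by
  induction w generalizing f with
  | nil => exact map_zero φ
  | cons i w ih =>
    rw [rawLinAct, rawLinAct, map_add, map_sum, ih]
    congr 1
    refine Finset.sum_congr rfl fun j _ => ?_
    rw [Matrix.map_apply, ← Rat.smul_def, map_smul, smul_eq_mul, Function.comp_apply]

theorem comp_rawLinHom (φ : K →ₗ[ℚ] ℚ) (c : Matrix I I ℚ) (f : List I → K) :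
    φ ∘ rawLinHom (c.map fun q => (q : K)) f = rawLinHom c (φ ∘ f) :=
  funext fun w => map_rawLinAct φ c w f

theorem comp_rawCasimir (φ : K →ₗ[ℚ] ℚ) (f : List I → K) :
    φ ∘ rawCasimir (fun t => (c t).map fun q => (q : K)) σ f = rawCasimir c σ (φ ∘ f) := by
  rw [rawCasimir_apply, rawCasimir_apply]
  simp only [← comp_rawLinHom]
  funext w
  simp

theorem rawLinHom_map_eq_zero_of_rawCasimir (hσ : ∀ t, (c t).transpose = c (σ t))
    {f : List I → K} (h : rawCasimir (fun t => (c t).map fun q => (q : K)) σ f = 0) (t : T) :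
    rawLinHom ((c (σ t)).map fun q => (q : K)) f = 0 := by
  refine eq_zero_of_forall_comp fun φ => ?_
  rw [comp_rawLinHom]
  refine rawLinHom_eq_zero_of_rawCasimir hσ ?_ t
  rw [← comp_rawCasimir, h]
  exact funext fun _ => map_zero φ

theorem rawCasimir_map_eq_zero_of_sq (hσ : ∀ t, (c t).transpose = c (σ t)) {f : List I → K}
    (h : rawCasimir (fun t => (c t).map fun q => (q : K)) σ
      (rawCasimir (fun t => (c t).map fun q => (q : K)) σ f) = 0) :
    rawCasimir (fun t => (c t).map fun q => (q : K)) σ f = 0 := by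
  refine eq_zero_of_forall_comp fun φ => ?_
  rw [comp_rawCasimir]
  refine rawCasimir_eq_zero_of_sq hσ ?_
  rw [← comp_rawCasimir, ← comp_rawCasimir, h]
  exact funext fun _ => map_zero φ

end RawPairing

/-! ## The decomposition into invariants and the image of the Casimir operator -/

section FiniteDimensional

/-- The hypothesis makes kernel and range disjoint, and rank-nullity then makes them complementary.
-/
theorem exists_eq_ker_add {K V : Type*} [Field K] [AddCommGroup V] [Module K V]
    [FiniteDimensional K V] (D : V →ₗ[K] V) (h : ∀ v, D (D v) = 0 → D v = 0) (u : V) :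
    ∃ y g, D y = 0 ∧ u = y + D g := by
  have hdisj : LinearMap.ker D ⊓ LinearMap.range D = ⊥ := by
    rw [eq_bot_iff]
    rintro _ ⟨h1, v, rfl⟩
    exact h v h1
  have htop : LinearMap.ker D ⊔ LinearMap.range D = ⊤ := by
    refine Submodule.eq_top_of_finrank_eq ?_
    have h1 := Submodule.finrank_sup_add_finrank_inf_eq (LinearMap.ker D) (LinearMap.range D)
    rw [hdisj, finrank_bot, add_zero] at h1
    rw [h1, add_comm]
    exact D.finrank_range_add_finrank_ker
  obtain ⟨y, hy, _, ⟨g, rfl⟩, hyz⟩ := Submodule.mem_sup.1 (htop ▸ Submodule.mem_top (x := u))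
  exact ⟨y, g, hy, hyz.symm⟩

open FormalFunctions

variable {K I : Type*} [Field K] [Finite I] {p : I → ZMod 2}

/-- The formal functions that are homogeneous of degree `n` and of parity `a`. -/
def homogeneousPart (K : Type*) [Field K] (p : I → ZMod 2) (n : ℕ) (a : ZMod 2) :
    Submodule K (FormalFunctions K p) where
  carrier := {f | HasParity a f ∧ ∀ w, w.length ≠ n → (f : List I → K) w = 0}
  zero_mem' := ⟨HasParity.zero a, fun _ _ => rfl⟩
  add_mem' hf hg := ⟨hf.1.add hg.1, fun w hw => by
    rw [Submodule.coe_add, Pi.add_apply, hf.2 w hw, hg.2 w hw, add_zero]⟩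
  smul_mem' c f hf := ⟨hf.1.smul c, fun w hw => by
    rw [Submodule.coe_smul, Pi.smul_apply, hf.2 w hw, smul_zero]⟩

instance (n : ℕ) (a : ZMod 2) : FiniteDimensional K (homogeneousPart K p n a) := by
  let ev : homogeneousPart K p n a →ₗ[K] ((Fin n → I) → K) :=
    { toFun := fun f v => (f.1 : List I → K) (List.ofFn v)
      map_add' := fun _ _ => rfl
      map_smul' := fun _ _ => rfl }
  refine Module.Finite.of_injective ev fun f g h => Subtype.ext (ext_coeff fun w => ?_)
  by_cases hw : w.length = n
  · subst hw
    have := congrFun h w.get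
    simpa [ev] using this
  · rw [f.2.2 w hw, g.2.2 w hw]

/-- An operator that preserves the homogeneous parts, commutes with formal sums, and satisfies
`ker C² = ker C` splits the formal functions into its kernel and image. -/
theorem exists_sub_mem_ker (C : FormalFunctions K p →ₗ[K] FormalFunctions K p)
    (hC : ∀ n a f, f ∈ homogeneousPart K p n a → C f ∈ homogeneousPart K p n a)
    (hsum : ∀ g, C (formalSum g) = formalSum fun n => C (g n))
    (hsq : ∀ f, C (C f) = 0 → C f = 0) {a : ZMod 2} {f : FormalFunctions K p}
    (hf : HasParity a f) : ∃ g, HasParity a g ∧ C (f - C g) = 0 := by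
  have key (n : ℕ) : ∀ u ∈ homogeneousPart K p n a,
      ∃ g ∈ homogeneousPart K p n a, C (u - C g) = 0 := by
    intro u hu
    let D : Module.End K (homogeneousPart K p n a) := C.restrict (hC n a)
    obtain ⟨y, g, hy, hyz⟩ := exists_eq_ker_add (V := homogeneousPart K p n a) D
      (fun v hv => Subtype.ext (hsq v.1 (congrArg Subtype.val hv))) ⟨u, hu⟩
    refine ⟨g.1, g.2, ?_⟩
    have h2 : u - C g.1 = y.1 := by
      rw [sub_eq_iff_eq_add]
      exact congrArg Subtype.val hyz
    rw [h2]
    exact congrArg Subtype.val hy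
  -- Only the homogeneous parts are finite-dimensional, so the splitting is performed in each degree
  -- and the results are reassembled.
  let part (n : ℕ) : FormalFunctions K p := formalSum fun k => if k = n then f else 0
  have hpart (n : ℕ) (w : List I) : (part n : List I → K) w =
      if w.length = n then (f : List I → K) w else 0 := by
    change ((if w.length = n then f else 0 : FormalFunctions K p) : List I → K) w = _
    split_ifs <;> rfl
  have hmem (n : ℕ) : part n ∈ homogeneousPart K p n a :=
    ⟨fun w hw => by rw [hpart, hf w hw, ite_self], fun w hw => by rw [hpart, if_neg hw]⟩
  choose g hg hgC using fun n => key n (part n) (hmem n)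
  refine ⟨formalSum g, fun w hw => (hg _).1 w hw, ?_⟩
  have h1 : f - C (formalSum g) = formalSum fun n => part n - C (g n) := by
    rw [hsum]
    refine ext_coeff fun w => ?_
    change _ - _ = (part w.length : List I → K) w - _
    rw [hpart, if_pos rfl]
    rfl
  rw [h1, hsum]
  simp only [hgC]
  rfl

end FiniteDimensional

/-! ## The action of `gl_N` -/

section LinAct

open FormalFunctions

variable {K I : Type*} [Field K] {p : I → ZMod 2}

theorem coord_apply [DecidableEq I] (j : I) (w : List I) :
    (coord j : FormalFunctions K p).1 w = if w = [j] then 1 else 0 := by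
  simp [coord]

theorem one_apply [DecidableEq I] (w : List I) :
    (one : FormalFunctions K p).1 w = if w = [] then 1 else 0 := by
  simp [one]

theorem deriv_one (i : I) : deriv i (one : FormalFunctions K p) = 0 := by
  refine ext_coeff fun w => ?_
  simp [deriv_apply, one]

theorem deriv_coord [DecidableEq I] (i j : I) :
    deriv i (coord j : FormalFunctions K p) = if i = j then one else 0 := by
  refine ext_coeff fun w => ?_
  rw [deriv_apply, coord_apply]
  by_cases hij : i = j
  · subst hij
    rw [if_pos rfl, one_apply]
    simp
  · rw [if_neg hij, if_neg (by simp [hij])]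
    rfl

theorem coord_hasParity (j : I) : HasParity (p j) (coord j : FormalFunctions K p) := by
  intro w hw
  classical
  rw [coord_apply, if_neg]
  rintro rfl
  exact hw (wordParity_singleton j)

theorem twist_one (q : ZMod 2) : twist q (one : FormalFunctions K p) = one := by
  refine ext_coeff fun w => ?_
  classical
  rw [twist_apply, one_apply]
  split_ifs with h
  · rw [h, mul_one]
    exact sgn_zero_right q
  · rw [mul_zero]

theorem mul_zero_left (g : FormalFunctions K p) : mul 0 g = 0 := by
  have := mul_smul_left (0 : K) 0 g
  rwa [zero_smul, zero_smul] at this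

theorem mul_zero_right (g : FormalFunctions K p) : mul g 0 = 0 := by
  have := mul_smul_right (0 : K) g 0
  rwa [zero_smul, zero_smul] at this

theorem one_mul_eq (g : FormalFunctions K p) : mul one g = g := by
  refine ext_coeff fun w => ?_
  induction w generalizing g with
  | nil => exact one_mul _
  | cons i w ih =>
    rw [← deriv_apply, deriv_leibniz, twist_one, deriv_one, mul_zero_left, zero_add, ih,
      deriv_apply]

theorem mul_one_eq (g : FormalFunctions K p) : mul g one = g := by
  refine ext_coeff fun w => ?_
  induction w generalizing g with
  | nil => exact mul_one _
  | cons i w ih =>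
    rw [← deriv_apply, deriv_leibniz, deriv_one, mul_zero_right, add_zero, ih, deriv_apply]

theorem deriv_coord_mul [DecidableEq I] (i j : I) (g : FormalFunctions K p) :
    deriv i (mul (coord j) g) =
      (if i = j then g else 0) + sgn K (p i) (p j) • mul (coord j) (deriv i g) := by
  rw [deriv_leibniz, deriv_coord, (coord_hasParity j).twist_eq, mul_smul_left]
  split_ifs
  · rw [one_mul_eq]
  · rw [mul_zero_left]

variable [Fintype I]

/-- Replacing letters by means of an even matrix preserves the length and the parity of a word,
whence the action preserves the homogeneous parts. -/
theorem rawLinAct_congr {c : Matrix I I K} (hc : ∀ j i, p j ≠ p i → c j i = 0) (w : List I)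
    {f g : List I → K}
    (h : ∀ v : List I, v.length = w.length → wordParity p v = wordParity p w → f v = g v) :
    rawLinAct c w f = rawLinAct c w g := by
  induction w generalizing f g with
  | nil => rfl
  | cons i w ih =>
    rw [rawLinAct, rawLinAct, ih (f := rawDeriv i f) (g := rawDeriv i g)]
    · congr 1
      refine Finset.sum_congr rfl fun j _ => ?_
      by_cases hj : p j = p i
      · rw [h (j :: w) (by simp) (by rw [wordParity_cons, wordParity_cons, hj])]
      · rw [hc j i hj, zero_mul, zero_mul]
    · intro v h1 h2
      exact h (i :: v) (by simp [h1]) (by rw [wordParity_cons, wordParity_cons, h2])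

theorem deriv_linAct (c : Matrix I I K) (hc : ∀ j i, p j ≠ p i → c j i = 0)
    (f : FormalFunctions K p) (i : I) :
    deriv i (linAct c hc f) = (∑ j, c j i • deriv j f) + linAct c hc (deriv i f) := by
  refine ext_coeff fun w => ?_
  rw [Submodule.coe_add, Pi.add_apply, coe_sum_apply]
  rfl

/-- The linear vector field form of the derivation, for comparison with the bracket by a quadratic
Hamiltonian. -/
theorem linAct_eq_sum (c : Matrix I I K) (hc : ∀ j i, p j ≠ p i → c j i = 0)
    (f : FormalFunctions K p) :
    linAct c hc f = ∑ j, ∑ l, c j l • mul (coord l) (deriv j f) := by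
  classical
  refine ext_coeff fun w => ?_
  induction w generalizing f with
  | nil =>
    simp only [coe_sum_apply]
    refine (Finset.sum_eq_zero fun j _ => Finset.sum_eq_zero fun l _ => ?_).symm
    rw [Submodule.coe_smul, Pi.smul_apply, mul_nil, coord_apply, if_neg (by simp), zero_mul,
      smul_zero]
  | cons i w ih =>
    rw [← deriv_apply, ← deriv_apply, deriv_linAct, Submodule.coe_add, Pi.add_apply, ih,
      ← Pi.add_apply, ← Submodule.coe_add]
    refine congrArg (fun h : FormalFunctions K p => (h : List I → K) w) ?_
    simp only [deriv_map_sum, deriv_map_smul, deriv_coord_mul, smul_add, Finset.sum_add_distrib]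
    congr 1
    · refine Finset.sum_congr rfl fun j _ => ?_
      rw [Finset.sum_eq_single i]
      · rw [if_pos rfl]
      · intro l _ hl
        rw [if_neg (Ne.symm hl), smul_zero]
      · simp
    · refine Finset.sum_congr rfl fun j _ => Finset.sum_congr rfl fun l _ => ?_
      by_cases hj : p j = p l
      · rw [deriv_deriv i j, mul_smul_right, smul_smul (sgn K (p i) (p l)), hj, sgn_mul_self,
          one_smul]
      · rw [hc j l hj, zero_smul, zero_smul]

end LinAct

/-! ### The action of `gl_N` and its Casimir operator -/

section GlAct

open FormalFunctions

variable {K ι : Type*} [Field K] [DecidableEq ι] {π : ι → ZMod 2} {N : ℕ}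

theorem adMatrix_add (M M' : Matrix (Fin N) (Fin N) K) :
    adMatrix ι (M + M') = adMatrix ι M + adMatrix ι M' := by
  ext J L
  simp only [adMatrix, Matrix.of_apply, Matrix.add_apply, Matrix.add_mul, Matrix.mul_add,
    Matrix.sub_apply]
  split_ifs
  · ring
  · rw [add_zero]

theorem adMatrix_smul (t : K) (M : Matrix (Fin N) (Fin N) K) :
    adMatrix ι (t • M) = t • adMatrix ι M := by
  ext J L
  simp only [adMatrix, Matrix.of_apply, Matrix.smul_apply, Matrix.smul_mul, Matrix.mul_smul,
    Matrix.sub_apply, smul_eq_mul]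
  split_ifs
  · ring
  · rw [mul_zero]

theorem adMatrix_single_apply (r s : Fin N) (J L : MatIndex ι N) :
    adMatrix ι (Matrix.single r s (1 : K)) J L = if J.1 = L.1 then
      (if s = L.2.1 ∧ J.2.1 = r ∧ J.2.2 = L.2.2 then 1 else 0) -
        (if L.2.2 = r ∧ J.2.1 = L.2.1 ∧ J.2.2 = s then 1 else 0) else 0 := by
  obtain ⟨j, a, b⟩ := J
  obtain ⟨l, c, d⟩ := L
  simp only [adMatrix, Matrix.of_apply, Matrix.sub_apply]
  congr 2
  · by_cases h : s = c
    · subst h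
      rw [Matrix.single_mul_single_same]
      simp [Matrix.single_apply, eq_comm]
    · rw [Matrix.single_mul_single_of_ne _ _ _ _ h]
      simp [h]
  · by_cases h : d = r
    · subst h
      rw [Matrix.single_mul_single_same]
      simp [Matrix.single_apply, eq_comm]
    · rw [Matrix.single_mul_single_of_ne _ _ _ _ h]
      simp [h]

/-- The matrix of the adjoint action of a matrix unit. -/
def unitAdMatrix (ι : Type*) [DecidableEq ι] (N : ℕ) (K : Type*) [Field K] (t : Fin N × Fin N) :
    Matrix (MatIndex ι N) (MatIndex ι N) K := -adMatrix ι (Matrix.single t.1 t.2 (1 : K))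

/-- In the basis of matrix units ad E_rs and ad E_sr are transposes. The Casimir operator of the
trace form is therefore a sum of operators of the form TᵗT, the source of positivity. -/
theorem unitAdMatrix_transpose (t : Fin N × Fin N) :
    (unitAdMatrix ι N K t).transpose = unitAdMatrix ι N K t.swap := by
  ext J L
  simp only [unitAdMatrix, Matrix.transpose_apply, Matrix.neg_apply, adMatrix_single_apply,
    Prod.fst_swap, Prod.snd_swap]
  grind

theorem unitAdMatrix_map [CharZero K] (t : Fin N × Fin N) :
    (unitAdMatrix ι N ℚ t).map (fun q => (q : K)) = unitAdMatrix ι N K t := by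
  ext J L
  simp only [unitAdMatrix, Matrix.map_apply, Matrix.neg_apply, adMatrix_single_apply]
  split_ifs <;> simp

variable [Fintype ι]

/-- The action of `gl_N` on formal functions, as a linear map in both arguments. -/
def glHom (π : ι → ZMod 2) (N : ℕ) : Matrix (Fin N) (Fin N) K →ₗ[K]
    FormalFunctions K (shiftParity π N) →ₗ[K] FormalFunctions K (shiftParity π N) :=
  LinearMap.mk₂ K (fun M f => glAct π M f)
    (fun M M' f => by
      simp only [glAct, linAct_eq_sum, adMatrix_add, Matrix.neg_apply, Matrix.add_apply, neg_add,
        add_smul, Finset.sum_add_distrib])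
    (fun t M f => by
      simp only [glAct, linAct_eq_sum, adMatrix_smul, Matrix.neg_apply, Matrix.smul_apply,
        smul_eq_mul, ← mul_neg, mul_smul, Finset.smul_sum])
    (fun M f g => ext_coeff fun w => rawLinAct_add _ w f.1 g.1)
    (fun t M f => ext_coeff fun w => rawLinAct_smul _ w t f.1)

theorem glHom_apply (M : Matrix (Fin N) (Fin N) K) (f : FormalFunctions K (shiftParity π N)) :
    glHom π N M f = glAct π M f := rfl

theorem coe_glHom (M : Matrix (Fin N) (Fin N) K) (f : FormalFunctions K (shiftParity π N)) :
    (glHom π N M f : List (MatIndex ι N) → K) = rawLinHom (-adMatrix ι M) f := rfl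

theorem FormalFunctions.HasParity.glHom {a : ZMod 2} {f : FormalFunctions K (shiftParity π N)}
    (hf : HasParity a f) (M : Matrix (Fin N) (Fin N) K) : HasParity a (glHom π N M f) := by
  intro w hw
  rw [coe_glHom, rawLinHom_apply, rawLinAct_congr (g := 0) (adMatrix_even π M)]
  · rw [← rawLinHom_apply, map_zero, Pi.zero_apply]
  · intro v _ hv
    exact hf v (hv ▸ hw)

theorem glHom_mem_homogeneousPart {n : ℕ} {a : ZMod 2} {f : FormalFunctions K (shiftParity π N)}
    (hf : f ∈ homogeneousPart K (shiftParity π N) n a) (M : Matrix (Fin N) (Fin N) K) :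
    glHom π N M f ∈ homogeneousPart K (shiftParity π N) n a := by
  refine ⟨hf.1.glHom M, fun w hw => ?_⟩
  rw [coe_glHom, rawLinHom_apply, rawLinAct_congr (g := 0) (adMatrix_even π M)]
  · rw [← rawLinHom_apply, map_zero, Pi.zero_apply]
  · intro v hv _
    exact hf.2 v (hv ▸ hw)

theorem glHom_formalSum (M : Matrix (Fin N) (Fin N) K)
    (g : ℕ → FormalFunctions K (shiftParity π N)) :
    glHom π N M (formalSum g) = formalSum fun n => glHom π N M (g n) := by
  refine ext_coeff fun w => ?_
  exact rawLinAct_congr (adMatrix_even π M) w fun v hv _ => by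
    change (g v.length).1 v = _
    rw [hv]

/-- The Casimir operator of `gl_N`. -/
def glCasimir (K : Type*) [Field K] (π : ι → ZMod 2) (N : ℕ) :
    FormalFunctions K (shiftParity π N) →ₗ[K] FormalFunctions K (shiftParity π N) :=
  ∑ t : Fin N × Fin N, glHom π N (Matrix.single t.1 t.2 (1 : K)) ∘ₗ
    glHom π N (Matrix.single t.2 t.1 (1 : K))

theorem glCasimir_apply (f : FormalFunctions K (shiftParity π N)) :
    glCasimir K π N f = ∑ t : Fin N × Fin N, glHom π N (Matrix.single t.1 t.2 (1 : K))
      (glHom π N (Matrix.single t.2 t.1 (1 : K)) f) := by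
  simp [glCasimir]

theorem coe_glCasimir [CharZero K] (f : FormalFunctions K (shiftParity π N)) :
    (glCasimir K π N f : List (MatIndex ι N) → K) =
      rawCasimir (fun t => (unitAdMatrix ι N ℚ t).map fun q => (q : K)) Prod.swap f := by
  rw [glCasimir_apply, rawCasimir_apply]
  simp only [unitAdMatrix_map]
  funext w
  rw [coe_sum_apply, Finset.sum_apply]
  rfl

/-- The `gl_N`-invariant formal functions. -/
def IsInvariant (π : ι → ZMod 2) (N : ℕ) (f : FormalFunctions K (shiftParity π N)) : Prop :=
  ∀ M, glHom π N M f = 0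

theorem isInvariant_iff {f : FormalFunctions K (shiftParity π N)} :
    IsInvariant π N f ↔ ∀ r s, glHom π N (Matrix.single r s (1 : K)) f = 0 := by
  refine ⟨fun h r s => h _, fun h M => ?_⟩
  rw [Matrix.matrix_eq_sum_single M, map_sum, LinearMap.sum_apply]
  refine Finset.sum_eq_zero fun r _ => ?_
  rw [map_sum, LinearMap.sum_apply]
  refine Finset.sum_eq_zero fun s _ => ?_
  have : Matrix.single r s (M r s) = M r s • Matrix.single r s (1 : K) := by simp
  rw [this, map_smul, LinearMap.smul_apply, h, smul_zero]

theorem IsInvariant.glCasimir_eq_zero {f : FormalFunctions K (shiftParity π N)}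
    (h : IsInvariant π N f) : glCasimir K π N f = 0 := by
  rw [glCasimir_apply]
  exact Finset.sum_eq_zero fun t _ => by rw [h, map_zero]

variable [CharZero K]

theorem isInvariant_of_glCasimir {f : FormalFunctions K (shiftParity π N)}
    (h : glCasimir K π N f = 0) : IsInvariant π N f := by
  refine isInvariant_iff.2 fun r s => Subtype.ext ?_
  -- The positivity lemma kills the operator with the swapped index, so the index (s, r) yields
  -- E_rs.
  have h' := rawLinHom_map_eq_zero_of_rawCasimir (σ := Prod.swap)
    (unitAdMatrix_transpose (ι := ι) (N := N) (K := ℚ)) ((coe_glCasimir f).symm.trans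
      (congrArg Subtype.val h)) (s, r)
  rw [unitAdMatrix_map] at h'
  exact h'

theorem glCasimir_eq_zero_of_sq {f : FormalFunctions K (shiftParity π N)}
    (h : glCasimir K π N (glCasimir K π N f) = 0) : glCasimir K π N f = 0 := by
  refine Subtype.ext ((coe_glCasimir f).trans (rawCasimir_map_eq_zero_of_sq (σ := Prod.swap)
    (unitAdMatrix_transpose (ι := ι) (N := N) (K := ℚ)) ?_))
  rw [← coe_glCasimir, ← coe_glCasimir, h]
  rfl

theorem exists_isInvariant_sub_glCasimir {a : ZMod 2} {f : FormalFunctions K (shiftParity π N)}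
    (hf : HasParity a f) :
    ∃ g, HasParity a g ∧ IsInvariant π N (f - glCasimir K π N g) := by
  obtain ⟨g, hg, h⟩ := exists_sub_mem_ker (glCasimir K π N) (fun n a f hf => by
    rw [glCasimir_apply]
    exact Submodule.sum_mem _ fun t _ => glHom_mem_homogeneousPart
      (glHom_mem_homogeneousPart hf _) _) (fun g => by
    rw [glCasimir_apply]
    simp only [glHom_formalSum, glCasimir_apply]
    refine ext_coeff fun w => ?_
    rw [coe_sum_apply]
    change _ = (∑ t : Fin N × Fin N, glHom π N (Matrix.single t.1 t.2 (1 : K))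
      (glHom π N (Matrix.single t.2 t.1 (1 : K)) (g w.length))).1 w
    rw [coe_sum_apply]
    rfl) (fun f => glCasimir_eq_zero_of_sq) hf
  exact ⟨g, hg, isInvariant_of_glCasimir h⟩

end GlAct

/-! ## The Cartan calculus -/

section Cartan

open FormalFunctions

variable {K ι : Type*} [Field K] [Fintype ι] [DecidableEq ι] {π : ι → ZMod 2} {N : ℕ}
  {P : Matrix (MatIndex ι N) (MatIndex ι N) K} {x₀ : FormalFunctions K (shiftParity π N)}
  {C : Fin N → Fin N → FormalFunctions K (shiftParity π N) →ₗ[K]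
    FormalFunctions K (shiftParity π N)}

/-- The even element `x₀` has the contractions `C r s`, anticommuting with the bracket by `x₀` up
to Hamiltonians `C r s x₀` of the action of `gl_N`. -/
structure IsCartan (P : Matrix (MatIndex ι N) (MatIndex ι N) K)
    (x₀ : FormalFunctions K (shiftParity π N))
    (C : Fin N → Fin N → FormalFunctions K (shiftParity π N) →ₗ[K]
      FormalFunctions K (shiftParity π N)) : Prop where
  symm : IsOddSymmetric (shiftParity π N) P
  even : HasParity 0 x₀
  parity : ∀ r s a f, HasParity a f → HasParity (a + 1) (C r s f)
  contract_poisson : ∀ r s f, C r s (poisson P x₀ f) =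
    -poisson P (C r s x₀) f - poisson P x₀ (C r s f)
  poisson_contract : ∀ r s f, poisson P (C r s x₀) f = -glHom π N (Matrix.single r s 1) f
  poisson_laplacian : ∀ r s f, poisson P (laplacian P (C r s x₀)) f = 0

namespace IsCartan

theorem odd (h : IsCartan P x₀ C) (r s : Fin N) : HasParity 1 (C r s x₀) :=
  h.parity r s 0 x₀ h.even

theorem glHom_eq (h : IsCartan P x₀ C) (r s : Fin N) (f : FormalFunctions K (shiftParity π N)) :
    glHom π N (Matrix.single r s 1) f = -poisson P (C r s x₀) f := by
  rw [h.poisson_contract, neg_neg]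

theorem glHom_poisson (h : IsCartan P x₀ C) (r s : Fin N) {a : ZMod 2}
    {f : FormalFunctions K (shiftParity π N)} (hf : HasParity a f)
    (g : FormalFunctions K (shiftParity π N)) :
    glHom π N (Matrix.single r s 1) (poisson P f g) =
      poisson P (glHom π N (Matrix.single r s 1) f) g +
        poisson P f (glHom π N (Matrix.single r s 1) g) := by
  simp only [h.glHom_eq]
  rw [poisson_jacobi h.symm (h.odd r s) hf, zmod_two_one_add_one, sgn_zero_right, sgn_zero_left,
    one_smul, one_smul, poisson_neg_left, poisson_neg_right]
  abel

/-- Cartan's formula. The contraction anticommutes with {x₀, -} up to the bracket with its value on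
x₀, and that bracket is the action up to sign. -/
theorem glHom_eq_contract (h : IsCartan P x₀ C) (r s : Fin N)
    (f : FormalFunctions K (shiftParity π N)) :
    glHom π N (Matrix.single r s 1) f =
      C r s (poisson P x₀ f) + poisson P x₀ (C r s f) := by
  rw [h.glHom_eq, h.contract_poisson]
  abel

theorem poisson_invariant (h : IsCartan P x₀ C) {a : ZMod 2}
    {f g : FormalFunctions K (shiftParity π N)} (hf : HasParity a f) (hfi : IsInvariant π N f)
    (hgi : IsInvariant π N g) : IsInvariant π N (poisson P f g) := by
  refine isInvariant_iff.2 fun r s => ?_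
  rw [h.glHom_poisson r s hf, hfi, hgi, poisson_zero_left, poisson_zero_right, add_zero]

variable [CharZero K]

/-- The action is bracketing with a Hamiltonian, and Δ is a derivation of the bracket; the term with
Δ of the Hamiltonian drops out because that element brackets to zero. -/
theorem glHom_laplacian (h : IsCartan P x₀ C) (r s : Fin N)
    (f : FormalFunctions K (shiftParity π N)) :
    glHom π N (Matrix.single r s 1) (laplacian P f) =
      laplacian P (glHom π N (Matrix.single r s 1) f) := by
  rw [h.glHom_eq, h.glHom_eq, laplacian_neg, laplacian_poisson_odd h.symm (h.odd r s),
    h.poisson_laplacian, neg_zero, zero_add]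

theorem laplacian_invariant (h : IsCartan P x₀ C) {f : FormalFunctions K (shiftParity π N)}
    (hf : IsInvariant π N f) : IsInvariant π N (laplacian P f) := by
  refine isInvariant_iff.2 fun r s => ?_
  rw [h.glHom_laplacian r s, hf, laplacian_zero]

/-- The element `x₀` is invariant. -/
theorem invariant (h : IsCartan P x₀ C) (h0 : poisson P x₀ x₀ = 0) : IsInvariant π N x₀ := by
  refine isInvariant_iff.2 fun r s => ?_
  -- Cartan's formula on x₀ leaves only {x₀, C x₀}, which by symmetry is {C x₀, x₀}, that is, minus
  -- the action on x₀. The action on x₀ equals its own negative.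
  have h1 := h.glHom_eq_contract r s x₀
  rw [h0, map_zero, zero_add, ← poisson_symm_even h.symm h.even (h.odd r s),
    h.poisson_contract] at h1
  exact eq_zero_of_eq_neg (K := K) h1

theorem glHom_twisted (h : IsCartan P x₀ C) (h0 : poisson P x₀ x₀ = 0) (r s : Fin N)
    (f : FormalFunctions K (shiftParity π N)) :
    glHom π N (Matrix.single r s 1) (poisson P x₀ f) =
      poisson P x₀ (glHom π N (Matrix.single r s 1) f) := by
  rw [h.glHom_poisson r s h.even, h.invariant h0, poisson_zero_left, zero_add]

theorem glCasimir_twisted (h : IsCartan P x₀ C) (h0 : poisson P x₀ x₀ = 0)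
    (f : FormalFunctions K (shiftParity π N)) :
    glCasimir K π N (poisson P x₀ f) = poisson P x₀ (glCasimir K π N f) := by
  simp only [glCasimir_apply, h.glHom_twisted h0, poisson_sum_right]

/-- The contracting homotopy of the Casimir operator. -/
def homotopy (C : Fin N → Fin N → FormalFunctions K (shiftParity π N) →ₗ[K]
    FormalFunctions K (shiftParity π N)) (f : FormalFunctions K (shiftParity π N)) :
    FormalFunctions K (shiftParity π N) :=
  ∑ t : Fin N × Fin N, C t.1 t.2 (glHom π N (Matrix.single t.2 t.1 1) f)

/-- One of the two factors in each term of the Casimir operator is expanded by Cartan's formula; the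
other commutes with {x₀, -}. -/
theorem glCasimir_eq (h : IsCartan P x₀ C) (h0 : poisson P x₀ x₀ = 0)
    (f : FormalFunctions K (shiftParity π N)) :
    glCasimir K π N f = homotopy C (poisson P x₀ f) + poisson P x₀ (homotopy C f) := by
  rw [glCasimir_apply, homotopy, homotopy, poisson_sum_right, ← Finset.sum_add_distrib]
  exact Finset.sum_congr rfl fun t _ => by rw [h.glHom_eq_contract, h.glHom_twisted h0]

/-- Modulo invariants c is a Casimir image Ω g, and Ω g = h δ g + δ h g for the homotopy h. It
remains to see that the first term vanishes, after which s = h g works. -/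
theorem exists_sub_twisted_invariant (h : IsCartan P x₀ C) (h0 : poisson P x₀ x₀ = 0)
    {a : ZMod 2} {c : FormalFunctions K (shiftParity π N)} (hc : HasParity a c)
    (hδ : IsInvariant π N (poisson P x₀ c)) :
    ∃ s, HasParity (a + 1) s ∧ IsInvariant π N (c - poisson P x₀ s) := by
  obtain ⟨g, hg, hi⟩ := exists_isInvariant_sub_glCasimir hc
  refine ⟨homotopy C g, HasParity.sum fun t _ => h.parity _ _ _ _ (hg.glHom _), ?_⟩
  -- Since Ω commutes with δ, Ω² δ g = Ω δ Ω g, and δ Ω g is the difference of δ c and δ of an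
  -- invariant element. Both are invariant, hence killed by Ω; from ker Ω² = ker Ω it follows that δ
  -- g is invariant.
  have h1 : glCasimir K π N (glCasimir K π N (poisson P x₀ g)) = 0 := by
    rw [h.glCasimir_twisted h0]
    have h2 : glCasimir K π N g = c - (c - glCasimir K π N g) := by abel
    rw [h2, ← poissonHom_apply, map_sub, poissonHom_apply, poissonHom_apply, map_sub,
      hδ.glCasimir_eq_zero, (h.poisson_invariant h.even (h.invariant h0) hi).glCasimir_eq_zero,
      sub_zero]
  have h3 := isInvariant_of_glCasimir (glCasimir_eq_zero_of_sq h1)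
  have h4 := h.glCasimir_eq h0 g
  -- The homotopy first applies the action of `gl_N`, so it annihilates invariants.
  have h5 : homotopy C (poisson P x₀ g) = 0 :=
    Finset.sum_eq_zero fun t _ => by rw [h3, map_zero]
  rw [h5, zero_add] at h4
  rwa [h4] at hi

end IsCartan

end Cartan

/-! ## Invariant gauge transformations -/

section Main

open FormalFunctions

variable {K ι : Type*} [Field K] [Fintype ι] [DecidableEq ι] {π : ι → ZMod 2} {N : ℕ}
  {P : Matrix (MatIndex ι N) (MatIndex ι N) K} {x₀ : FormalFunctions K (shiftParity π N)}
  {C : Fin N → Fin N → FormalFunctions K (shiftParity π N) →ₗ[K]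
    FormalFunctions K (shiftParity π N)}

theorem IsInvariant.add {f g : FormalFunctions K (shiftParity π N)} (hf : IsInvariant π N f)
    (hg : IsInvariant π N g) : IsInvariant π N (f + g) := fun M => by
  rw [map_add, hf, hg, add_zero]

theorem IsInvariant.smul {f : FormalFunctions K (shiftParity π N)} (c : K)
    (hf : IsInvariant π N f) : IsInvariant π N (c • f) := fun M => by
  rw [map_smul, hf, smul_zero]

theorem IsInvariant.neg {f : FormalFunctions K (shiftParity π N)}
    (hf : IsInvariant π N f) : IsInvariant π N (-f) := fun M => by
  rw [map_neg, hf, neg_zero]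

theorem IsInvariant.zero : IsInvariant π N (0 : FormalFunctions K (shiftParity π N)) :=
  fun _ => map_zero _

theorem IsInvariant.sum {J : Type*} {t : Finset J} {f : J → FormalFunctions K (shiftParity π N)}
    (hf : ∀ j ∈ t, IsInvariant π N (f j)) : IsInvariant π N (∑ j ∈ t, f j) := fun M => by
  rw [map_sum]
  exact Finset.sum_eq_zero fun j hj => hf j hj M

theorem gaugeAct_congr {I : Type*} [Fintype I] {p : I → ZMod 2} {P : Matrix I I K}
    {y y' : ComBV K p} (hy : y ∈ filtration K p 1) (hy' : y' ∈ filtration K p 1) (x : ComBV K p)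
    {n : ℕ} (h : ∀ k ≤ n, y k = y' k) : gaugeAct P y x n = gaugeAct P y' x n := by
  rw [← sub_eq_zero, gaugeAct_sub hy hy' x fun k hk => h k hk.le, h n le_rfl, sub_self,
    poisson_zero_left]

theorem gaugeAct_zero_apply {I : Type*} [Fintype I] {p : I → ZMod 2} {P : Matrix I I K}
    {y : ComBV K p} (hy : y ∈ filtration K p 1) (x : ComBV K p) : gaugeAct P y x 0 = x 0 := by
  rw [gaugeAct_congr hy (Submodule.zero_mem _) x (n := 0) fun k hk => hy k (by omega),
    gaugeAct_eq_self]
  funext n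
  have h1 : bracket P (0 : ComBV K p) x = 0 := funext fun n =>
    Finset.sum_eq_zero fun _ _ => poisson_zero_left _
  rw [h1, add_zero]
  rcases n with _ | n
  · rfl
  · exact laplacian_zero

/-- The coefficient of `ħ^n` of the bracket of an even element with itself. -/
theorem bracket_self_apply {I : Type*} [Fintype I] {p : I → ZMod 2} {P : Matrix I I K}
    (hP : IsOddSymmetric p P) {x : ComBV K p} (hx : IsOfParity 0 x) (n : ℕ) :
    bracket P x x (n + 1) = (2 : K) • poisson P (x 0) (x (n + 1)) +
      ∑ i ∈ Finset.HasAntidiagonal.antidiagonal n,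
        if i.2 = 0 then 0 else poisson P (x (i.1 + 1)) (x i.2) := by
  have h : ∑ i ∈ Finset.HasAntidiagonal.antidiagonal n, poisson P (x (i.1 + 1)) (x i.2) =
      poisson P (x (n + 1)) (x 0) + ∑ i ∈ Finset.HasAntidiagonal.antidiagonal n,
        if i.2 = 0 then 0 else poisson P (x (i.1 + 1)) (x i.2) := by
    have h1 : poisson P (x (n + 1)) (x 0) = ∑ i ∈ Finset.HasAntidiagonal.antidiagonal n,
        if i.2 = 0 then poisson P (x (i.1 + 1)) (x i.2) else 0 := by
      rw [Finset.sum_eq_single (n, 0)]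
      · simp
      · rintro ⟨a, b⟩ hx hne
        simp only [Finset.HasAntidiagonal.mem_antidiagonal, ne_eq, Prod.mk.injEq, not_and]
          at hx hne
        exact if_neg (by simp only; omega)
      · simp
    rw [h1, ← Finset.sum_add_distrib]
    refine Finset.sum_congr rfl fun i _ => ?_
    split_ifs
    · rw [add_zero]
    · rw [zero_add]
  rw [bracket, Finset.Nat.antidiagonal_succ, Finset.sum_cons, Finset.sum_map]
  change poisson P (x 0) (x (n + 1)) + ∑ i ∈ Finset.HasAntidiagonal.antidiagonal n,
    poisson P (x (i.1 + 1)) (x i.2) = _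
  rw [h, poisson_symm_even hP (hx 0) (hx (n + 1)), two_smul]
  abel

theorem IsCartan.bracket_invariant (h : IsCartan P x₀ C) {a : ZMod 2}
    {x y : ComBV K (shiftParity π N)} (hx : IsOfParity a x)
    (hxi : ∀ n, IsInvariant π N (x n)) (hyi : ∀ n, IsInvariant π N (y n))
    (n : ℕ) : IsInvariant π N (bracket P x y n) :=
  IsInvariant.sum fun _ _ => h.poisson_invariant (hx _) (hxi _) (hyi _)

variable [CharZero K]

namespace IsCartan

theorem differential_invariant (h : IsCartan P x₀ C) {x : ComBV K (shiftParity π N)}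
    (hxi : ∀ n, IsInvariant π N (x n)) : ∀ n, IsInvariant π N (differential P x n)
  | 0 => IsInvariant.zero
  | n + 1 => h.laplacian_invariant (hxi n)

theorem gaugeAct_invariant (h : IsCartan P x₀ C) {x y : ComBV K (shiftParity π N)}
    (hy : IsOfParity 1 y) (hyi : ∀ n, IsInvariant π N (y n)) (hxi : ∀ n, IsInvariant π N (x n))
    (n : ℕ) : IsInvariant π N (gaugeAct P y x n) := by
  have key (i : ℕ) : ∀ n, IsInvariant π N
      ((bracket P y)^[i] (differential P y + bracket P y x) n) := by
    induction i with
    | zero =>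
      exact fun n => (h.differential_invariant hyi n).add (h.bracket_invariant hy hyi hxi n)
    | succ i ih =>
      rw [Function.iterate_succ_apply']
      exact h.bracket_invariant hy hyi ih
  exact (hxi n).add (IsInvariant.sum fun i _ => (key i n).smul _)

end IsCartan

theorem IsMaurerCartan.poisson_zero {I : Type*} [Fintype I] {p : I → ZMod 2} {P : Matrix I I K}
    {x : ComBV K p} (hx : IsMaurerCartan P x) : poisson P (x 0) (x 0) = 0 := by
  have h : (0 : FormalFunctions K p) + (2 : K)⁻¹ • bracket P x x 0 = 0 := congrFun hx 0
  rw [zero_add, smul_eq_zero_iff_right (inv_ne_zero (two_ne_zero (α := K))), bracket,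
    Finset.Nat.antidiagonal_zero, Finset.sum_singleton] at h
  exact h

namespace IsCartan

/-- At ħ^{n+1} the Maurer-Cartan equation expresses this bracket through Δ z_n and brackets of
coefficients of index at most n. -/
theorem twisted_invariant (h : IsCartan P x₀ C) {z : ComBV K (shiftParity π N)}
    (hz : IsOfParity 0 z) (hMC : IsMaurerCartan P z) (n : ℕ)
    (hinv : ∀ k ≤ n, IsInvariant π N (z k)) :
    IsInvariant π N (poisson P (z 0) (z (n + 1))) := by
  have h1 := congrFun hMC (n + 1)
  rw [Pi.add_apply, Pi.smul_apply, bracket_self_apply h.symm hz, smul_add, smul_smul,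
    inv_mul_cancel₀ two_ne_zero, one_smul, ← add_assoc, add_right_comm] at h1
  rw [eq_neg_of_add_eq_zero_right h1]
  refine ((h.laplacian_invariant (hinv n le_rfl)).add
    (IsInvariant.smul _ (IsInvariant.sum fun i hi => ?_))).neg
  rw [Finset.HasAntidiagonal.mem_antidiagonal] at hi
  split_ifs with h0
  · exact IsInvariant.zero
  · exact h.poisson_invariant (hz _) (hinv _ (by omega)) (hinv _ (by omega))

/-- Every quantization is gauge equivalent to an invariant one. -/
theorem exists_gaugeAct_invariant (h : IsCartan P x₀ C) {x : ComBV K (shiftParity π N)}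
    (hx : IsOfParity 0 x) (hMC : IsMaurerCartan P x) (hx0 : x 0 = x₀) :
    ∃ y, y ∈ filtration K (shiftParity π N) 1 ∧ IsOfParity 1 y ∧
      ∀ n, IsInvariant π N (gaugeAct P y x n) := by
  have h0 : poisson P x₀ x₀ = 0 := hx0 ▸ hMC.poisson_zero
  obtain ⟨y, hy⟩ := exists_limit_of_approximations
    (fun n (y : ComBV K (shiftParity π N)) => y ∈ filtration K (shiftParity π N) 1 ∧
      IsOfParity 1 y ∧ ∀ k < n, IsInvariant π N (gaugeAct P y x k)) 0
    ⟨Submodule.zero_mem _, fun _ => HasParity.zero _, fun k hk => absurd hk (by omega)⟩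
    (fun n y hy => by
      obtain ⟨hy1, hyo, hyi⟩ := hy
      rcases n with _ | n
      · refine ⟨y, ⟨hy1, hyo, fun k hk => ?_⟩, fun _ _ => rfl⟩
        obtain rfl : k = 0 := by omega
        rw [gaugeAct_zero_apply hy1, hx0]
        exact h.invariant h0
      · have hz := hyo.gaugeAct h.symm hx
        have hz0 : gaugeAct P y x 0 = x₀ := by rw [gaugeAct_zero_apply hy1, hx0]
        have hδ := h.twisted_invariant hz (hMC.gaugeAct h.symm hx hyo hy1) n
          fun k hk => hyi k (by omega)
        rw [hz0] at hδ
        obtain ⟨s, hs, hsi⟩ := h.exists_sub_twisted_invariant h0 (hz (n + 1)) hδ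
        -- Lowering the coefficient of y at ħ^{n+1} by s leaves the transformed element unchanged
        -- below that order and subtracts {x₀, s} from its coefficient there.
        let y' : ComBV K (shiftParity π N) := fun k => if k = n + 1 then y k - s else y k
        have hlt : ∀ k < n + 1, y' k = y k := fun k hk => if_neg (by omega)
        have hy' : y' ∈ filtration K (shiftParity π N) 1 := fun k hk => by
          rw [hlt k (by omega), hy1 k hk]
        refine ⟨y', ⟨hy', fun k => ?_, fun k hk => ?_⟩, hlt⟩
        · by_cases hk : k = n + 1
          · simp only [y', hk, if_true]
            rw [sub_eq_add_neg]
            exact (hyo _).add hs.neg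
          · simp only [y', hk, if_false]
            exact hyo k
        · rcases Nat.lt_succ_iff_lt_or_eq.1 hk with hk' | rfl
          · rw [gaugeAct_congr hy' hy1 x fun j hj => hlt j (by omega)]
            exact hyi k hk'
          · have h1 := gaugeAct_sub (P := P) hy' hy1 x hlt
            have h2 : y' (n + 1) - y (n + 1) = -s := by
              simp only [y', if_true]
              abel
            rw [h2, hx0, poisson_neg_left, poisson_symm_even h.symm h.even hs, sub_eq_iff_eq_add,
              neg_add_eq_sub] at h1
            rwa [h1])
  have hy1 : y ∈ filtration K (shiftParity π N) 1 := fun k hk => by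
    obtain ⟨t, ht, hk'⟩ := hy (k + 1)
    rw [hk' k (by omega), ht.1 k hk]
  refine ⟨y, hy1, fun k => ?_, fun k => ?_⟩
  · obtain ⟨t, ht, hk⟩ := hy (k + 1)
    rw [hk k (by omega)]
    exact ht.2.1 k
  · obtain ⟨t, ht, hk⟩ := hy (k + 1)
    rw [gaugeAct_congr hy1 ht.1 x fun j hj => hk j (by omega)]
    exact ht.2.2 k (by omega)

/-- Gauge equivalent invariant quantizations are related by an invariant gauge transformation. -/
theorem exists_invariant_gaugeAct (h : IsCartan P x₀ C) {x x' y : ComBV K (shiftParity π N)}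
    (hxi : ∀ n, IsInvariant π N (x n)) (hx0 : x 0 = x₀)
    (hx' : IsOfParity 0 x') (hMC : IsMaurerCartan P x') (hxi' : ∀ n, IsInvariant π N (x' n))
    (hx0' : x' 0 = x₀) (hy1 : y ∈ filtration K (shiftParity π N) 1) (hyo : IsOfParity 1 y)
    (hxy : x' = gaugeAct P y x) :
    ∃ z, (∀ n, IsInvariant π N (z n)) ∧ z ∈ filtration K (shiftParity π N) 1 ∧
      IsOfParity 1 z ∧ x' = gaugeAct P z x := by
  have h0 : poisson P x₀ x₀ = 0 := hx0' ▸ hMC.poisson_zero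
  obtain ⟨z, hz⟩ := exists_limit_of_approximations
    (fun n (z : ComBV K (shiftParity π N)) => z ∈ filtration K (shiftParity π N) 1 ∧
      IsOfParity 1 z ∧ x' = gaugeAct P z x ∧ ∀ k < n, IsInvariant π N (z k)) y
    ⟨hy1, hyo, hxy, fun k hk => absurd hk (by omega)⟩
    (fun n z hz => by
      obtain ⟨hz1, hzo, hzx, hzi⟩ := hz
      rcases n with _ | n
      · refine ⟨z, ⟨hz1, hzo, hzx, fun k hk => ?_⟩, fun _ _ => rfl⟩
        rw [hz1 k hk]
        exact IsInvariant.zero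
      -- The truncation of z is invariant, hence so is exp(t) · x. Comparing it with x' isolates the
      -- effect of z_{n+1}.
      · let t : ComBV K (shiftParity π N) := fun k => if k < n + 1 then z k else 0
        have hlt : ∀ k < n + 1, z k = t k := fun k hk => (if_pos hk).symm
        have ht1 : t ∈ filtration K (shiftParity π N) 1 := fun k hk => by
          rw [← hlt k (by omega), hz1 k hk]
        have hto : IsOfParity 1 t := fun k => by
          by_cases hk : k < n + 1
          · rw [← hlt k hk]
            exact hzo k
          · simp only [t, hk, if_false]
            exact HasParity.zero _
        have hti : ∀ k, IsInvariant π N (t k) := fun k => by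
          by_cases hk : k < n + 1
          · rw [← hlt k hk]
            exact hzi k hk
          · simp only [t, hk, if_false]
            exact IsInvariant.zero
        have h1 := gaugeAct_sub (P := P) hz1 ht1 x hlt
        have h2 : t (n + 1) = 0 := if_neg (by omega)
        rw [h2, sub_zero, hx0, poisson_symm_even h.symm h.even (hzo _), ← hzx] at h1
        have hδ : IsInvariant π N (poisson P x₀ (z (n + 1))) := by
          rw [← h1, sub_eq_add_neg]
          exact (hxi' _).add (h.gaugeAct_invariant hto hti hxi _).neg
        obtain ⟨w, hw, hwi⟩ := h.exists_sub_twisted_invariant h0 (hzo (n + 1)) hδ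
        -- With W = -w ħ^{n+1}, the transformation dW + {x', W} fixes x' and has leading coefficient
        -- -{x₀, w} at ħ^{n+1}, since dW starts one order higher.
        let W : ComBV K (shiftParity π N) := fun k => if k = n + 1 then -w else 0
        have hWe : IsOfParity 0 W := fun k => by
          by_cases hk : k = n + 1
          · simp only [W, hk, if_true]
            exact hw.neg
          · simp only [W, hk, if_false]
            exact HasParity.zero _
        have hWn : W ∈ filtration K (shiftParity π N) (n + 1) := fun k hk => if_neg (by omega)
        have hu : differential P W + bracket P x' W ∈ filtration K (shiftParity π N) (n + 1) :=
          Submodule.add_mem _ (filtration_antitone (by omega) (differential_mem_filtration hWn))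
            (by simpa using bracket_mem_filtration (mem_filtration_zero x') hWn)
        have huo : IsOfParity 1 (differential P W + bracket P x' W) :=
          (hWe.differential h.symm).add (hx'.bracket h.symm hWe)
        -- Composing after z keeps the endpoint x' and the coefficients below n+1, and replaces
        -- z_{n+1} by the invariant z_{n+1} - {x₀, w}.
        obtain ⟨c, hco, hc1, hck, hcx⟩ := exists_gaugeAct_comp h.symm huo hzo hz1
          (Nat.succ_ne_zero n) hu
        refine ⟨c, ⟨hc1, hco, ?_, fun k hk => ?_⟩, fun k hk => ?_⟩
        · rw [hcx, ← hzx, hMC.gaugeAct_twisted h.symm hx' hWe]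
        · rcases Nat.lt_succ_iff_lt_or_eq.1 hk with hk' | rfl
          · rw [hck k hk'.le, hu k hk', zero_add]
            exact hzi k hk'
          · rw [hck _ le_rfl, Pi.add_apply]
            have h3 : differential P W (n + 1) = 0 := by
              change laplacian P (W n) = 0
              rw [hWn n (by omega), laplacian_zero]
            have h4 : bracket P x' W (n + 1) = -poisson P x₀ w := by
              rw [bracket, Finset.sum_eq_single (0, n + 1)]
              · simp only [W, if_true]
                rw [hx0', poisson_neg_right]
              · rintro ⟨i, j⟩ hij hne
                simp only [Finset.HasAntidiagonal.mem_antidiagonal, ne_eq, Prod.mk.injEq,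
                  not_and] at hij hne
                rw [hWn j (by omega), poisson_zero_right]
              · simp
            rw [h3, h4, zero_add, neg_add_eq_sub]
            exact hwi
        · rw [hck k hk.le, hu k hk, zero_add])
  have hz1 : z ∈ filtration K (shiftParity π N) 1 := fun k hk => by
    obtain ⟨t, ht, hk'⟩ := hz (k + 1)
    rw [hk' k (by omega), ht.1 k hk]
  refine ⟨z, fun k => ?_, hz1, fun k => ?_, funext fun k => ?_⟩
  · obtain ⟨t, ht, hk⟩ := hz (k + 1)
    rw [hk k (by omega)]
    exact ht.2.2.2 k (by omega)
  · obtain ⟨t, ht, hk⟩ := hz (k + 1)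
    rw [hk k (by omega)]
    exact ht.2.1 k
  · obtain ⟨t, ht, hk⟩ := hz (k + 1)
    rw [gaugeAct_congr hz1 ht.1 x fun j hj => hk j (by omega), ← ht.2.2.1]

end IsCartan

/-! ## The moduli spaces -/

section Moduli

variable {I : Type*} [Fintype I] {p : I → ZMod 2} {Q : Matrix I I K}

/-- The quotient is by the generated equivalence relation, so injectivity needs to know that the
gauge relation on all quantizations is already an equivalence; transitivity is Campbell-Hausdorff.
-/
theorem gaugeEquiv_top_equivalence (hQ : IsOddSymmetric p Q) (z₀ : FormalFunctions K p) :
    Equivalence (GaugeEquiv Q ⊤ (x₀ := z₀)) where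
  refl x := by
    refine ⟨0, trivial, Submodule.zero_mem _, fun _ => HasParity.zero _, ?_⟩
    have h := gaugeAct_neg_gaugeAct (P := Q) (Submodule.zero_mem (filtration K p 1)) x.1
    rw [neg_zero] at h
    have h1 : gaugeAct Q (0 : ComBV K p) x.1 = x.1 := by
      apply gaugeAct_eq_self
      have h2 : bracket Q (0 : ComBV K p) x.1 = 0 := funext fun n =>
        Finset.sum_eq_zero fun _ _ => poisson_zero_left _
      rw [h2, add_zero]
      funext n
      rcases n with _ | n
      · rfl
      · exact laplacian_zero
    exact h1.symm
  symm := by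
    rintro x x' ⟨y, -, hy1, hyo, hxy⟩
    refine ⟨-y, trivial, Submodule.neg_mem _ hy1, hyo.neg, ?_⟩
    rw [hxy, gaugeAct_neg_gaugeAct hy1]
  trans := by
    rintro x x' x'' ⟨y, -, hy1, hyo, hxy⟩ ⟨u, -, hu1, huo, hxu⟩
    obtain ⟨c, hco, hc1, -, hcx⟩ := exists_gaugeAct_comp hQ huo hyo hy1 one_ne_zero hu1
    exact ⟨c, trivial, hc1, hco, by rw [hcx, ← hxy, ← hxu]⟩

end Moduli

theorem IsCartan.moduli_bijective (h : IsCartan P x₀ C) :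
    Function.Bijective (Moduli.incl P (le_top : invariants K π N ≤ ⊤) x₀) ∧
      (∀ x : Quantization P ⊤ x₀, ∃ x' : Quantization P (invariants K π N) x₀,
          GaugeEquiv P ⊤ x (x'.incl P le_top)) ∧
      (∀ x' x'' : Quantization P (invariants K π N) x₀,
        GaugeEquiv P ⊤ (x'.incl P le_top) (x''.incl P le_top) →
          GaugeEquiv P (invariants K π N) x' x'') := by
  have hsurj : ∀ x : Quantization P ⊤ x₀, ∃ x' : Quantization P (invariants K π N) x₀,
      GaugeEquiv P ⊤ x (x'.incl P le_top) := by
    rintro ⟨x, -, hx, hMC, hx0⟩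
    obtain ⟨y, hy1, hyo, hyi⟩ := h.exists_gaugeAct_invariant hx hMC hx0
    exact ⟨⟨gaugeAct P y x, hyi, hyo.gaugeAct h.symm hx, hMC.gaugeAct h.symm hx hyo hy1,
      (gaugeAct_zero_apply hy1 x).trans hx0⟩, y, trivial, hy1, hyo, rfl⟩
  have hinj : ∀ x' x'' : Quantization P (invariants K π N) x₀,
      GaugeEquiv P ⊤ (x'.incl P le_top) (x''.incl P le_top) →
        GaugeEquiv P (invariants K π N) x' x'' := by
    rintro ⟨x, hxi, _, _, hx0⟩ ⟨x', hxi', hx', hMC', hx0'⟩ ⟨y, -, hy1, hyo, hxy⟩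
    exact h.exists_invariant_gaugeAct hxi hx0 hx' hMC' hxi' hx0' hy1 hyo hxy
  refine ⟨⟨?_, ?_⟩, hsurj, hinj⟩
  · rintro ⟨x'⟩ ⟨x''⟩ hq
    refine Quot.sound (hinj x' x'' ?_)
    exact (gaugeEquiv_top_equivalence h.symm x₀).eqvGen_iff.1 (Quot.eqvGen_exact hq)
  · rintro ⟨x⟩
    obtain ⟨x', hx'⟩ := hsurj x
    exact ⟨Quot.mk _ x', (Quot.sound hx').symm⟩

end Main

/-! ## Tensors and their contractions -/

section Tensor

open FormalFunctions

variable {K I : Type*} [Field K] {p : I → ZMod 2}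

theorem word_hasParity (w : List I) :
    HasParity (wordParity p w) (word w : FormalFunctions K p) := by
  induction w with
  | nil =>
    intro v hv
    rw [word]
    classical
    rw [one_apply, if_neg]
    rintro rfl
    exact hv rfl
  | cons i w ih =>
    rw [wordParity_cons]
    exact (coord_hasParity i).mul ih

/-- `mul` as a linear map in its second argument. -/
def mulHom (f : FormalFunctions K p) : FormalFunctions K p →ₗ[K] FormalFunctions K p where
  toFun g := mul f g
  map_add' g g' := mul_add_right f g g'
  map_smul' c g := mul_smul_right c f g

theorem mulHom_apply (f g : FormalFunctions K p) : mulHom f g = mul f g := rfl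

theorem mul_sum_left {J : Type*} (s : Finset J) (f : J → FormalFunctions K p)
    (g : FormalFunctions K p) : mul (∑ j ∈ s, f j) g = ∑ j ∈ s, mul (f j) g := by
  classical
  induction s using Finset.induction_on with
  | empty => rw [Finset.sum_empty, Finset.sum_empty, mul_zero_left]
  | insert j s hj ih => rw [Finset.sum_insert hj, Finset.sum_insert hj, mul_add_left, ih]

variable [Fintype I]

/-- The image in `Ŝ V^*` of the tensor with coefficients `α`. -/
noncomputable def ofTensor (p : I → ZMod 2) (n : ℕ) (α : (Fin n → I) → K) :
    FormalFunctions K p :=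
  ∑ w : Fin n → I, α w • word (List.ofFn w)

theorem ofTensor_zero (α : (Fin 0 → I) → K) : ofTensor p 0 α = α ![] • one := by
  rw [ofTensor, Fintype.sum_subsingleton _ ![]]
  rfl

theorem ofTensor_succ (n : ℕ) (α : (Fin (n + 1) → I) → K) :
    ofTensor p (n + 1) α = ∑ j, mul (coord j) (ofTensor p n fun w => α (Fin.cons j w)) := by
  rw [ofTensor, ← (Fin.consEquiv fun _ => I).sum_comp, Fintype.sum_prod_type]
  refine Finset.sum_congr rfl fun j _ => ?_
  rw [ofTensor, ← mulHom_apply, map_sum]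
  refine Finset.sum_congr rfl fun w _ => ?_
  rw [map_smul, mulHom_apply]
  change α (Fin.cons j w) • word (List.ofFn (Fin.cons j w : Fin (n + 1) → I)) = _
  rw [List.ofFn_cons]
  rfl

theorem ofTensor_smul (n : ℕ) (c : K) (α : (Fin n → I) → K) :
    ofTensor p n (fun w => c * α w) = c • ofTensor p n α := by
  simp only [ofTensor, mul_smul, Finset.smul_sum]

theorem ofTensor_sum {T : Type*} (s : Finset T) (n : ℕ) (α : T → (Fin n → I) → K) :
    ofTensor p n (fun w => ∑ t ∈ s, α t w) = ∑ t ∈ s, ofTensor p n (α t) := by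
  simp only [ofTensor, Finset.sum_smul]
  exact Finset.sum_comm

theorem ofTensor_eq_zero {n : ℕ} {α : (Fin n → I) → K} (h : ∀ w, α w = 0) :
    ofTensor p n α = 0 :=
  Finset.sum_eq_zero fun w _ => by rw [h, zero_smul]

theorem deriv_ofTensor_succ (n : ℕ) (α : (Fin (n + 1) → I) → K) (i : I) :
    deriv i (ofTensor p (n + 1) α) = (ofTensor p n fun w => α (Fin.cons i w)) +
      ∑ j, sgn K (p i) (p j) •
        mul (coord j) (deriv i (ofTensor p n fun w => α (Fin.cons j w))) := by
  classical
  rw [ofTensor_succ, deriv_map_sum]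
  simp only [deriv_coord_mul, Finset.sum_add_distrib, Finset.sum_ite_eq, Finset.mem_univ, if_true]

theorem deriv_ofTensor_zero (α : (Fin 0 → I) → K) (i : I) : deriv i (ofTensor p 0 α) = 0 := by
  rw [ofTensor_zero, deriv_map_smul, deriv_one, smul_zero]

variable {T : Type*} [Fintype T]

/-- The contraction of a tensor with a homogeneous vector is the sum of the contractions of its
slots. -/
theorem contract_ofTensor {v : T → K} {e : T → I} {q : ZMod 2} (hv : ∀ t, v t ≠ 0 → p (e t) = q)
    (n : ℕ) (α : (Fin (n + 1) → I) → K) :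
    ∑ t, v t • deriv (e t) (ofTensor p (n + 1) α) =
      ∑ k : Fin (n + 1), ofTensor p n fun w =>
        sgn K q (wordParity p ((List.ofFn w).take k)) *
          ∑ t, v t * α (Fin.insertNth k (e t) w) := by
  -- The derivative either hits the first letter or passes it with a Koszul sign. That sign is
  -- common to all t with v t ≠ 0, as these indices have parity q.
  have hcons (n : ℕ) (α : (Fin (n + 1) → I) → K) :
      ∑ t, v t • deriv (e t) (ofTensor p (n + 1) α) =
        (ofTensor p n fun w => ∑ t, v t * α (Fin.cons (e t) w)) + ∑ j, sgn K q (p j) •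
          mul (coord j) (∑ t, v t • deriv (e t) (ofTensor p n fun w => α (Fin.cons j w))) := by
    simp only [deriv_ofTensor_succ, smul_add, Finset.sum_add_distrib, ofTensor_sum, ofTensor_smul]
    congr 1
    simp only [← mulHom_apply, map_sum, map_smul, Finset.smul_sum]
    rw [Finset.sum_comm]
    refine Finset.sum_congr rfl fun j _ => Finset.sum_congr rfl fun t _ => ?_
    by_cases ht : v t = 0
    · rw [ht, zero_smul, zero_smul, smul_zero]
    · rw [hv t ht, smul_comm]
  induction n with
  | zero =>
    rw [hcons, Fin.sum_univ_succ, Fin.sum_univ_zero]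
    simp only [deriv_ofTensor_zero, smul_zero, Finset.sum_const_zero, mul_zero_right, add_zero,
      Fin.val_zero, List.take_zero, Fin.insertNth_zero']
    simp only [wordParity, List.map_nil, List.sum_nil, sgn_zero_right, one_mul]
  | succ n ih =>
    rw [hcons, Fin.sum_univ_succ]
    congr 1
    · simp only [Fin.val_zero, List.take_zero, Fin.insertNth_zero']
      simp only [wordParity, List.map_nil, List.sum_nil, sgn_zero_right, one_mul]
    · simp only [ih, ← mulHom_apply, map_sum, Finset.smul_sum]
      rw [Finset.sum_comm]
      refine Finset.sum_congr rfl fun k _ => ?_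
      rw [ofTensor_succ]
      refine Finset.sum_congr rfl fun j _ => ?_
      rw [← map_smul, mulHom_apply, ← ofTensor_smul]
      congr 2
      funext w
      rw [Fin.val_succ, List.ofFn_cons, List.take_succ_cons, wordParity_cons, sgn_add, mul_assoc]
      congr 2
      refine Finset.sum_congr rfl fun t _ => ?_
      congr 2
      exact (Fin.insertNth_succ_cons k (e t) j w).symm

theorem ofTensor_two_apply (α : (Fin 2 → I) → K) (i j : I) :
    (ofTensor p 2 α : List I → K) [i, j] = α ![i, j] + sgn K (p i) (p j) * α ![j, i] := by
  classical
  have h1 (i : I) (α : (Fin 1 → I) → K) : deriv i (ofTensor p 1 α) = α ![i] • one := by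
    rw [deriv_ofTensor_succ]
    simp only [deriv_ofTensor_zero, mul_zero_right, smul_zero, Finset.sum_const_zero, add_zero]
    rw [ofTensor_zero]
    rfl
  rw [← deriv_apply, ← deriv_apply, deriv_ofTensor_succ, deriv_map_add, deriv_map_sum, h1]
  simp only [h1, mul_smul_right, mul_one_eq, deriv_map_smul, deriv_coord, smul_ite, smul_zero,
    Finset.sum_ite_eq, Finset.mem_univ, if_true]
  rw [smul_smul, ← add_smul, Submodule.coe_smul, Pi.smul_apply, one_apply, if_pos rfl, smul_eq_mul,
    mul_one]
  rfl

theorem ofTensor_hasParity {n : ℕ} {q : ZMod 2} {α : (Fin n → I) → K}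
    (h : ∀ w, α w ≠ 0 → ∑ j, p (w j) = q) : HasParity q (ofTensor p n α) := by
  refine HasParity.sum fun w _ => ?_
  by_cases hw : α w = 0
  · rw [hw, zero_smul]
    exact HasParity.zero _
  · have h1 : wordParity p (List.ofFn w) = q := by
      rw [← h w hw, wordParity, List.map_ofFn, List.sum_ofFn]
      rfl
    exact (h1 ▸ word_hasParity (List.ofFn w) : HasParity q (word (List.ofFn w))).smul _

end Tensor

/-! ## The inverse form on the dual of `Σ gl_N(A)` -/

section Form

variable {K A : Type*} [Field K] [AddCommGroup A] [Module K A]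
  {𝒜 : ZMod 2 → Submodule K A} {B : LinearMap.BilinForm K A}
  {ι : Type*} {b : Module.Basis ι K A} {π : ι → ZMod 2} {N : ℕ}

theorem eq_zero_of_mem_of_mem (𝒜 : ZMod 2 → Submodule K A) [DirectSum.Decomposition 𝒜] {a : A}
    {i j : ZMod 2} (hi : a ∈ 𝒜 i) (hj : a ∈ 𝒜 j) (hij : i ≠ j) : a = 0 := by
  rw [← DirectSum.decompose_of_mem_same 𝒜 hj, DirectSum.decompose_of_mem_ne 𝒜 hi hij]

theorem zmod_two_eq_add_one_of_ne {x y : ZMod 2} (h : x ≠ y) : x = y + 1 := by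
  revert x y
  decide

theorem parity_of_repr_ne_zero [DirectSum.Decomposition 𝒜] [Fintype ι]
    (hb : ∀ i, b i ∈ 𝒜 (π i)) {a : A} {q : ZMod 2}
    (ha : a ∈ 𝒜 q) {i : ι} (hi : b.repr a i ≠ 0) : π i = q := by
  by_contra hne
  have hsplit : a = (∑ j with π j = q, b.repr a j • b j) +
      ∑ j with ¬ π j = q, b.repr a j • b j := by
    rw [Finset.sum_filter_add_sum_filter_not, b.sum_repr]
  have h1 : (∑ j with π j = q, b.repr a j • b j) ∈ 𝒜 q :=
    Submodule.sum_mem _ fun j hj => Submodule.smul_mem _ _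
      ((Finset.mem_filter.1 hj).2 ▸ hb j)
  have h2 : (∑ j with ¬ π j = q, b.repr a j • b j) ∈ 𝒜 (q + 1) := by
    refine Submodule.sum_mem _ fun j hj => Submodule.smul_mem _ _ ?_
    exact zmod_two_eq_add_one_of_ne (Finset.mem_filter.1 hj).2 ▸ hb j
  have h3 : ∑ j with ¬ π j = q, b.repr a j • b j = 0 := by
    refine eq_zero_of_mem_of_mem 𝒜 ?_ h2 (i := q) (by simp)
    rw [← sub_eq_iff_eq_add'.2 hsplit]
    exact Submodule.sub_mem _ ha h1
  have h4 := Finset.sum_congr (s₁ := Finset.univ) rfl fun j _ =>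
    show (if ¬ π j = q then b.repr a j else 0) • b j =
      if ¬ π j = q then b.repr a j • b j else 0 by split_ifs <;> simp
  rw [← Finset.sum_filter, h3] at h4
  have h5 := Fintype.linearIndependent_iff.1 b.linearIndependent _ h4 i
  rw [if_pos hne] at h5
  exact hi h5

theorem IsOddInnerProduct.parity_of_ne_zero (hB : IsOddInnerProduct 𝒜 B)
    (hb : ∀ i, b i ∈ 𝒜 (π i)) {i j : ι} (h : B (b i) (b j) ≠ 0) : π j = π i + 1 := by
  have h1 : π i + π j = 1 := by
    by_contra h'
    exact h (hB.odd _ _ _ _ (hb i) (hb j) h')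
  generalize π i = x at h1
  generalize π j = y at h1
  revert x y
  decide

/-- An odd form pairs only elements of opposite parities, one of which is even, so the Koszul sign
is trivial. -/
theorem IsOddInnerProduct.basis_comm (hB : IsOddInnerProduct 𝒜 B)
    (hb : ∀ i, b i ∈ 𝒜 (π i)) (i j : ι) : B (b i) (b j) = B (b j) (b i) := by
  by_cases h : B (b j) (b i) = 0
  · rw [hB.symm _ _ _ _ (hb i) (hb j), h, mul_zero]
  · rw [hB.symm _ _ _ _ (hb i) (hb j), hB.parity_of_ne_zero hb h]
    rcases zmod_two_cases (π j) with h | h <;> rw [h]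
    · rw [sgn_zero_right, one_mul]
    · rw [zmod_two_one_add_one, sgn_zero_left, one_mul]

theorem neg_one_pow_val (q : ZMod 2) : (-1 : K) ^ q.val = sgn K q 1 := by
  rw [sgn, show (1 : ZMod 2).val = 1 from rfl, mul_one]

theorem sgn_add_one_left (q : ZMod 2) : sgn K (q + 1) 1 = -sgn K q 1 := by
  rw [sgn_comm, sgn_add, sgn_one_one, sgn_comm, mul_neg_one]

theorem matrixPairing_matBasis (J L : MatIndex ι N) :
    matrixPairing B N (matBasis b J) (matBasis b L) =
      if J.2.2 = L.2.1 ∧ L.2.2 = J.2.1 then B (b J.1) (b L.1) else 0 := by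
  obtain ⟨i, r, s⟩ := J
  obtain ⟨j, r', s'⟩ := L
  simp only [matrixPairing, matBasis, Matrix.single_apply]
  rw [Finset.sum_eq_single r, Finset.sum_eq_single s]
  · by_cases h : s = r' ∧ s' = r
    · rw [if_pos ⟨rfl, rfl⟩, if_pos ⟨h.1.symm, h.2⟩, if_pos h]
    · rw [if_neg h, if_neg (c := r' = s ∧ s' = r) fun h' => h ⟨h'.1.symm, h'.2⟩, map_zero]
  · intro y _ hy
    rw [if_neg fun h => hy h.2.symm, map_zero, LinearMap.zero_apply]
  · simp
  · intro x _ hx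
    refine Finset.sum_eq_zero fun y _ => ?_
    rw [if_neg fun h => hx h.1.symm, map_zero, LinearMap.zero_apply]
  · simp

theorem sympGram_apply (J L : MatIndex ι N) : sympGram B b π N J L =
    if J.2.2 = L.2.1 ∧ L.2.2 = J.2.1 then sgn K (π J.1) 1 * B (b J.1) (b L.1) else 0 := by
  rw [sympGram, Matrix.of_apply, matrixPairing_matBasis, neg_one_pow_val]
  split_ifs
  · rfl
  · exact mul_zero _

variable [Fintype ι] [DecidableEq ι]

/-- The inverse of the Gram matrix of `B`. -/
noncomputable def gramInverse (B : LinearMap.BilinForm K A) (b : Module.Basis ι K A) :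
    Matrix ι ι K :=
  (LinearMap.BilinForm.toMatrix b B)⁻¹

theorem toMatrix_mul_gramInverse (hB : IsOddInnerProduct 𝒜 B) :
    LinearMap.BilinForm.toMatrix b B * gramInverse B b = 1 := by
  refine Matrix.mul_nonsing_inv _ (isUnit_iff_ne_zero.2 ?_)
  rw [← Matrix.nondegenerate_iff_det_ne_zero, LinearMap.BilinForm.nondegenerate_toMatrix_iff]
  exact hB.nondegenerate

theorem gramInverse_comm (hB : IsOddInnerProduct 𝒜 B) (hb : ∀ i, b i ∈ 𝒜 (π i)) (i j : ι) :
    gramInverse B b i j = gramInverse B b j i := by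
  have h : (LinearMap.BilinForm.toMatrix b B).transpose = LinearMap.BilinForm.toMatrix b B := by
    ext i j
    rw [Matrix.transpose_apply, LinearMap.BilinForm.toMatrix_apply,
      LinearMap.BilinForm.toMatrix_apply, hB.basis_comm hb]
  have h1 : (gramInverse B b).transpose = gramInverse B b := by
    rw [gramInverse, Matrix.transpose_nonsing_inv, h]
  rw [← h1, Matrix.transpose_apply, h1]

/-- The grading operator anticommutes with the Gram matrix, hence with its inverse. An entry of the
inverse between equal parities is therefore its own negative. -/
theorem parity_of_gramInverse_ne_zero [CharZero K] (hB : IsOddInnerProduct 𝒜 B)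
    (hb : ∀ i, b i ∈ 𝒜 (π i)) {i j : ι} (h : gramInverse B b i j ≠ 0) : π j = π i + 1 := by
  set G := LinearMap.BilinForm.toMatrix b B with hG
  set D : Matrix ι ι K := Matrix.diagonal fun i => sgn K (π i) 1 with hD
  have hDD : D * D = 1 := by
    rw [hD, Matrix.diagonal_mul_diagonal]
    simp only [sgn_mul_self, Matrix.diagonal_one]
  have hDG : D * G = -(G * D) := by
    ext i j
    rw [hD, Matrix.diagonal_mul, Matrix.neg_apply, Matrix.mul_diagonal, hG,
      LinearMap.BilinForm.toMatrix_apply]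
    by_cases h0 : B (b i) (b j) = 0
    · rw [h0, mul_zero, zero_mul, neg_zero]
    · rw [hB.parity_of_ne_zero hb h0, sgn_add_one_left]
      ring
  have hinv : -(D * gramInverse B b * D) = gramInverse B b := by
    refine (Matrix.inv_eq_right_inv ?_).symm
    have h1 : G * -(D * gramInverse B b * D) = D * (G * gramInverse B b) * D := by
      rw [mul_neg, ← mul_assoc, ← mul_assoc, ← mul_assoc, hDG, neg_mul, neg_mul]
    rw [← hG, h1, toMatrix_mul_gramInverse hB, mul_one, hDD]
  have h2 := congrFun (congrFun hinv i) j
  rw [Matrix.neg_apply, hD, Matrix.mul_diagonal, Matrix.diagonal_mul] at h2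
  by_contra hne
  have hij : π j = π i := by
    generalize π i = x at hne
    generalize π j = y at hne
    revert x y
    decide
  rw [hij, mul_right_comm, sgn_mul_self, one_mul] at h2
  exact h (eq_zero_of_eq_neg (K := K) h2.symm)

/-- The inverse of the Gram matrix of `Σ gl_N(A)`. -/
theorem sympGram_mul (hB : IsOddInnerProduct 𝒜 B) : sympGram B b π N *
    (Matrix.of fun J L => if J.2.2 = L.2.1 ∧ L.2.2 = J.2.1 then
      sgn K (π L.1) 1 * gramInverse B b J.1 L.1 else 0) = 1 := by
  ext J M
  rw [Matrix.mul_apply]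
  simp only [sympGram_apply, Matrix.of_apply]
  rw [Fintype.sum_prod_type]
  have h1 (i : ι) : ∑ t : Fin N × Fin N,
      (if J.2.2 = t.1 ∧ t.2 = J.2.1 then sgn K (π J.1) 1 * B (b J.1) (b i) else 0) *
        (if t.2 = M.2.1 ∧ M.2.2 = t.1 then sgn K (π M.1) 1 * gramInverse B b i M.1 else 0) =
      (if J.2 = M.2 then sgn K (π J.1) 1 * sgn K (π M.1) 1 else 0) *
        (LinearMap.BilinForm.toMatrix b B J.1 i * gramInverse B b i M.1) := by
    rw [Finset.sum_eq_single (J.2.2, J.2.1)]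
    · rw [if_pos ⟨rfl, rfl⟩, LinearMap.BilinForm.toMatrix_apply]
      by_cases h : J.2 = M.2
      · rw [if_pos h, if_pos ⟨congrArg Prod.fst h, congrArg Prod.snd h.symm⟩]
        ring
      · rw [if_neg h, if_neg fun h' => h (Prod.ext h'.1 h'.2.symm), mul_zero, zero_mul]
    · intro t _ ht
      rw [if_neg fun h => ht (Prod.ext h.1.symm h.2), zero_mul]
    · simp
  rw [Finset.sum_congr rfl fun i _ => h1 i, ← Finset.mul_sum, ← Matrix.mul_apply,
    toMatrix_mul_gramInverse hB, Matrix.one_apply, Matrix.one_apply]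
  by_cases h : J = M
  · rw [h, if_pos rfl, if_pos rfl, if_pos rfl, sgn_mul_self, one_mul]
  · rw [if_neg h]
    by_cases h2 : J.2 = M.2
    · rw [if_neg fun h1 => h (Prod.ext h1 h2), mul_zero]
    · rw [if_neg h2, zero_mul]

theorem sympGram_mul_inv (hB : IsOddInnerProduct 𝒜 B) :
    sympGram B b π N * (sympGram B b π N)⁻¹ = 1 := by
  rw [Matrix.inv_eq_right_inv (sympGram_mul hB), sympGram_mul hB]

/-- The suspension sign in the Gram matrix and the sign in the inverse form have arguments differing
by the parity shift, so their product is -1. -/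
theorem glForm_apply (hB : IsOddInnerProduct 𝒜 B) (J L : MatIndex ι N) :
    glForm B b π N J L =
      if J.2.2 = L.2.1 ∧ L.2.2 = J.2.1 then -gramInverse B b J.1 L.1 else 0 := by
  rw [glForm, inverseForm, Matrix.of_apply,
    Matrix.inv_eq_right_inv (sympGram_mul hB), Matrix.of_apply, neg_one_pow_val,
    shiftParity, sgn_add_one_left]
  split_ifs
  · rw [mul_neg, mul_right_comm, sgn_mul_self, one_mul]
  · rw [zero_mul]

theorem glForm_isOddSymmetric [CharZero K] (hB : IsOddInnerProduct 𝒜 B)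
    (hb : ∀ i, b i ∈ 𝒜 (π i)) : IsOddSymmetric (shiftParity π N) (glForm B b π N) where
  symm J L := by
    rw [glForm_apply hB, glForm_apply hB, gramInverse_comm hB hb]
    exact if_congr ⟨fun h => ⟨h.2, h.1⟩, fun h => ⟨h.2, h.1⟩⟩ rfl rfl
  odd J L h := by
    rw [glForm_apply hB] at h
    have h1 : gramInverse B b J.1 L.1 ≠ 0 := by
      intro h0
      rw [h0, neg_zero, ite_self] at h
      exact h rfl
    rw [shiftParity, shiftParity, parity_of_gramInverse_ne_zero hB hb h1]

end Form

/-! ## The cyclic tensors -/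

section CyclicForm

variable {K A : Type*} [Field K] [AddCommGroup A] [Module K A]
  {𝒜 : ZMod 2 → Submodule K A} {B : LinearMap.BilinForm K A}
  {m : ∀ k : ℕ, MultilinearMap K (fun _ : Fin k => A) A} {e : A}

/-- `e` is a strict unit. -/
structure IsStrictUnit (m : ∀ k : ℕ, MultilinearMap K (fun _ : Fin k => A) A) (e : A) : Prop where
  left : ∀ a, m 2 ![e, a] = a
  right : ∀ a, m 2 ![a, e] = a
  zero : ∀ k, k ≠ 2 → ∀ a : Fin k → A, (∃ j, a j = e) → m k a = 0

/-- For homogeneous a, the product of the odd part of e with a equals a minus the product with the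
even part, so it has both parities and vanishes. Multiplying the odd part by e itself then shows
that it is zero. -/
theorem IsStrictUnit.even [DirectSum.Decomposition 𝒜] (he : IsStrictUnit m e)
    (hm : IsAInfinity 𝒜 m) : e ∈ 𝒜 0 := by
  let e₀ : A := (DirectSum.decompose 𝒜 e 0 : A)
  let e₁ : A := (DirectSum.decompose 𝒜 e 1 : A)
  have h0 : e₀ ∈ 𝒜 0 := SetLike.coe_mem _
  have h1 : e₁ ∈ 𝒜 1 := SetLike.coe_mem _
  have hsum : e₀ + e₁ = e := by
    classical
    have h := DirectSum.sum_support_decompose 𝒜 e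
    rw [Finset.sum_subset (Finset.subset_univ _)] at h
    · exact (Fin.sum_univ_two _).symm.trans h
    · intro i _ hi
      rw [DFinsupp.notMem_support_iff] at hi
      rw [hi]
      rfl
  have hadd (x y a : A) : m 2 ![x + y, a] = m 2 ![x, a] + m 2 ![y, a] := by
    have hu (z : A) : Function.update ![x, a] 0 z = ![z, a] := by
      funext j; fin_cases j <;> rfl
    have h := (m 2).map_update_add ![x, a] 0 x y
    rwa [hu, hu, hu] at h
  have hadd' (x y a : A) : m 2 ![a, x + y] = m 2 ![a, x] + m 2 ![a, y] := by
    have hu (z : A) : Function.update ![a, x] 1 z = ![a, z] := by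
      funext j; fin_cases j <;> rfl
    have h := (m 2).map_update_add ![a, x] 1 x y
    rwa [hu, hu, hu] at h
  have hdeg (i j : ZMod 2) (x y : A) (hx : x ∈ 𝒜 i) (hy : y ∈ 𝒜 j) :
      m 2 ![x, y] ∈ 𝒜 (i + j) := by
    have h := hm.degree 2 ![i, j] ![x, y] (by
      intro k
      fin_cases k
      · exact hx
      · exact hy)
    have h2 : ((2 : ℕ) : ZMod 2) + ∑ k, ![i, j] k = i + j := by
      rw [Fin.sum_univ_two]
      change (0 : ZMod 2) + (i + j) = _
      rw [zero_add]
    rwa [h2] at h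
  have hkill (i : ZMod 2) (a : A) (ha : a ∈ 𝒜 i) : m 2 ![e₁, a] = 0 := by
    refine eq_zero_of_mem_of_mem 𝒜 (i := i) (j := 1 + i) ?_ (hdeg 1 i e₁ a h1 ha) (by simp)
    have h : m 2 ![e₁, a] = a - m 2 ![e₀, a] := by
      rw [eq_sub_iff_add_eq', ← hadd, hsum, he.left]
    rw [h]
    have h' := hdeg 0 i e₀ a h0 ha
    rw [zero_add] at h'
    exact Submodule.sub_mem _ ha h'
  have h2 : e₁ = 0 := by
    rw [← he.right e₁, ← hsum, hadd', hkill 0 e₀ h0, hkill 1 e₁ h1, add_zero]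
  rw [← hsum, h2, add_zero]
  exact h0

/-- The form `⟨m_k (a_0, …, a_{k-1}), a_k⟩`. -/
def cyclicForm (B : LinearMap.BilinForm K A)
    (m : ∀ k : ℕ, MultilinearMap K (fun _ : Fin k => A) A) (k : ℕ) :
    MultilinearMap K (fun _ : Fin (k + 1) => A) K :=
  MultilinearMap.uncurryRight (M := fun _ : Fin (k + 1) => A) (B.compMultilinearMap (m k))

theorem cyclicForm_apply (k : ℕ) (a : Fin (k + 1) → A) :
    cyclicForm B m k a = B (m k (Fin.init a)) (a (Fin.last k)) := rfl

/-- If the unit stands in the last slot, outside m_k, cyclicity rotates it inside. -/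
theorem cyclicForm_unit_eq_zero (he : IsStrictUnit m e) (hcyc : IsCyclicStructure 𝒜 B m) {k : ℕ}
    (hk : 1 ≤ k) (hk2 : k ≠ 2) {q : Fin (k + 1) → ZMod 2} {a : Fin (k + 1) → A}
    (ha : ∀ j, a j ∈ 𝒜 (q j)) {t : Fin (k + 1)} (ht : a t = e) : cyclicForm B m k a = 0 := by
  rw [cyclicForm_apply]
  rcases Fin.eq_castSucc_or_eq_last t with ⟨j, rfl⟩ | rfl
  · rw [he.zero k hk2 (Fin.init a) ⟨j, ht⟩, map_zero, LinearMap.zero_apply]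
  · obtain ⟨k, rfl⟩ : ∃ l, k = l + 1 := ⟨k - 1, by omega⟩
    rw [hcyc (k + 1) hk q a ha, he.zero (k + 1) hk2 (Fin.tail a) ⟨Fin.last k, by
      rw [← ht]; rfl⟩, map_zero, LinearMap.zero_apply, mul_zero]

/-- In the last slot, rotation gives ⟨y, x⟩ with the sign that graded symmetry removes again; the
even unit contributes no sign. -/
theorem cyclicForm_two_unit (he : IsStrictUnit m e) (hB : IsOddInnerProduct 𝒜 B)
    (hcyc : IsCyclicStructure 𝒜 B m) (he0 : e ∈ 𝒜 0) {i j : ZMod 2} {x y : A} (hx : x ∈ 𝒜 i)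
    (hy : y ∈ 𝒜 j) (t : Fin 3) : cyclicForm B m 2 (Fin.insertNth t e ![x, y]) = B x y := by
  fin_cases t
  · change B (m 2 _) _ = _
    have h : (Fin.init (Fin.insertNth 0 e ![x, y] : Fin 3 → A)) = ![e, x] := by
      funext j; fin_cases j <;> rfl
    exact (congrArg (fun z => B (m 2 z) y) h).trans (by rw [he.left])
  · change B (m 2 _) _ = _
    have h : (Fin.init (Fin.insertNth 1 e ![x, y] : Fin 3 → A)) = ![x, e] := by
      funext j; fin_cases j <;> rfl
    exact (congrArg (fun z => B (m 2 z) y) h).trans (by rw [he.right])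
  · have h0 : (Fin.insertNth 2 e ![x, y] : Fin 3 → A) = ![x, y, e] := by
      funext j; fin_cases j <;> rfl
    have h1 := hcyc 2 one_le_two ![i, j, 0] ![x, y, e] (by
      intro l
      fin_cases l
      · exact hx
      · exact hy
      · exact he0)
    have h2 : Fin.tail ![x, y, e] = ![y, e] := by
      funext j; fin_cases j <;> rfl
    have h3 : ∑ l, Fin.tail ![i, j, 0] l = j := by
      rw [Fin.sum_univ_two]
      exact add_zero j
    change cyclicForm B m 2 (Fin.insertNth 2 e ![x, y]) = _
    rw [h0, cyclicForm_apply, h1, h2, h3, he.right, hB.symm i j x y hx hy]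
    simp

end CyclicForm

/-! ### Coefficients of the cyclic tensors -/

section CyclicTensor

variable {K A : Type*} [Field K] [AddCommGroup A] [Module K A]
  {𝒜 : ZMod 2 → Submodule K A} {B : LinearMap.BilinForm K A}
  {m : ∀ k : ℕ, MultilinearMap K (fun _ : Fin k => A) A} {e : A}
  {ι : Type*} {b : Module.Basis ι K A} {π : ι → ZMod 2} {N : ℕ}

/-- The sign of the suspension. -/
def suspensionSign (K : Type*) [Field K] (k : ℕ) (q : Fin (k + 1) → ZMod 2) : K :=
  (-1) ^ (∑ j : Fin (k + 1), (k - (j : ℕ)) * (q j).val)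

/-- The trace of a product of matrix units. -/
def unitTrace (K : Type*) [Field K] (k : ℕ) (u : Fin (k + 1) → Fin N × Fin N) : K :=
  ∑ t : Fin (k + 1) → Fin N,
    if (t 0 = (u (Fin.last k)).2 ∧ t (Fin.last k) = (u (Fin.last k)).1) ∧
      ∀ j : Fin k, u j.castSucc = (t j.castSucc, t j.succ) then 1 else 0

/-- On elementary tensors b_i ⊗ E_rs the suspension sign, the matrix part and the form on A
separate, so contraction with the unit can be studied in each factor. -/
theorem cyclicTensor_eq (k : ℕ) (w : Fin (k + 1) → MatIndex ι N) :
    cyclicTensor B m b π N k w = suspensionSign K k (fun j => π (w j).1) *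
      (unitTrace K k (fun j => (w j).2) * cyclicForm B m k fun j => b (w j).1) := by
  have hm (t : Fin (k + 1) → Fin N) :
      (m k fun j => matBasis b (w j.castSucc) (t j.castSucc) (t j.succ)) =
        if ∀ j : Fin k, (w j.castSucc).2 = (t j.castSucc, t j.succ) then
          m k fun j => b (w j.castSucc).1 else 0 := by
    split_ifs with h
    · congr 1
      funext j
      rw [matBasis, h j]
      simp
    · rw [not_forall] at h
      obtain ⟨j, hj⟩ := h
      refine (m k).map_coord_zero j ?_
      rw [matBasis, Matrix.single_apply, if_neg]
      exact fun h => hj (Prod.ext h.1 h.2)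
  rw [cyclicTensor]
  congr 1
  have hpair (X : Matrix (Fin N) (Fin N) A) (L : MatIndex ι N) :
      matrixPairing B N X (matBasis b L) = B (X L.2.2 L.2.1) (b L.1) := by
    rw [matrixPairing, Finset.sum_eq_single L.2.2, Finset.sum_eq_single L.2.1]
    · simp [matBasis]
    · intro y _ hy
      rw [matBasis, Matrix.single_apply, if_neg fun h => hy h.1.symm, map_zero]
    · simp
    · intro x _ hx
      refine Finset.sum_eq_zero fun y _ => ?_
      rw [matBasis, Matrix.single_apply, if_neg fun h => hx h.2.symm, map_zero]
    · simp
  rw [hpair, matrixStructure, Matrix.of_apply, map_sum, LinearMap.sum_apply, unitTrace,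
    Finset.sum_mul]
  refine Finset.sum_congr rfl fun t _ => ?_
  rw [hm]
  by_cases h1 : t 0 = (w (Fin.last k)).2.2 ∧ t (Fin.last k) = (w (Fin.last k)).2.1
  · by_cases h2 : ∀ j : Fin k, (w j.castSucc).2 = (t j.castSucc, t j.succ)
    · rw [if_pos h1, if_pos h2, if_pos ⟨h1, h2⟩, one_mul]
      rfl
    · rw [if_pos h1, if_neg h2, if_neg fun h => h2 h.2, zero_mul, map_zero, LinearMap.zero_apply]
  · rw [if_neg h1, if_neg fun h => h1 h.1, zero_mul, map_zero, LinearMap.zero_apply]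

theorem comp_insertNth {α β : Type*} (g : α → β) {n : ℕ} (t : Fin (n + 1)) (x : α)
    (f : Fin n → α) : (fun j => g ((Fin.insertNth t x f : Fin (n + 1) → α) j)) =
      Fin.insertNth t (g x) fun j => g (f j) :=
  Fin.eq_insertNth_iff.2 ⟨by rw [Fin.insertNth_apply_same], by
    funext j
    rw [Fin.removeNth, Fin.insertNth_apply_succAbove]⟩

/-- Only even basis vectors occur in e, so the suspension sign is constant and multilinearity
recombines the sum. -/
theorem sum_repr_cyclicTensor [Fintype ι] (hπ : ∀ i, b.repr e i ≠ 0 → π i = 0) (k : ℕ)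
    (t : Fin (k + 1)) (r s : Fin N) (w : Fin k → MatIndex ι N) :
    ∑ i, b.repr e i * cyclicTensor B m b π N k (Fin.insertNth t (i, r, s) w) =
      suspensionSign K k (Fin.insertNth t 0 fun j => π (w j).1) *
        (unitTrace K k (Fin.insertNth t (r, s) fun j => (w j).2) *
          cyclicForm B m k (Fin.insertNth t e fun j => b (w j).1)) := by
  have h1 : cyclicForm B m k (Fin.insertNth t e fun j => b (w j).1) =
      ∑ i, b.repr e i * cyclicForm B m k (Fin.insertNth t (b i) fun j => b (w j).1) := by
    have h := (cyclicForm B m k).map_update_sum Finset.univ t (fun i => b.repr e i • b i)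
      (Fin.insertNth t 0 fun j => b (w j).1)
    simp only [Fin.update_insertNth, b.sum_repr] at h
    rw [h]
    refine Finset.sum_congr rfl fun i _ => ?_
    have h2 := (cyclicForm B m k).map_update_smul (Fin.insertNth t 0 fun j => b (w j).1) t
      (b.repr e i) (b i)
    simpa only [Fin.update_insertNth, smul_eq_mul] using h2
  rw [h1, Finset.mul_sum, Finset.mul_sum]
  refine Finset.sum_congr rfl fun i _ => ?_
  by_cases hi : b.repr e i = 0
  · rw [hi, zero_mul, zero_mul, mul_zero, mul_zero]
  · rw [cyclicTensor_eq, comp_insertNth (fun J : MatIndex ι N => π J.1),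
      comp_insertNth (fun J : MatIndex ι N => J.2), comp_insertNth (fun J : MatIndex ι N => b J.1),
      hπ i hi]
    ring

theorem unitTrace_two (u₀ u₁ u₂ : Fin N × Fin N) : unitTrace K 2 ![u₀, u₁, u₂] =
    if u₀.1 = u₂.2 ∧ u₀.2 = u₁.1 ∧ u₁.2 = u₂.1 then 1 else 0 := by
  -- The first two matrix units determine the only possible path.
  rw [unitTrace, Finset.sum_eq_single ![u₀.1, u₁.1, u₁.2]]
  · refine if_congr ?_ rfl rfl
    rw [Fin.forall_fin_two]
    simp only [Prod.ext_iff]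
    change (u₀.1 = u₂.2 ∧ u₁.2 = u₂.1) ∧ (u₀.1 = u₀.1 ∧ u₀.2 = u₁.1) ∧
      (u₁.1 = u₁.1 ∧ u₁.2 = u₁.2) ↔ _
    tauto
  · intro t _ ht
    refine if_neg fun h => ht ?_
    have h0 := h.2 0
    have h1 := h.2 1
    change u₀ = (t 0, t 1) at h0
    change u₁ = (t 1, t 2) at h1
    rw [h0, h1]
    funext j
    fin_cases j <;> rfl
  · simp

theorem suspensionSign_two (q₀ q₁ q₂ : ZMod 2) :
    suspensionSign K 2 ![q₀, q₁, q₂] = sgn K q₁ 1 := by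
  rw [suspensionSign, Fin.sum_univ_three, ← neg_one_pow_val]
  change (-1 : K) ^ (2 * q₀.val + 1 * q₁.val + 0 * q₂.val) = _
  rw [zero_mul, add_zero, one_mul, pow_add, pow_mul]
  norm_num

/-- The degree k of m_k, the oddness of the pairing and the k+1 parity shifts add up to zero modulo
2. -/
theorem parity_of_cyclicTensor_ne_zero [DirectSum.Decomposition 𝒜] (hb : ∀ i, b i ∈ 𝒜 (π i))
    (hB : IsOddInnerProduct 𝒜 B) (hm : IsAInfinity 𝒜 m) {k : ℕ} {w : Fin (k + 1) → MatIndex ι N}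
    (h : cyclicTensor B m b π N k w ≠ 0) : ∑ j, shiftParity π N (w j) = 0 := by
  rw [cyclicTensor_eq, cyclicForm_apply] at h
  have h1 := hm.degree k (fun j => π (w j.castSucc).1) (fun j => b (w j.castSucc).1)
    fun j => hb _
  have h2 : (k : ZMod 2) + ∑ j : Fin k, π (w j.castSucc).1 + π (w (Fin.last k)).1 = 1 := by
    by_contra hne
    refine h ?_
    have h3 := hB.odd _ _ _ _ h1 (hb (w (Fin.last k)).1) hne
    rw [show B (m k (Fin.init fun j => b (w j).1)) (b (w (Fin.last k)).1) = 0 from h3, mul_zero,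
      mul_zero]
  simp only [shiftParity, Finset.sum_add_distrib, Finset.sum_const, Finset.card_univ,
    Fintype.card_fin, nsmul_eq_mul, mul_one]
  rw [Fin.sum_univ_castSucc, Nat.cast_add, Nat.cast_one]
  have h4 : ∑ j : Fin k, π (w j.castSucc).1 + π (w (Fin.last k)).1 + ((k : ZMod 2) + 1) =
      ((k : ZMod 2) + ∑ j : Fin k, π (w j.castSucc).1 + π (w (Fin.last k)).1) + 1 := by ring
  rw [h4, h2]
  rfl

end CyclicTensor

/-! ## Contraction with the unit -/

section UnitContraction

open FormalFunctions

variable {K A : Type*} [Field K] [AddCommGroup A] [Module K A]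
  {𝒜 : ZMod 2 → Submodule K A} {B : LinearMap.BilinForm K A}
  {m : ∀ k : ℕ, MultilinearMap K (fun _ : Fin k => A) A} {e : A}
  {ι : Type*} {b : Module.Basis ι K A} {π : ι → ZMod 2} {N : ℕ}

/-- Half of the Hamiltonian of a matrix unit, on a pair of basis vectors. -/
noncomputable def halfHamiltonian (B : LinearMap.BilinForm K A) (b : Module.Basis ι K A)
    (π : ι → ZMod 2) (r s : Fin N) (J L : MatIndex ι N) : K :=
  if r = L.2.2 ∧ s = J.2.1 ∧ J.2.2 = L.2.1 then sgn K (π J.1) 1 * B (b J.1) (b L.1) else 0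

/-- Traces and signs are cyclically invariant, so inserting the unit into any of the three slots
gives the same function, up to the order of the two remaining arguments. -/
theorem unitContraction_slot (hb : ∀ i, b i ∈ 𝒜 (π i)) (hB : IsOddInnerProduct 𝒜 B)
    (hcyc : IsCyclicStructure 𝒜 B m) (he : IsStrictUnit m e) (he0 : e ∈ 𝒜 0) (r s : Fin N)
    (J L : MatIndex ι N) (t : Fin 3) :
    sgn K 1 (wordParity (shiftParity π N) ((List.ofFn ![J, L]).take t)) *
      (suspensionSign K 2 (Fin.insertNth t 0 fun j => π ((![J, L] : Fin 2 → MatIndex ι N) j).1) *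
        (unitTrace K 2 (Fin.insertNth t (r, s) fun j => ((![J, L] : Fin 2 → MatIndex ι N) j).2) *
          cyclicForm B m 2 (Fin.insertNth t e fun j =>
            b ((![J, L] : Fin 2 → MatIndex ι N) j).1))) =
      if t = 1 then halfHamiltonian B b π r s L J else halfHamiltonian B b π r s J L := by
  have h1 : (fun j => π ((![J, L] : Fin 2 → MatIndex ι N) j).1) = ![π J.1, π L.1] := by
    funext j; fin_cases j <;> rfl
  have h2 : (fun j => ((![J, L] : Fin 2 → MatIndex ι N) j).2) = ![J.2, L.2] := by
    funext j; fin_cases j <;> rfl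
  have h3 : (fun j => b ((![J, L] : Fin 2 → MatIndex ι N) j).1) = ![b J.1, b L.1] := by
    funext j; fin_cases j <;> rfl
  have h4 {α : Type _} (x y z : α) : (Fin.insertNth 0 x ![y, z] : Fin 3 → α) = ![x, y, z] := by
    funext j; fin_cases j <;> rfl
  have h5 {α : Type _} (x y z : α) : (Fin.insertNth 1 x ![y, z] : Fin 3 → α) = ![y, x, z] := by
    funext j; fin_cases j <;> rfl
  have h6 {α : Type _} (x y z : α) : (Fin.insertNth 2 x ![y, z] : Fin 3 → α) = ![y, z, x] := by
    funext j; fin_cases j <;> rfl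
  rw [h1, h2, h3, cyclicForm_two_unit he hB hcyc he0 (hb J.1) (hb L.1)]
  have hL : List.ofFn ![J, L] = [J, L] := rfl
  rw [hL]
  have hzero : sgn K 1 (wordParity (shiftParity π N) []) = 1 := sgn_zero_right 1
  fin_cases t
  · change sgn K 1 (wordParity (shiftParity π N) []) * (suspensionSign K 2
      (Fin.insertNth 0 0 ![π J.1, π L.1]) * (unitTrace K 2 (Fin.insertNth 0 (r, s) ![J.2, L.2]) *
        _)) = halfHamiltonian B b π r s J L
    rw [hzero, h4, h4, suspensionSign_two, unitTrace_two, halfHamiltonian, one_mul, ite_mul,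
      one_mul, zero_mul, mul_ite, mul_zero]
  · change sgn K 1 (wordParity (shiftParity π N) [J]) * (suspensionSign K 2
      (Fin.insertNth 1 0 ![π J.1, π L.1]) * (unitTrace K 2 (Fin.insertNth 1 (r, s) ![J.2, L.2]) *
        _)) = halfHamiltonian B b π r s L J
    rw [wordParity_singleton, shiftParity, sgn_comm, sgn_add_one_left, h5, h5, suspensionSign_two,
      unitTrace_two, halfHamiltonian, sgn_zero_left, one_mul, hB.basis_comm hb L.1 J.1]
    by_cases h0 : B (b J.1) (b L.1) = 0
    · simp [h0]
    · rw [hB.parity_of_ne_zero hb h0, sgn_add_one_left, ite_mul, one_mul, zero_mul, mul_ite,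
        mul_zero]
      refine if_congr ?_ rfl rfl
      constructor
      · rintro ⟨x, y, z⟩
        exact ⟨y.symm, z, x.symm⟩
      · rintro ⟨x, y, z⟩
        exact ⟨z.symm, x.symm, y⟩
  · change sgn K 1 (wordParity (shiftParity π N) [J, L]) * (suspensionSign K 2
      (Fin.insertNth 2 0 ![π J.1, π L.1]) * (unitTrace K 2 (Fin.insertNth 2 (r, s) ![J.2, L.2]) *
        _)) = halfHamiltonian B b π r s J L
    rw [wordParity_pair, shiftParity, shiftParity, h6, h6, suspensionSign_two, unitTrace_two,
      halfHamiltonian, sgn_add, sgn_comm 1, sgn_comm 1, sgn_add_one_left, sgn_add_one_left,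
      ite_mul, one_mul, zero_mul, mul_ite, mul_ite, mul_zero, mul_zero]
    refine if_congr ?_ ?_ rfl
    · constructor
      · rintro ⟨x, y, z⟩
        exact ⟨z.symm, x.symm, y⟩
      · rintro ⟨x, y, z⟩
        exact ⟨y.symm, z, x.symm⟩
    · linear_combination sgn K (π J.1) 1 * B (b J.1) (b L.1) * sgn_mul_self (K := K) (π L.1) 1

theorem sgn_mul_halfHamiltonian (hb : ∀ i, b i ∈ 𝒜 (π i)) (hB : IsOddInnerProduct 𝒜 B)
    (r s : Fin N) (J L : MatIndex ι N) :
    sgn K (shiftParity π N J) (shiftParity π N L) * halfHamiltonian B b π r s J L =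
      halfHamiltonian B b π r s J L := by
  rw [halfHamiltonian]
  split_ifs
  · by_cases h0 : B (b J.1) (b L.1) = 0
    · simp [h0]
    · rw [shiftParity, shiftParity, hB.parity_of_ne_zero hb h0]
      rcases zmod_two_cases (π J.1) with h | h <;> rw [h]
      · rw [zero_add, zmod_two_one_add_one, sgn_zero_right, one_mul]
      · rw [zmod_two_one_add_one, sgn_zero_left, one_mul]
  · rw [mul_zero]

variable [Fintype ι]

/-- The contraction with `Σ (e ⊗ E_{rs})`. -/
noncomputable def unitContraction (b : Module.Basis ι K A) (π : ι → ZMod 2) (e : A)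
    (r s : Fin N) :
    FormalFunctions K (shiftParity π N) →ₗ[K] FormalFunctions K (shiftParity π N) :=
  ∑ i, b.repr e i • derivHom (i, r, s)

theorem unitContraction_eq (r s : Fin N) (f : FormalFunctions K (shiftParity π N)) :
    unitContraction b π e r s f = ∑ i, b.repr e i • deriv (i, r, s) f := by
  rw [unitContraction, LinearMap.sum_apply]
  rfl

theorem unitContraction_apply (r s : Fin N) (f : FormalFunctions K (shiftParity π N))
    (w : List (MatIndex ι N)) : (unitContraction b π e r s f : List (MatIndex ι N) → K) w =
      ∑ i, b.repr e i * (f : List (MatIndex ι N) → K) ((i, r, s) :: w) := by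
  rw [unitContraction_eq, coe_sum_apply]
  rfl

theorem lTilde_apply {k : ℕ} {w : List (MatIndex ι N)} (hw : w.length = k + 2) :
    (lTilde B m b π N : List (MatIndex ι N) → K) w = ((k + 2 : ℕ) : K)⁻¹ *
      (ofTensor (shiftParity π N) (k + 2) (cyclicTensor B m b π N (k + 1)) :
        List (MatIndex ι N) → K) w := by
  rw [lTilde, formalSum]
  simp only
  rw [hw]
  rfl

theorem lTilde_apply_of_length_le {w : List (MatIndex ι N)} (hw : w.length ≤ 1) :
    (lTilde B m b π N : List (MatIndex ι N) → K) w = 0 := by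
  rw [lTilde, formalSum]
  simp only
  obtain h | h : w.length = 0 ∨ w.length = 1 := by omega
  · rw [h]
    rfl
  · rw [h]
    rfl

theorem lTilde_even [DirectSum.Decomposition 𝒜] (hb : ∀ i, b i ∈ 𝒜 (π i))
    (hB : IsOddInnerProduct 𝒜 B) (hm : IsAInfinity 𝒜 m) : HasParity 0 (lTilde B m b π N) := by
  intro w hw
  by_cases h : w.length ≤ 1
  · exact lTilde_apply_of_length_le h
  · obtain ⟨k, hk⟩ : ∃ k, w.length = k + 2 := ⟨w.length - 2, by omega⟩
    rw [lTilde_apply hk, ofTensor_hasParity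
      (fun v hv => parity_of_cyclicTensor_ne_zero hb hB hm hv) w hw, mul_zero]

theorem unitContraction_lTilde (hπ : ∀ i, b.repr e i ≠ 0 → π i = 0) (r s : Fin N) {k : ℕ}
    {w : List (MatIndex ι N)} (hw : w.length = k + 1) :
    (unitContraction b π e r s (lTilde B m b π N) : List (MatIndex ι N) → K) w =
      ((k + 2 : ℕ) : K)⁻¹ * ∑ t : Fin (k + 2), (ofTensor (shiftParity π N) (k + 1) fun v =>
        sgn K 1 (wordParity (shiftParity π N) ((List.ofFn v).take t)) *
          (suspensionSign K (k + 1) (Fin.insertNth t 0 fun j => π (v j).1) *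
            (unitTrace K (k + 1) (Fin.insertNth t (r, s) fun j => (v j).2) *
              cyclicForm B m (k + 1) (Fin.insertNth t e fun j => b (v j).1))) :
        List (MatIndex ι N) → K) w := by
  have h := contract_ofTensor (p := shiftParity π N) (v := fun i => b.repr e i)
    (e := fun i => ((i, r, s) : MatIndex ι N)) (q := 1) (fun i hi => by
      rw [shiftParity, hπ i hi, zero_add]) (k + 1) (cyclicTensor B m b π N (k + 1))
  simp only [sum_repr_cyclicTensor hπ] at h
  rw [← coe_sum_apply, ← h, coe_sum_apply, unitContraction_apply, Finset.mul_sum]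
  refine Finset.sum_congr rfl fun i _ => ?_
  rw [lTilde_apply (k := k) (by rw [List.length_cons, hw]), mul_left_comm]
  rfl

theorem unitContraction_lTilde_of_length_ne [DirectSum.Decomposition 𝒜]
    (hb : ∀ i, b i ∈ 𝒜 (π i)) (hcyc : IsCyclicStructure 𝒜 B m) (he : IsStrictUnit m e)
    (he0 : e ∈ 𝒜 0) (r s : Fin N) {w : List (MatIndex ι N)} (hw : w.length ≠ 2) :
    (unitContraction b π e r s (lTilde B m b π N) : List (MatIndex ι N) → K) w = 0 := by
  rcases hk : w.length with _ | k
  · rw [unitContraction_apply]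
    exact Finset.sum_eq_zero fun i _ => by
      rw [lTilde_apply_of_length_le (by rw [List.length_cons, hk]), mul_zero]
  · rw [unitContraction_lTilde (fun i hi => parity_of_repr_ne_zero hb he0 hi) r s hk]
    rw [Finset.sum_eq_zero, mul_zero]
    intro t _
    rw [ofTensor_eq_zero]
    · rfl
    · intro v
      have hhom (j : Fin (k + 2)) :
          (Fin.insertNth t e fun j => b (v j).1 : Fin (k + 2) → A) j ∈
            𝒜 ((Fin.insertNth t 0 fun j => π (v j).1 : Fin (k + 2) → ZMod 2) j) := by
        rcases Fin.eq_self_or_eq_succAbove t j with rfl | ⟨l, rfl⟩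
        · rw [Fin.insertNth_apply_same, Fin.insertNth_apply_same]
          exact he0
        · rw [Fin.insertNth_apply_succAbove, Fin.insertNth_apply_succAbove]
          exact hb _
      rw [cyclicForm_unit_eq_zero he hcyc (by omega) (by omega) hhom
        (Fin.insertNth_apply_same t _ _), mul_zero, mul_zero, mul_zero]

/-- After symmetrisation the three slots contribute equally, cancelling the coefficient 1/3 of the
cubic term. -/
theorem unitContraction_lTilde_pair [CharZero K] [DirectSum.Decomposition 𝒜]
    (hb : ∀ i, b i ∈ 𝒜 (π i)) (hB : IsOddInnerProduct 𝒜 B) (hcyc : IsCyclicStructure 𝒜 B m)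
    (he : IsStrictUnit m e) (he0 : e ∈ 𝒜 0) (r s : Fin N) (J L : MatIndex ι N) :
    (unitContraction b π e r s (lTilde B m b π N) : List (MatIndex ι N) → K) [J, L] =
      halfHamiltonian B b π r s J L + halfHamiltonian B b π r s L J := by
  refine (unitContraction_lTilde (fun i hi => parity_of_repr_ne_zero hb he0 hi) r s
    (k := 1) rfl).trans ((congrArg _ (Finset.sum_congr (g := fun _ =>
      halfHamiltonian B b π r s J L + halfHamiltonian B b π r s L J) rfl fun t _ =>
      (ofTensor_two_apply _ J L).trans ?_)).trans ?_)
  · refine (congrArg₂ (fun x y => x + sgn K (shiftParity π N J) (shiftParity π N L) * y)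
      (unitContraction_slot hb hB hcyc he he0 r s J L t)
      (unitContraction_slot hb hB hcyc he he0 r s L J t)).trans ?_
    split_ifs
    · rw [sgn_mul_halfHamiltonian hb hB, add_comm]
    · rw [sgn_comm, sgn_mul_halfHamiltonian hb hB]
  · rw [Finset.sum_const, Finset.card_univ, Fintype.card_fin, nsmul_eq_mul, ← mul_assoc,
      inv_mul_cancel₀ (Nat.cast_ne_zero.2 (by omega)), one_mul]

variable [DecidableEq ι]

/-- The two terms of the commutator [E_rs, -] give the two orders of the arguments. This identifies
the contraction of x₀ with the Hamiltonian of ad E_rs. -/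
theorem sum_adMatrix_sympGram (hb : ∀ i, b i ∈ 𝒜 (π i)) (hB : IsOddInnerProduct 𝒜 B)
    (r s : Fin N) (J L : MatIndex ι N) :
    ∑ M, adMatrix ι (Matrix.single r s (1 : K)) M L * sympGram B b π N M J =
      halfHamiltonian B b π r s J L + halfHamiltonian B b π r s L J := by
  have had (M : MatIndex ι N) : adMatrix ι (Matrix.single r s (1 : K)) M L =
      (if M = (L.1, r, L.2.2) then if s = L.2.1 then (1 : K) else 0 else 0) -
        if M = (L.1, L.2.1, s) then if L.2.2 = r then (1 : K) else 0 else 0 := by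
    rw [adMatrix_single_apply]
    simp only [Prod.ext_iff]
    grind
  simp only [had, sub_mul, Finset.sum_sub_distrib, ite_mul, zero_mul, one_mul,
    Finset.sum_ite_eq', Finset.mem_univ, if_true, sympGram_apply, halfHamiltonian]
  have hs : sgn K (π J.1) 1 * B (b J.1) (b L.1) = -(sgn K (π L.1) 1 * B (b L.1) (b J.1)) := by
    rw [hB.basis_comm hb L.1 J.1]
    by_cases h0 : B (b J.1) (b L.1) = 0
    · rw [h0, mul_zero, mul_zero, neg_zero]
    · rw [hB.parity_of_ne_zero hb h0, sgn_add_one_left, neg_mul, neg_neg]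
  rw [hs]
  generalize sgn K (π L.1) 1 * B (b L.1) (b J.1) = c
  grind

end UnitContraction

/-! ### The Cartan calculus of the unit -/

section CartanCalculus

open FormalFunctions

variable {K A : Type*} [Field K] [AddCommGroup A] [Module K A]
  {𝒜 : ZMod 2 → Submodule K A} [DirectSum.Decomposition 𝒜] {B : LinearMap.BilinForm K A}
  {m : ∀ k : ℕ, MultilinearMap K (fun _ : Fin k => A) A} {e : A}
  {ι : Type*} [Fintype ι] {b : Module.Basis ι K A} {π : ι → ZMod 2} {N : ℕ}

/-- A formal function that is supported on the words of length `2` is quadratic. -/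
theorem deriv_eq_sum_coord {K I : Type*} [Field K] [Fintype I] {p : I → ZMod 2}
    {f : FormalFunctions K p} (hf : ∀ w : List I, w.length ≠ 2 → (f : List I → K) w = 0) (k : I) :
    deriv k f = ∑ l, (f : List I → K) [k, l] • coord l := by
  classical
  refine ext_coeff fun w => ?_
  rw [coe_sum_apply]
  simp only [Submodule.coe_smul, Pi.smul_apply, coord_apply, smul_eq_mul]
  by_cases hw : ∃ j, w = [j]
  · obtain ⟨j, rfl⟩ := hw
    simp [deriv_apply]
  · rw [Finset.sum_eq_zero fun l _ => by rw [if_neg fun h => hw ⟨l, h⟩, mul_zero], deriv_apply,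
      hf]
    intro h
    rw [List.length_cons] at h
    exact hw (List.length_eq_one_iff.1 (by omega))

theorem unitContraction_hasParity (hb : ∀ i, b i ∈ 𝒜 (π i)) (he0 : e ∈ 𝒜 0) (r s : Fin N)
    {a : ZMod 2} {f : FormalFunctions K (shiftParity π N)} (hf : HasParity a f) :
    HasParity (a + 1) (unitContraction b π e r s f) := by
  rw [unitContraction_eq]
  refine HasParity.sum fun i _ => ?_
  by_cases hi : b.repr e i = 0
  · rw [hi, zero_smul]
    exact HasParity.zero _
  · have h := hf.deriv ((i, r, s) : MatIndex ι N)
    rw [shiftParity, parity_of_repr_ne_zero hb he0 hi, zero_add] at h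
    exact h.smul _

variable [DecidableEq ι]

theorem glForm_mul_sgn_eq (J L : MatIndex ι N) :
    glForm B b π N J L * sgn K (shiftParity π N L) 1 = (sympGram B b π N)⁻¹ J L := by
  rw [glForm, inverseForm, Matrix.of_apply, neg_one_pow_val, mul_assoc, sgn_mul_self, mul_one]

variable [CharZero K]

/-- The contractions with the unit form a Cartan calculus on `Ŝ (Σ gl_N(A))^*`. -/
theorem isCartan_unitContraction (hb : ∀ i, b i ∈ 𝒜 (π i)) (hB : IsOddInnerProduct 𝒜 B)
    (hm : IsAInfinity 𝒜 m) (hcyc : IsCyclicStructure 𝒜 B m) (he : IsStrictUnit m e) :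
    IsCartan (glForm B b π N) (lTilde B m b π N) (unitContraction b π e) := by
  have he0 : e ∈ 𝒜 0 := he.even hm
  have hP : IsOddSymmetric (shiftParity π N) (glForm B b π N) := glForm_isOddSymmetric hB hb
  have heven : HasParity 0 (lTilde B m b π N) := lTilde_even hb hB hm
  have hlen (r s : Fin N) (w : List (MatIndex ι N)) (hw : w.length ≠ 2) :
      (unitContraction b π e r s (lTilde B m b π N) : List (MatIndex ι N) → K) w = 0 :=
    unitContraction_lTilde_of_length_ne hb hcyc he he0 r s hw
  refine ⟨hP, heven, fun r s a f hf => unitContraction_hasParity hb he0 r s hf, ?_, ?_, ?_⟩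
  -- Every coordinate derivative occurring in the contraction is odd because e is even; an odd
  -- derivative is a derivation of the odd bracket with these signs on an even first argument.
  · intro r s f
    rw [unitContraction_eq, unitContraction_eq, unitContraction_eq, poisson_sum_left,
      poisson_sum_right, ← Finset.sum_neg_distrib, ← Finset.sum_sub_distrib]
    refine Finset.sum_congr rfl fun i _ => ?_
    by_cases hi : b.repr e i = 0
    · rw [hi, zero_smul, zero_smul, zero_smul, poisson_zero_left, poisson_zero_right, neg_zero,
        sub_zero]
    · have h1 : shiftParity π N (i, r, s) = 1 := by
        rw [shiftParity, parity_of_repr_ne_zero hb he0 hi, zero_add]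
      rw [deriv_poisson hP heven, h1, zero_add, sgn_one_one, poisson_smul_left,
        poisson_smul_right, neg_smul_eq, neg_smul_eq, one_smul, one_smul, smul_add, smul_neg,
        smul_neg, sub_eq_add_neg]
  · intro r s f
    have hodd := unitContraction_hasParity hb he0 r s heven
    rw [zero_add] at hodd
    have h1 (k c : MatIndex ι N) : (unitContraction b π e r s (lTilde B m b π N) :
        List (MatIndex ι N) → K) [k, c] = ∑ M, adMatrix ι (Matrix.single r s (1 : K)) M c *
          sympGram B b π N M k := by
      rw [sum_adMatrix_sympGram hb hB, unitContraction_lTilde_pair hb hB hcyc he he0]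
    -- The inverse Gram matrix in the bracket cancels the Gram matrix in the quadratic Hamiltonian,
    -- leaving the matrix of ad E_rs.
    have h2 (l c : MatIndex ι N) : ∑ k, (sympGram B b π N)⁻¹ k l *
        ∑ M, adMatrix ι (Matrix.single r s (1 : K)) M c * sympGram B b π N M k =
          adMatrix ι (Matrix.single r s (1 : K)) l c := by
      simp only [Finset.mul_sum]
      rw [Finset.sum_comm]
      have h3 (M : MatIndex ι N) : ∑ k, (sympGram B b π N)⁻¹ k l *
          (adMatrix ι (Matrix.single r s (1 : K)) M c * sympGram B b π N M k) =
            adMatrix ι (Matrix.single r s (1 : K)) M c *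
              (1 : Matrix (MatIndex ι N) (MatIndex ι N) K) M l := by
        rw [← sympGram_mul_inv (π := π) (b := b) (N := N) hB, Matrix.mul_apply, Finset.mul_sum]
        exact Finset.sum_congr rfl fun k _ => by ring
      simp only [h3, Matrix.one_apply, mul_ite, mul_one, mul_zero, Finset.sum_ite_eq',
        Finset.mem_univ, if_true]
    rw [glHom_apply, glAct, linAct_eq_sum, poisson_eq_sum hodd, Finset.sum_comm,
      ← Finset.sum_neg_distrib]
    refine Finset.sum_congr rfl fun l _ => ?_
    simp only [deriv_eq_sum_coord (hlen r s), mul_sum_left, mul_smul_left, glForm_mul_sgn_eq, h1,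
      Finset.smul_sum, smul_smul]
    rw [Finset.sum_comm, ← Finset.sum_neg_distrib]
    refine Finset.sum_congr rfl fun c _ => ?_
    rw [← Finset.sum_smul, h2, Matrix.neg_apply, neg_smul_eq, neg_neg]
  -- The Hamiltonian is quadratic, so its Laplacian is constant and all its derivatives vanish.
  · intro r s f
    have h1 (k l : MatIndex ι N) : deriv k (twist (shiftParity π N l)
        (laplacian (glForm B b π N) (unitContraction b π e r s (lTilde B m b π N)))) = 0 := by
      refine ext_coeff fun w => ?_
      rw [deriv_apply, twist_apply, laplacian, Submodule.coe_smul, Pi.smul_apply, coe_sum_apply,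
        Finset.sum_eq_zero, smul_zero, mul_zero]
      · rfl
      · intro i _
        rw [coe_sum_apply]
        refine Finset.sum_eq_zero fun j _ => ?_
        rw [Submodule.coe_smul, Pi.smul_apply, deriv_apply, deriv_apply, hlen r s _ (by simp),
          smul_zero]
    rw [poisson]
    simp only [h1, mul_zero_left, smul_zero, Finset.sum_const_zero]

end CartanCalculus

end BVQuant

theorem mainTheorem11 {K A : Type*} [Field K] [CharZero K] [AddCommGroup A] [Module K A]
    (𝒜 : ZMod 2 → Submodule K A) [DirectSum.Decomposition 𝒜]
    {ι : Type*} [Fintype ι] [DecidableEq ι] (b : Module.Basis ι K A) (π : ι → ZMod 2)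
    (hb : ∀ i, b i ∈ 𝒜 (π i))
    (B : LinearMap.BilinForm K A) (hB : IsOddInnerProduct 𝒜 B)
    (m : ∀ k : ℕ, MultilinearMap K (fun _ : Fin k => A) A)
    (hm : IsAInfinity 𝒜 m) (hcyc : IsCyclicStructure 𝒜 B m) (hunit : IsUnital m) (N : ℕ) :
    Function.Bijective
        (Moduli.incl (glForm B b π N) (le_top : invariants K π N ≤ ⊤) (lTilde B m b π N)) ∧
      (∀ x : Quantization (glForm B b π N) ⊤ (lTilde B m b π N),
        ∃ x' : Quantization (glForm B b π N) (invariants K π N) (lTilde B m b π N),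
          GaugeEquiv (glForm B b π N) ⊤ x (x'.incl (glForm B b π N) le_top)) ∧
      (∀ x' x'' : Quantization (glForm B b π N) (invariants K π N) (lTilde B m b π N),
        GaugeEquiv (glForm B b π N) ⊤ (x'.incl (glForm B b π N) le_top)
            (x''.incl (glForm B b π N) le_top) →
          GaugeEquiv (glForm B b π N) (invariants K π N) x' x'') := by
  obtain ⟨e, he, he'⟩ := hunit
  exact (isCartan_unitContraction (N := N) hb hB hm hcyc
    (⟨fun a => (he a).1, fun a => (he a).2, he'⟩ : IsStrictUnit m e)).moduli_bijective
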